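/- **Model.** Let $S=\langle s_1,\dots,s_n\rangle$ be a sequence of $n\ge 2$ distinct elements of a linear order. The values cannot be inspected; elements can only be compared. The comparison of each pair of elements is wrong with probability $p$, independently over all pairs, and comparison errors are persistent (repeating a comparison gives the same outcome). Algorithms are fixed (size-independent) word-RAM programs with words of $O(\log n)$ bits, in which a comparison, a fair coin toss, a memory access and an arithmetic operation on words each take one step; running time is the number of steps. Write $\log$ for the binary logarithm and $|LIS(S)|$ for the length of a longest increasing subsequence of $S$. For an ordering $S^{apx}$ of the elements of $S$, let $\mathrm{pos}(x)$ be the position of $x$ in $S^{apx}$; the maximum dislocation of $S^{apx}$ is the maximum over all $x$ of $|\mathrm{pos}(x)-\mathrm{rank}(x)|$, where $\mathrm{rank}(x)$ is the true rank of $x$. A sequence $s'_1,\dots,s'_m$ is $2d$-distant in $S^{apx}$ if $\mathrm{pos}(s'_i)+2d\le \mathrm{pos}(s'_{i+1})$ for $1\le i<m$. **Approximation-Algorithm** (with an approximate sorting subroutine and an integer constant $c\geq 1$). Run the subroutine to obtain $S^{apx}$; set $d=c\lfloor\log n\rfloor$, $L[1]=s_1$, $k=1$. For $i=2,\dots,n$,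 let $x=s_i$: if $\mathrm{pos}(x)<\mathrm{pos}(L[1])$, set $L[1]=x$; otherwise find $j=\max\{j\le k:\mathrm{pos}(L[j])<\mathrm{pos}(x)\}$ by binary search, and if $\mathrm{pos}(L[j])+2d\le\mathrm{pos}(x)$, increase $k$ by one in case $j=k$, set $L[j+1]=x$ and $prec[x]=L[j]$. Finally return the sequence of length $k$ that ends with $L[k]$ and is obtained by following the pointers $prec$ backwards. **Theorem (Upper Bound).** There is an absolute constant $0<p_0<\frac12$ such that for every fixed error probability $0\le p\le p_0$ there are a (possibly randomized) approximate sorting subroutine and constants $c,C\geq 1$ for which the following holds for every $n\ge2$ and every sequence $S$ of $n$ distinct elements. 1. For all comparison outcomes and coin tosses, the Approximation-Algorithm halts after at most $C\,n\log n$ steps, the subroutine outputs an ordering $S^{apx}$ of the elements of $S$, and the returned sequence is a longest one among the subsequences of $S$ that are $2d$-distant in $S^{apx}$, where $d=c\lfloor\log n\rfloor$. 2. With probability at least $1-\frac1n$ (over the comparison errors and the coin tosses), $S^{apx}$ has maximum dislocation at most $d$, and the returned subsequence is increasing and has length at least $\frac{|LIS(S)|}{2d}$ and hence at least $\frac{|LIS(S)|}{C\log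 n}$. -/

import Mathlib

namespace NoisyLIS

/-! ## A word RAM with a comparison instruction, and its step count -/

/-- Arithmetic operations on words (`sub` truncates at `0`, `div` rounds down). -/
inductive Op
  | add | sub | mul | div

/-- The value of an arithmetic operation. -/
def Op.apply : Op → ℕ → ℕ → ℕ
  | .add, a, b => a + b
  | .sub, a, b => a - b
  | .mul, a, b => a * b
  | .div, a, b => a / b

/-- Expressions: literals, the input length, registers, array cells, arithmetic. -/
inductive RExp
  | lit (v : ℕ)
  | len
  | reg (r : ℕ)
  | cell (a : ℕ) (i : RExp)
  | op (o : Op) (x y : RExp)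

/-- A memory state: registers, arrays of cells, and the number of coins tossed so far. -/
structure State where
  reg : ℕ → ℕ
  arr : ℕ → ℕ → ℕ
  tossed : ℕ

/-- The initial state: all memory is `0` and no coin has been tossed. -/
def State.init : State := ⟨fun _ => 0, fun _ _ => 0, 0⟩

/-- Write `v` to register `r`. -/
def State.setReg (s : State) (r v : ℕ) : State :=
  { s with reg := Function.update s.reg r v }

/-- Write `v` to cell `i` of array `a`. -/
def State.setCell (s : State) (a i v : ℕ) : State :=
  { s with arr := Function.update s.arr a (Function.update (s.arr a) i v) }

/-- The value of an expression in a state, for an input of length `n`. -/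
def RExp.eval (n : ℕ) (s : State) : RExp → ℕ
  | .lit v => v
  | .len => n
  | .reg r => s.reg r
  | .cell a i => s.arr a (i.eval n s)
  | .op o x y => o.apply (x.eval n s) (y.eval n s)

/-- The time for evaluating an expression: one step for each of its nodes. -/
def RExp.cost : RExp → ℕ
  | .lit _ => 1
  | .len => 1
  | .reg _ => 1
  | .cell _ i => i.cost + 1
  | .op _ x y => x.cost + y.cost + 1

/-- Programs. The input elements are addressed by their index `0, …, n - 1` in the input
sequence. They are accessible only through `compare r x y`, which writes to register `r` the
outcome (`1` or `0`) of the comparison "element number `x` is observed to be smaller than element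
number `y`"; `toss r` writes a fair random bit to register `r`. Conditions are tests `x < y`. -/
inductive Program
  | skip
  | assign (r : ℕ) (x : RExp)
  | store (a : ℕ) (i x : RExp)
  | compare (r : ℕ) (x y : RExp)
  | toss (r : ℕ)
  | seq (P Q : Program)
  | ifLt (x y : RExp) (P Q : Program)
  | whileLt (x y : RExp) (P : Program)

/-- `Exec n obs coin W P s s' t`: for an input of length `n` with comparison outcomes `obs` and
coin tosses `coin`, the program `P` started in state `s` halts in state `s'` after exactly `t`
steps, and all values and addresses that it writes are words smaller than `W` (an execution that
would write a larger one does not halt properly and is not related to any `s'`). -/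
inductive Exec (n : ℕ) (obs : Fin n → Fin n → Bool) (coin : ℕ → Bool) (W : ℕ) :
    Program → State → State → ℕ → Prop
  | skip (s : State) : Exec n obs coin W .skip s s 1
  | assign (s : State) (r : ℕ) (x : RExp) (hx : x.eval n s < W) :
      Exec n obs coin W (.assign r x) s (s.setReg r (x.eval n s)) (x.cost + 1)
  | store (s : State) (a : ℕ) (i x : RExp) (hi : i.eval n s < W) (hx : x.eval n s < W) :
      Exec n obs coin W (.store a i x) s (s.setCell a (i.eval n s) (x.eval n s))
        (i.cost + x.cost + 1)
  | compare (s : State) (r : ℕ) (x y : RExp) (hx : x.eval n s < n) (hy : y.eval n s < n) :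
      Exec n obs coin W (.compare r x y) s
        (s.setReg r (obs ⟨x.eval n s, hx⟩ ⟨y.eval n s, hy⟩).toNat) (x.cost + y.cost + 1)
  | toss (s : State) (r : ℕ) :
      Exec n obs coin W (.toss r) s
        { s.setReg r (coin s.tossed).toNat with tossed := s.tossed + 1 } 1
  | seq {P Q : Program} {s s₁ s₂ : State} {t₁ t₂ : ℕ}
      (h₁ : Exec n obs coin W P s s₁ t₁) (h₂ : Exec n obs coin W Q s₁ s₂ t₂) :
      Exec n obs coin W (.seq P Q) s s₂ (t₁ + t₂)
  | ifTrue {P Q : Program} {x y : RExp} {s s' : State} {t : ℕ}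
      (h : x.eval n s < y.eval n s) (h₁ : Exec n obs coin W P s s' t) :
      Exec n obs coin W (.ifLt x y P Q) s s' (x.cost + y.cost + 1 + t)
  | ifFalse {P Q : Program} {x y : RExp} {s s' : State} {t : ℕ}
      (h : ¬ x.eval n s < y.eval n s) (h₂ : Exec n obs coin W Q s s' t) :
      Exec n obs coin W (.ifLt x y P Q) s s' (x.cost + y.cost + 1 + t)
  | whileTrue {P : Program} {x y : RExp} {s s₁ s₂ : State} {t₁ t₂ : ℕ}
      (h : x.eval n s < y.eval n s) (h₁ : Exec n obs coin W P s s₁ t₁)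
      (h₂ : Exec n obs coin W (.whileLt x y P) s₁ s₂ t₂) :
      Exec n obs coin W (.whileLt x y P) s s₂ (x.cost + y.cost + 1 + t₁ + t₂)
  | whileFalse {P : Program} {x y : RExp} {s : State}
      (h : ¬ x.eval n s < y.eval n s) :
      Exec n obs coin W (.whileLt x y P) s s (x.cost + y.cost + 1)

/-! ## The Approximation-Algorithm -/

/-- The array that holds the approximately sorted sequence `S^apx` (as input indices). -/
abbrev aApx : ℕ := 0
/-- The array that holds `pos(·, S^apx)`. -/
abbrev aPos : ℕ := 1
/-- The array `L`. -/
abbrev aL : ℕ := 2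
/-- The array `prec`. -/
abbrev aPrec : ℕ := 3
/-- The array that holds the returned subsequence (as input indices). -/
abbrev aLis : ℕ := 4
/-- The register `k`. -/
abbrev rK : ℕ := 0
/-- The register `d`. -/
abbrev rD : ℕ := 1
/-- The register `i`. -/
abbrev rI : ℕ := 2
/-- The register `j`. -/
abbrev rJ : ℕ := 3
/-- An auxiliary register (upper end of the binary search). -/
abbrev rH : ℕ := 4
/-- An auxiliary register. -/
abbrev rM : ℕ := 5

/-- `x + y` -/
abbrev RExp.plus (x y : RExp) : RExp := .op .add x y
/-- `x - y` -/
abbrev RExp.minus (x y : RExp) : RExp := .op .sub x y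

/-- Run a list of programs one after the other. -/
def Program.block : List Program → Program
  | [] => .skip
  | P :: l => .seq P (Program.block l)

open RExp Program in
/-- `for i = 0, …, n - 1 do pos[apx[i]] := i` -/
def computePos : Program := block [
  assign rI (lit 0),
  whileLt (reg rI) len (block [
    store aPos (cell aApx (reg rI)) (reg rI),
    assign rI (plus (reg rI) (lit 1))])]

open RExp Program in
/-- `d := c * ⌊log₂ n⌋` -/
def computeD (c : ℕ) : Program := block [
  assign rD (lit 0),
  assign rM len,
  whileLt (lit 1) (reg rM) (block [
    assign rM (op .div (reg rM) (lit 2)),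
    assign rD (plus (reg rD) (lit c))])]

open RExp Program in
/-- `j := max {j ≤ k | pos(L[j]) < pos(x)}` for the element `x` number `i`, by binary search,
when it is known that `pos(L[1]) < pos(x)` -/
def findJ : Program := block [
  assign rJ (lit 1),
  assign rH (plus (reg rK) (lit 1)),
  whileLt (plus (reg rJ) (lit 1)) (reg rH) (block [
    assign rM (op .div (plus (reg rJ) (reg rH)) (lit 2)),
    ifLt (cell aPos (cell aL (reg rM))) (cell aPos (reg rI))
      (assign rJ (reg rM))
      (assign rH (reg rM))])]

open RExp Program in
/-- The main loop: `L[1] := s₁; k := 1;` then every further element `x` is processed in turn.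
If `pos(x) < pos(L[1])` then `L[1] := x`, else `j := max {j ≤ k | pos(L[j]) < pos(x)}` and,
if `pos(L[j]) + 2d ≤ pos(x)`, then `k := k + 1` in case `j = k`, `L[j+1] := x` and
`prec[x] := L[j]`. -/
def mainLoop : Program := block [
  store aL (lit 1) (lit 0),
  assign rK (lit 1),
  assign rI (lit 1),
  whileLt (reg rI) len (block [
    ifLt (cell aPos (reg rI)) (cell aPos (cell aL (lit 1)))
      (store aL (lit 1) (reg rI))
      (block [
        findJ,
        ifLt (cell aPos (reg rI))
            (plus (cell aPos (cell aL (reg rJ))) (op .mul (lit 2) (reg rD)))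
          skip
          (block [
            ifLt (reg rJ) (reg rK) skip (assign rK (plus (reg rK) (lit 1))),
            store aL (plus (reg rJ) (lit 1)) (reg rI),
            store aPrec (reg rI) (cell aL (reg rJ))])]),
    assign rI (plus (reg rI) (lit 1))])]

open RExp Program in
/-- Follow the pointers `prec` from `L[k]` on and write the elements met to `lis`, from its
last cell `k - 1` down to its first cell `0`. -/
def recover : Program := block [
  assign rI (minus (reg rK) (lit 1)),
  store aLis (reg rI) (cell aL (reg rK)),
  whileLt (lit 0) (reg rI) (block [
    store aLis (minus (reg rI) (lit 1)) (cell aPrec (cell aLis (reg rI))),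
    assign rI (minus (reg rI) (lit 1))])]

/-- The Approximation-Algorithm, with the approximate sorting subroutine `sort` (which leaves
`S^apx` in the array `aApx`) and the constant `c` in `d = c log n`. -/
def approximationAlgorithm (sort : Program) (c : ℕ) : Program :=
  .block [sort, computePos, computeD c, mainLoop, recover]

/-- In state `s` the array `aApx` holds the sequence `σ 0, …, σ (n - 1)`. -/
def HoldsApx {n : ℕ} (s : State) (σ : Equiv.Perm (Fin n)) : Prop :=
  ∀ q : Fin n, s.arr aApx q = (σ q : ℕ)

/-- In state `s` the returned subsequence (`k` cells of the array `aLis`) is the list `l`. -/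
def Returns {n : ℕ} (s : State) (l : List (Fin n)) : Prop :=
  (List.range (s.reg rK)).map (s.arr aLis) = l.map (fun i => (i : ℕ))

/-! ## Subsequences, ranks, dislocation

The input sequence is an injective map `S` from `Fin n` to a linear order, and a subsequence of it
is given by the strictly increasing list of the indices of its elements. An order `S^apx` of the
elements is given by a permutation `σ`, where `σ q` is the index of the element in position `q`,
so that the position of element `i` is `σ.symm i`. Positions and ranks start from `0`. -/

/-- The list of indices `l` describes a subsequence. -/
def IsSubseq {n : ℕ} (l : List (Fin n)) : Prop := l.Pairwise (· < ·)

/-- The list of indices `l` describes an increasing subsequence of `S`. -/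
def IsIncreasingSubseq {n : ℕ} {α : Type*} [LinearOrder α] (S : Fin n → α)
    (l : List (Fin n)) : Prop :=
  IsSubseq l ∧ l.Pairwise (fun i j => S i < S j)

/-- The length of a longest increasing subsequence of `S`. -/
noncomputable def lisLength {n : ℕ} {α : Type*} [LinearOrder α] (S : Fin n → α) : ℕ :=
  sSup {m | ∃ l : List (Fin n), IsIncreasingSubseq S l ∧ l.length = m}

/-- The sequence `l` is `D`-distant in the order `σ`: `pos(l_i) + D ≤ pos(l_{i+1})`. -/
def IsDistant {n : ℕ} (σ : Equiv.Perm (Fin n)) (D : ℕ) (l : List (Fin n)) : Prop :=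
  l.IsChain (fun i j => (σ.symm i : ℕ) + D ≤ (σ.symm j : ℕ))

/-- The list `l` is a longest subsequence that is `D`-distant in `σ`. -/
def IsLongestDistantSubseq {n : ℕ} (σ : Equiv.Perm (Fin n)) (D : ℕ) (l : List (Fin n)) : Prop :=
  IsSubseq l ∧ IsDistant σ D l ∧
    ∀ l' : List (Fin n), IsSubseq l' → IsDistant σ D l' → l'.length ≤ l.length

/-- The rank of the element number `i` in `S`. -/
def rank {n : ℕ} {α : Type*} [LinearOrder α] (S : Fin n → α) (i : Fin n) : ℕ :=
  (Finset.univ.filter (fun j => S j < S i)).card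

/-- The maximum dislocation of the order `σ` of the elements of `S`. -/
def maxDislocation {n : ℕ} {α : Type*} [LinearOrder α] (S : Fin n → α)
    (σ : Equiv.Perm (Fin n)) : ℕ :=
  Finset.univ.sup (fun i => ((σ.symm i : ℤ) - (rank S i : ℤ)).natAbs)

/-! ## Random persistent comparison errors -/

/-- A sample: for each pair of elements whether their comparison is wrong (the entries for
one-element pairs are never used), and the outcomes of all coin tosses of the algorithm. -/
abbrev Sample (n : ℕ) : Type := (Sym2 (Fin n) → Bool) × (ℕ → Bool)

/-- The law of a sample: all entries are independent, each comparison is wrong with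
probability `p`, and each coin is fair. -/
noncomputable def sampleLaw (n : ℕ) (p : unitInterval) : MeasureTheory.Measure (Sample n) :=
  (MeasureTheory.Measure.pi fun _ => ProbabilityTheory.bernoulliMeasure true false p).prod
    (MeasureTheory.Measure.infinitePi fun _ =>
      ProbabilityTheory.bernoulliMeasure true false ⟨1 / 2, by norm_num, by norm_num⟩)

/-- The observed outcome of the comparison "is element number `i` smaller than element
number `j`?": it is negated exactly if the comparison of this pair is wrong. -/
def observed {n : ℕ} {α : Type*} [LinearOrder α] (S : Fin n → α) (wrong : Sym2 (Fin n) → Bool)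
    (i j : Fin n) : Bool :=
  decide (i ≠ j) && xor (decide (S i < S j)) (wrong s(i, j))

end NoisyLIS

set_option linter.unusedSimpArgs false

namespace NoisyLIS

/-! ## Reasoning about executions -/

/-! The proof has a deterministic half and a probabilistic half.

Deterministic half. The main loop is patience sorting for the relation `pos a + 2 * d ≤ pos b`:
among the distant subsequences of length `j` seen so far, `L[j]` is an end of least position
(`LoopInv`). Hence the output is a longest distant subsequence for whatever order the subroutine
supplies. If that order has dislocation at most `d`, elements whose positions are `2 * d` apart are
in the right relative order, so distant subsequences are increasing. Conversely, splitting an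
increasing subsequence by position modulo `2 * d` gives `2 * d` distant ones, so only a factor `2 *
d` is lost (`length_le_of_isLongest`). What remains is to sort in `O(n log n)` steps with
dislocation `O(log n)` although errors are persistent.

The sorting method. Nested random levels are drawn: one element of each neighbouring pair of a level
goes to the next level, until one element is left. The levels are then ordered from the sparsest to
the densest, and dislocation at most `64 * ell n` is maintained (`order_close`). In one step
(`refine_close`) every element receives an estimate of its rank in the sparser level, with error at
most `5376 * ell n`: its position if it belongs to that level, the result of a noisy search
otherwise. Since the sample meets each long interval of ranks often (`Spread`), sorting by the
estimates gives dislocation at most `2 ^ 18 * ell n`. Then each element is compared with all others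
in a window of twice that radius. Its score differs from its rank by at most the number of wrong
comparisons in the window, at most `32 * ell n`, and sorting by scores brings the dislocation back
to `64 * ell n`. A level of `m` elements costs `O(m * ell n)`, and the sizes of the levels halve.

The noisy search is a walk with a centre and a scale. A round without errors lowers a potential by
one while it is positive, and any round raises it by at most three; so if at most `ell n` of the `16
* ell n` rounds contain an error, most rounds vote for one of two cells next to the true block
(`walk_best`).

Probabilistic half. The order in which an element is searched was itself computed from noisy
comparisons, but only from those between elements of the sparser level (`order_congr`). The pairs
containing a searched element outside that level are therefore independent of the order
(`real_not_fewSearch_le`). Each query of a search uses an element of its own, and the course of the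
search is determined by the set of its wrong queries, so a union bound over `2 ^ (64 * ell n)` sets
suffices (`exists_patterns`). Errors in windows are counted with respect to true ranks and thus
concern a set of pairs fixed in advance (`real_not_fewNear_le`). `Spread` follows from an
exponential Markov inequality for the coins (`real_between_lt_le`). For `p ≤ 2 ^ (-2 ^ 17)` each of
the three kinds of failure has probability at most `2 ^ (-3 * ell n)`.

The link to the machine is a weakest-precondition calculus: the rules `runs_*`, a frame rule `Agree`
and loop rules with step bounds show that the programs compute the functions `noisyRank`, `sorted`,
`refine` and `order`. -/

/-- The program halts from `s`, and the final state and the running time satisfy `Q`. -/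
def Runs (n : ℕ) (obs : Fin n → Fin n → Bool) (coin : ℕ → Bool) (W : ℕ) (P : Program) (s : State)
    (Q : State → ℕ → Prop) : Prop :=
  ∃ s' t, Exec n obs coin W P s s' t ∧ Q s' t

section Runs
variable {n : ℕ} {obs : Fin n → Fin n → Bool} {coin : ℕ → Bool} {W : ℕ}

theorem Runs.mono {P : Program} {s : State} {Q Q' : State → ℕ → Prop}
    (h : Runs n obs coin W P s Q) (hQ : ∀ s' t, Q s' t → Q' s' t) : Runs n obs coin W P s Q' := by
  obtain ⟨s', t, h1, h2⟩ := h
  exact ⟨s', t, h1, hQ _ _ h2⟩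

theorem runs_skip {s : State} {Q : State → ℕ → Prop} :
    Runs n obs coin W .skip s Q ↔ Q s 1 := by
  constructor
  · rintro ⟨s', t, h, hQ⟩; cases h; exact hQ
  · intro h; exact ⟨_, _, .skip s, h⟩

theorem runs_assign {s : State} {r : ℕ} {x : RExp} {Q : State → ℕ → Prop} :
    Runs n obs coin W (.assign r x) s Q ↔
      x.eval n s < W ∧ Q (s.setReg r (x.eval n s)) (x.cost + 1) := by
  constructor
  · rintro ⟨s', t, h, hQ⟩; cases h; exact ⟨‹_›, hQ⟩
  · rintro ⟨h, hQ⟩; exact ⟨_, _, .assign s r x h, hQ⟩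

theorem runs_store {s : State} {a : ℕ} {i x : RExp} {Q : State → ℕ → Prop} :
    Runs n obs coin W (.store a i x) s Q ↔
      i.eval n s < W ∧ x.eval n s < W ∧
        Q (s.setCell a (i.eval n s) (x.eval n s)) (i.cost + x.cost + 1) := by
  constructor
  · rintro ⟨s', t, h, hQ⟩; cases h; exact ⟨‹_›, ‹_›, hQ⟩
  · rintro ⟨h, h', hQ⟩; exact ⟨_, _, .store s a i x h h', hQ⟩

theorem runs_compare {s : State} {r : ℕ} {x y : RExp} {Q : State → ℕ → Prop} :
    Runs n obs coin W (.compare r x y) s Q ↔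
      ∃ (hx : x.eval n s < n) (hy : y.eval n s < n),
        Q (s.setReg r (obs ⟨x.eval n s, hx⟩ ⟨y.eval n s, hy⟩).toNat) (x.cost + y.cost + 1) := by
  constructor
  · rintro ⟨s', t, h, hQ⟩; cases h; exact ⟨‹_›, ‹_›, hQ⟩
  · rintro ⟨h, h', hQ⟩; exact ⟨_, _, .compare s r x y h h', hQ⟩

theorem runs_toss {s : State} {r : ℕ} {Q : State → ℕ → Prop} :
    Runs n obs coin W (.toss r) s Q ↔
      Q { s.setReg r (coin s.tossed).toNat with tossed := s.tossed + 1 } 1 := by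
  constructor
  · rintro ⟨s', t, h, hQ⟩; cases h; exact hQ
  · intro h; exact ⟨_, _, .toss s r, h⟩

theorem runs_seq {s : State} {P P' : Program} {Q : State → ℕ → Prop} :
    Runs n obs coin W (.seq P P') s Q ↔
      Runs n obs coin W P s fun s₁ t₁ => Runs n obs coin W P' s₁ fun s₂ t₂ => Q s₂ (t₁ + t₂) := by
  constructor
  · rintro ⟨s', t, h, hQ⟩
    cases h with
    | seq h₁ h₂ => exact ⟨_, _, h₁, _, _, h₂, hQ⟩
  · rintro ⟨s₁, t₁, h₁, s₂, t₂, h₂, hQ⟩; exact ⟨_, _, .seq h₁ h₂, hQ⟩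

theorem runs_ifLt {s : State} {x y : RExp} {P P' : Program} {Q : State → ℕ → Prop} :
    Runs n obs coin W (.ifLt x y P P') s Q ↔
      (x.eval n s < y.eval n s →
        Runs n obs coin W P s fun s' t => Q s' (x.cost + y.cost + 1 + t)) ∧
      (¬ x.eval n s < y.eval n s →
        Runs n obs coin W P' s fun s' t => Q s' (x.cost + y.cost + 1 + t)) := by
  constructor
  · rintro ⟨s', t, h, hQ⟩
    cases h with
    | ifTrue h h₁ => exact ⟨fun _ => ⟨_, _, h₁, hQ⟩, fun h' => absurd h h'⟩
    | ifFalse h h₁ => exact ⟨fun h' => absurd h' h, fun _ => ⟨_, _, h₁, hQ⟩⟩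
  · rintro ⟨h₁, h₂⟩
    by_cases h : x.eval n s < y.eval n s
    · obtain ⟨s', t, h₃, hQ⟩ := h₁ h
      exact ⟨_, _, .ifTrue h h₃, hQ⟩
    · obtain ⟨s', t, h₃, hQ⟩ := h₂ h
      exact ⟨_, _, .ifFalse h h₃, hQ⟩

theorem runs_block_nil {s : State} {Q : State → ℕ → Prop} :
    Runs n obs coin W (.block []) s Q ↔ Q s 1 := runs_skip

theorem runs_block_cons {s : State} {P : Program} {l : List Program} {Q : State → ℕ → Prop} :
    Runs n obs coin W (.block (P :: l)) s Q ↔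
      Runs n obs coin W P s fun s₁ t₁ => Runs n obs coin W (.block l) s₁ fun s₂ t₂ =>
        Q s₂ (t₁ + t₂) := runs_seq

/-! ### Frames -/

/-- The registers that a program may write. -/
def Program.regs : Program → List ℕ
  | .skip => []
  | .assign r _ => [r]
  | .store _ _ _ => []
  | .compare r _ _ => [r]
  | .toss r => [r]
  | .seq P Q => P.regs ++ Q.regs
  | .ifLt _ _ P Q => P.regs ++ Q.regs
  | .whileLt _ _ P => P.regs

/-- The arrays that a program may write. -/
def Program.arrs : Program → List ℕ
  | .skip => []
  | .assign _ _ => []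
  | .store a _ _ => [a]
  | .compare _ _ _ => []
  | .toss _ => []
  | .seq P Q => P.arrs ++ Q.arrs
  | .ifLt _ _ P Q => P.arrs ++ Q.arrs
  | .whileLt _ _ P => P.arrs

/-- Whether a program may toss coins. -/
def Program.tosses : Program → Bool
  | .skip => false
  | .assign _ _ => false
  | .store _ _ _ => false
  | .compare _ _ _ => false
  | .toss _ => true
  | .seq P Q => P.tosses || Q.tosses
  | .ifLt _ _ P Q => P.tosses || Q.tosses
  | .whileLt _ _ P => P.tosses

/-- The states `s` and `s'` differ at most in what the program `P` may write. -/
structure Agree (P : Program) (s s' : State) : Prop where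
  reg : ∀ r, r ∉ P.regs → s'.reg r = s.reg r
  arr : ∀ a, a ∉ P.arrs → s'.arr a = s.arr a
  tossed : P.tosses = false → s'.tossed = s.tossed

theorem Agree.refl (P : Program) (s : State) : Agree P s s := ⟨by simp, by simp, by simp⟩

theorem Agree.trans {P : Program} {s s' s'' : State} (h : Agree P s s') (h' : Agree P s' s'') :
    Agree P s s'' :=
  ⟨fun r hr => (h'.reg r hr).trans (h.reg r hr), fun r hr => (h'.arr r hr).trans (h.arr r hr),
    fun hr => (h'.tossed hr).trans (h.tossed hr)⟩

theorem Agree.weaken {P P' : Program} {s s' : State} (h : Agree P s s')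
    (hr : ∀ r, r ∉ P'.regs → r ∉ P.regs) (ha : ∀ r, r ∉ P'.arrs → r ∉ P.arrs)
    (ht : P'.tosses = false → P.tosses = false) : Agree P' s s' :=
  ⟨fun r h' => h.reg r (hr r h'), fun r h' => h.arr r (ha r h'), fun h' => h.tossed (ht h')⟩

/-- The frame rule. The lists `regs` and `arrs` of a concrete program are finite and computable, so
later proofs transport untouched values by `decide`. -/
theorem Exec.agree {P : Program} {s s' : State} {t : ℕ} (h : Exec n obs coin W P s s' t) :
    Agree P s s' := by
  induction h with
  | skip s => exact .refl _ _
  | assign s r x hx =>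
    refine ⟨fun r' h => ?_, fun _ _ => rfl, fun _ => rfl⟩
    simp only [Program.regs, List.mem_singleton] at h
    simp [State.setReg, h]
  | store s a i x hi hx =>
    refine ⟨fun _ _ => rfl, fun r' h => ?_, fun _ => rfl⟩
    simp only [Program.arrs, List.mem_singleton] at h
    simp [State.setCell, h]
  | compare s r x y hx hy =>
    refine ⟨fun r' h => ?_, fun _ _ => rfl, fun _ => rfl⟩
    simp only [Program.regs, List.mem_singleton] at h
    simp [State.setReg, h]
  | toss s r =>
    refine ⟨fun r' h => ?_, fun _ _ => rfl, fun h => by simp [Program.tosses] at h⟩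
    simp only [Program.regs, List.mem_singleton] at h
    simp [State.setReg, h]
  | seq _ _ ih₁ ih₂ =>
    refine Agree.trans (ih₁.weaken ?_ ?_ ?_) (ih₂.weaken ?_ ?_ ?_) <;>
      simp +contextual [Program.regs, Program.arrs, Program.tosses]
  | ifTrue _ _ ih =>
    refine ih.weaken ?_ ?_ ?_ <;>
      simp +contextual [Program.regs, Program.arrs, Program.tosses]
  | ifFalse _ _ ih =>
    refine ih.weaken ?_ ?_ ?_ <;>
      simp +contextual [Program.regs, Program.arrs, Program.tosses]
  | whileTrue _ _ _ ih₁ ih₂ =>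
    refine Agree.trans (ih₁.weaken ?_ ?_ ?_) ih₂ <;>
      simp +contextual [Program.regs, Program.arrs, Program.tosses]
  | whileFalse _ => exact .refl _ _

theorem Runs.agree {P : Program} {s : State} {Q : State → ℕ → Prop}
    (h : Runs n obs coin W P s Q) :
    Runs n obs coin W P s fun s' t => Q s' t ∧ Agree P s s' := by
  obtain ⟨s', t, h1, h2⟩ := h
  exact ⟨s', t, h1, h2, h1.agree⟩

/-- Run a subprogram with known behaviour `R`, remembering what it leaves unchanged. -/
theorem Runs.then {P : Program} {s : State} {R Q : State → ℕ → Prop}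
    (h : Runs n obs coin W P s R) (hQ : ∀ s' t, R s' t → Agree P s s' → Q s' t) :
    Runs n obs coin W P s Q :=
  h.agree.mono fun s' t h => hQ s' t h.1 h.2

/-! ### Loops -/

/-- For loops whose number of rounds `N` is known beforehand. Since `Agree P s₀ s` is provided in
every round, the invariant `I` only has to mention what the body changes. -/
theorem runs_while {P : Program} {x y : RExp} {s₀ : State} (N : ℕ) (I : ℕ → State → Prop)
    (b : ℕ → ℕ) (h0 : I 0 s₀)
    (hcond : ∀ i s, i ≤ N → I i s → Agree P s₀ s → (x.eval n s < y.eval n s ↔ i < N))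
    (hbody : ∀ i s, i < N → I i s → Agree P s₀ s →
      Runs n obs coin W P s fun s' t => t ≤ b i ∧ I (i + 1) s') :
    Runs n obs coin W (.whileLt x y P) s₀ fun s' t =>
      t ≤ ∑ i ∈ Finset.range N, (b i + (x.cost + y.cost + 1)) + (x.cost + y.cost + 1) ∧ I N s' ∧
        Agree P s₀ s' := by
  have key : ∀ k i s, i + k = N → I i s → Agree P s₀ s →
      Runs n obs coin W (.whileLt x y P) s fun s' t =>
        t ≤ ∑ i ∈ Finset.Ico i N, (b i + (x.cost + y.cost + 1)) + (x.cost + y.cost + 1) ∧ I N s' ∧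
        Agree P s₀ s' := by
    intro k
    induction k with
    | zero =>
      intro i s hi hI hA
      obtain rfl : i = N := by omega
      refine ⟨s, _, .whileFalse ?_, ?_, hI, hA⟩
      · rw [hcond i s le_rfl hI hA]; simp
      · simp
    | succ k ih =>
      intro i s hi hI hA
      have hiN : i < N := by omega
      obtain ⟨s₁, t₁, h₁, ⟨ht₁, hI₁⟩, hA₁⟩ := (hbody i s hiN hI hA).agree
      obtain ⟨s₂, t₂, h₂, ht₂, hI₂, hA₂⟩ := ih (i + 1) s₁ (by omega) hI₁ (hA.trans hA₁)
      refine ⟨s₂, _, .whileTrue ((hcond i s hiN.le hI hA).2 hiN) h₁ h₂, ?_, hI₂, hA₂⟩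
      rw [Finset.sum_eq_sum_Ico_succ_bot hiN]
      omega
  have := key N 0 s₀ (by simp) h0 (.refl _ _)
  simpa only [Finset.range_eq_Ico] using this

/-- A loop in which each round takes at most `b` steps. -/
theorem runs_while_const {P : Program} {x y : RExp} {s₀ : State} (N : ℕ) (I : ℕ → State → Prop)
    (b : ℕ) (h0 : I 0 s₀)
    (hcond : ∀ i s, i ≤ N → I i s → Agree P s₀ s → (x.eval n s < y.eval n s ↔ i < N))
    (hbody : ∀ i s, i < N → I i s → Agree P s₀ s →
      Runs n obs coin W P s fun s' t => t ≤ b ∧ I (i + 1) s') :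
    Runs n obs coin W (.whileLt x y P) s₀ fun s' t =>
      t ≤ N * (b + (x.cost + y.cost + 1)) + (x.cost + y.cost + 1) ∧ I N s' ∧ Agree P s₀ s' := by
  refine (runs_while N I (fun _ => b) h0 hcond hbody).mono fun s' t h => ?_
  simpa using h

/-- A loop in which each round takes at most `b` steps and uses up one unit of fuel. -/
theorem runs_while_fuel {P : Program} {x y : RExp} {s₀ : State} (N : ℕ) (I : ℕ → State → Prop)
    (b : ℕ) (hN : I N s₀)
    (hzero : ∀ s, I 0 s → ¬ x.eval n s < y.eval n s)
    (hbody : ∀ i s, x.eval n s < y.eval n s → I (i + 1) s → Agree P s₀ s →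
      Runs n obs coin W P s fun s' t => t ≤ b ∧ I i s') :
    Runs n obs coin W (.whileLt x y P) s₀ fun s' t =>
      t ≤ N * (b + (x.cost + y.cost + 1)) + (x.cost + y.cost + 1) ∧ (∃ i, I i s') ∧
        ¬ x.eval n s' < y.eval n s' := by
  have key : ∀ i s, I i s → Agree P s₀ s →
      Runs n obs coin W (.whileLt x y P) s fun s' t =>
        t ≤ i * (b + (x.cost + y.cost + 1)) + (x.cost + y.cost + 1) ∧ (∃ i, I i s') ∧
        ¬ x.eval n s' < y.eval n s' := by
    intro i
    induction i with
    | zero =>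
      intro s hI hA
      exact ⟨s, _, .whileFalse (hzero s hI), by simp, ⟨0, hI⟩, hzero s hI⟩
    | succ i ih =>
      intro s hI hA
      by_cases hc : x.eval n s < y.eval n s
      · obtain ⟨s₁, t₁, h₁, ⟨ht₁, hI₁⟩, hA₁⟩ := (hbody i s hc hI hA).agree
        obtain ⟨s₂, t₂, h₂, ht₂, hI₂, hc₂⟩ := ih s₁ hI₁ (hA.trans hA₁)
        refine ⟨s₂, _, .whileTrue hc h₁ h₂, ?_, hI₂, hc₂⟩
        rw [add_mul]
        omega
      · exact ⟨s, _, .whileFalse hc, by omega, ⟨_, hI⟩, hc⟩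
  exact key N s₀ hN (.refl _ _)

end Runs

@[simp] theorem State.setReg_reg (s : State) (r v r' : ℕ) :
    (s.setReg r v).reg r' = if r' = r then v else s.reg r' := by
  simp [State.setReg, Function.update_apply]

@[simp] theorem State.setReg_arr (s : State) (r v : ℕ) : (s.setReg r v).arr = s.arr := rfl

@[simp] theorem State.setReg_tossed (s : State) (r v : ℕ) : (s.setReg r v).tossed = s.tossed := rfl

@[simp] theorem State.setCell_reg (s : State) (a i v : ℕ) : (s.setCell a i v).reg = s.reg := rfl

@[simp] theorem State.setCell_tossed (s : State) (a i v : ℕ) :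
    (s.setCell a i v).tossed = s.tossed := rfl

@[simp] theorem State.setCell_arr (s : State) (a i v a' : ℕ) :
    (s.setCell a i v).arr a' = if a' = a then Function.update (s.arr a) i v else s.arr a' := by
  simp [State.setCell, Function.update_apply]

/-! ### The Approximation-Algorithm finds a longest distant subsequence -/

section Search
variable {n : ℕ} {obs : Fin n → Fin n → Bool} {coin : ℕ → Bool} {W : ℕ}

theorem runs_computePos {s : State} (σ : Equiv.Perm (Fin n)) (hs : HoldsApx s σ) (hW : n < W) :
    Runs n obs coin W computePos s fun s' t =>
      t ≤ 13 * n + 6 ∧ ∀ i : Fin n, s'.arr aPos i = (σ.symm i : ℕ) := by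
  rw [computePos, runs_block_cons, runs_assign]
  refine ⟨by simp [RExp.eval]; omega, ?_⟩
  rw [runs_block_cons]
  refine (runs_while_const n (fun i s' => s'.reg rI = i ∧
    ∀ q : Fin n, (q : ℕ) < i → s'.arr aPos (σ q) = q) 10 (by simp [RExp.eval]) ?_ ?_).then ?_
  · rintro i s' hi ⟨h1, h2⟩ hA
    simp [RExp.eval, h1]
  · rintro i s' hi ⟨h1, h2⟩ hA
    have h3 : s'.arr aApx i = σ ⟨i, hi⟩ := by
      rw [hA.arr aApx (by decide)]
      simpa using hs ⟨i, hi⟩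
    simp only [runs_block_cons, runs_block_nil, runs_assign, runs_store, RExp.eval, h1, h3,
      Op.apply, RExp.cost, State.setCell_reg, State.setReg_reg, State.setCell_arr,
      State.setReg_arr]
    have := (σ ⟨i, hi⟩).2
    refine ⟨by omega, by omega, by omega, by omega, by simp, ?_⟩
    intro q hq
    by_cases hqi : (q : ℕ) = i
    · subst hqi; simp
    · have : (σ q : ℕ) ≠ σ ⟨i, hi⟩ := by
        intro h
        have := σ.injective (Fin.ext h)
        exact hqi (by rw [this])
      rw [if_pos trivial, Function.update_of_ne this]
      exact h2 q (by omega)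
  · rintro s' t ⟨ht, ⟨h1, h2⟩, -⟩ -
    rw [runs_block_nil]
    refine ⟨by simp [RExp.cost] at ht ⊢; omega, fun i => ?_⟩
    simpa using h2 (σ.symm i) (σ.symm i).2

/-- The loop of `computeD` halves `n` while the result exceeds `1`; this makes its number of rounds
exactly `Nat.log 2 n`. -/
theorem one_lt_div_two_pow_iff (hn : n ≠ 0) (i : ℕ) : 1 < n / 2 ^ i ↔ i < Nat.log 2 n := by
  rw [Nat.lt_iff_add_one_le, Nat.le_div_iff_mul_le (by positivity), Nat.lt_iff_add_one_le,
    Nat.le_log_iff_pow_le (by norm_num) hn, pow_succ']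

theorem runs_computeD (c : ℕ) {s : State} (hn : 2 ≤ n) (hW : n < W) (hc : c * Nat.log 2 n < W) :
    Runs n obs coin W (computeD c) s fun s' t =>
      t ≤ 13 * Nat.log 2 n + 9 ∧ s'.reg rD = c * Nat.log 2 n := by
  simp only [computeD, runs_block_cons, runs_assign]
  refine ⟨by simp [RExp.eval]; omega, by simp [RExp.eval]; omega, ?_⟩
  refine (runs_while_const (Nat.log 2 n) (fun i s' => s'.reg rM = n / 2 ^ i ∧
    s'.reg rD = c * i) 10 (by simp [RExp.eval]) ?_ ?_).then ?_
  · rintro i s' hi ⟨h1, h2⟩ hA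
    simp only [RExp.eval, h1]
    exact one_lt_div_two_pow_iff (by omega) i
  · rintro i s' hi ⟨h1, h2⟩ hA
    simp only [runs_block_cons, runs_block_nil, runs_assign, RExp.eval, h1, h2,
      Op.apply, RExp.cost, State.setReg_reg, rM, rD]
    have h3 : n / 2 ^ i / 2 ≤ n := (Nat.div_le_self _ _).trans (Nat.div_le_self _ _)
    have h4 : c * (i + 1) ≤ c * Nat.log 2 n := Nat.mul_le_mul_left _ hi
    refine ⟨by omega, ?_, by omega, ?_, ?_⟩
    · simp; rw [mul_add] at h4; omega
    · simp [pow_succ, Nat.div_div_eq_div_mul]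
    · simp [mul_add]
  · rintro s' t ⟨ht, ⟨h1, h2⟩, -⟩ -
    rw [runs_block_nil]
    refine ⟨by simp [RExp.cost] at ht ⊢; omega, h2⟩

/-! ### The main loop -/

/-- There is a `D`-distant subsequence of length `j` that ends with element number `e`. -/
def DistEnd (pos : ℕ → ℕ) (D : ℕ) : ℕ → ℕ → Prop
  | 0, _ => False
  | 1, _ => True
  | j + 2, e => ∃ a, a < e ∧ pos a + D ≤ pos e ∧ DistEnd pos D (j + 1) a

/-- Following the pointers `prec` from `e` gives a `D`-distant subsequence of length `j`. -/
def PrecChain (pos : ℕ → ℕ) (D : ℕ) (prec : ℕ → ℕ) : ℕ → ℕ → Prop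
  | 0, _ => False
  | 1, _ => True
  | j + 2, e => prec e < e ∧ pos (prec e) + D ≤ pos e ∧ PrecChain pos D prec (j + 1) (prec e)

/-- Pointers lead to smaller indices, so a chain that starts at `e < x` never reads the pointer of
`x`. -/
theorem PrecChain.update {pos prec : ℕ → ℕ} {D x y : ℕ} : ∀ {j e : ℕ}, e < x →
    PrecChain pos D prec j e → PrecChain pos D (Function.update prec x y) j e
  | 0, _, _, h => h
  | 1, _, _, _ => trivial
  | j + 2, e, he, h => by
    obtain ⟨h1, h2, h3⟩ := h
    rw [PrecChain, Function.update_of_ne (by omega)]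
    exact ⟨h1, h2, PrecChain.update (by omega) h3⟩

/-- The invariant of the main loop after the first `i` elements. -/
structure LoopInv (pos : ℕ → ℕ) (D i k : ℕ) (L prec : ℕ → ℕ) : Prop where
  one_le : 1 ≤ k
  le : k ≤ i
  lt : ∀ j, 1 ≤ j → j ≤ k → L j < i
  gap : ∀ j, 1 ≤ j → j < k → pos (L j) + D ≤ pos (L (j + 1))
  chain : ∀ j, 1 ≤ j → j ≤ k → PrecChain pos D prec j (L j)
  opt : ∀ j e, e < i → DistEnd pos D j e → j ≤ k ∧ pos (L j) ≤ pos e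

theorem loopInv_one (pos : ℕ → ℕ) (D : ℕ) (L prec : ℕ → ℕ) (hL : L 1 = 0) :
    LoopInv pos D 1 1 L prec where
  one_le := le_rfl
  le := le_rfl
  lt j h1 h2 := by obtain rfl : j = 1 := by omega
                   omega
  gap j h1 h2 := by omega
  chain j h1 h2 := by obtain rfl : j = 1 := by omega
                      trivial
  opt j e he h := by
    obtain rfl : e = 0 := by omega
    match j, h with
    | 1, _ => simp [hL]
    | j + 2, ⟨a, ha, _⟩ => omega

theorem LoopInv.gap' {pos : ℕ → ℕ} {D i k : ℕ} {L prec : ℕ → ℕ}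
    (h : LoopInv pos D i k L prec) {j j' : ℕ} (hj : 1 ≤ j) (hjj : j < j') (hj' : j' ≤ k) :
    pos (L j) + D ≤ pos (L j') := by
  induction j' with
  | zero => omega
  | succ j' ih =>
    have := h.gap j' (by omega) (by omega)
    rcases Nat.lt_or_ge j j' with h1 | h1
    · have := ih h1 (by omega)
      omega
    · obtain rfl : j = j' := by omega
      exact this

/-- An element before `L[1]` ends no distant subsequence of length at least `2`: the predecessor
would have to lie before it, but by `opt` and `gap` it lies at or behind `L[1]`. -/
theorem LoopInv.replace_first {pos : ℕ → ℕ} {D i k : ℕ} {L prec : ℕ → ℕ}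
    (h : LoopInv pos D i k L prec) (hx : pos i < pos (L 1)) :
    LoopInv pos D (i + 1) k (Function.update L 1 i) prec where
  one_le := h.one_le
  le := by have := h.le; omega
  lt j h1 h2 := by
    rcases eq_or_ne j 1 with rfl | hj
    · simp
    · rw [Function.update_of_ne hj]; have := h.lt j h1 h2; omega
  gap j h1 h2 := by
    have := h.gap j h1 h2
    rw [Function.update_of_ne (by omega : j + 1 ≠ 1)]
    rcases eq_or_ne j 1 with rfl | hj
    · simp only [Function.update_self]; omega
    · rw [Function.update_of_ne hj]; omega
  chain j h1 h2 := by
    rcases eq_or_ne j 1 with rfl | hj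
    · trivial
    · rw [Function.update_of_ne hj]; exact h.chain j h1 h2
  opt j e he hd := by
    rcases Nat.lt_succ_iff_lt_or_eq.1 he with he | rfl
    · obtain ⟨h1, h2⟩ := h.opt j e he hd
      refine ⟨h1, ?_⟩
      rcases eq_or_ne j 1 with rfl | hj
      · simp only [Function.update_self]; omega
      · rwa [Function.update_of_ne hj]
    · match j, hd with
      | 1, _ => simpa using h.one_le
      | j + 2, ⟨a, ha, hae, hd⟩ =>
        obtain ⟨h1, h2⟩ := h.opt (j + 1) a ha hd
        exfalso
        rcases Nat.eq_zero_or_pos j with rfl | hj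
        · simp at h2; omega
        · have := h.gap' (j := 1) (j' := j + 1) le_rfl (by omega) h1
          omega

/-- An element less than `D` behind `L[j]` ends no distant subsequence longer than `j`, since the
predecessor would lie at or behind `L[j]`. For lengths up to `j` the present ends already lie before
the element. -/
theorem LoopInv.skip {pos : ℕ → ℕ} {D i k : ℕ} {L prec : ℕ → ℕ} (h : LoopInv pos D i k L prec)
    {j : ℕ} (hj : 1 ≤ j) (hjk : j ≤ k) (hlt : pos (L j) < pos i)
    (hx : pos i < pos (L j) + D) :
    LoopInv pos D (i + 1) k L prec where
  one_le := h.one_le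
  le := by have := h.le; omega
  lt j h1 h2 := by have := h.lt j h1 h2; omega
  gap := h.gap
  chain := h.chain
  opt j' e he hd := by
    rcases Nat.lt_succ_iff_lt_or_eq.1 he with he | rfl
    · exact h.opt j' e he hd
    · have key : j' ≤ j := by
        match j', hd with
        | 1, _ => omega
        | j' + 2, ⟨a, ha, hae, hd⟩ =>
          obtain ⟨h1, h2⟩ := h.opt (j' + 1) a ha hd
          by_contra hcon
          rcases Nat.lt_or_ge j (j' + 1) with h3 | h3
          · have := h.gap' hj h3 h1
            omega
          · obtain rfl : j = j' + 1 := by omega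
            omega
      refine ⟨by omega, ?_⟩
      rcases Nat.eq_zero_or_pos j' with rfl | h0
      · exact hd.elim
      rcases key.lt_or_eq with h3 | rfl
      · have := h.gap' h0 h3 hjk
        omega
      · omega

/-- The element is at least `D` behind `L[j]` and not behind `L[j + 1]`, so it is the new best end
for length `j + 1`. For a greater length its predecessor would lie at or behind the old `L[j + 1]`,
hence not before it; `0 < D` gives the contradiction. -/
theorem LoopInv.extend {pos : ℕ → ℕ} {D i k : ℕ} {L prec : ℕ → ℕ} (h : LoopInv pos D i k L prec)
    {j : ℕ} (hD : 0 < D) (hj : 1 ≤ j) (hjk : j ≤ k) (hlt : pos (L j) + D ≤ pos i)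
    (hx : j < k → pos i ≤ pos (L (j + 1))) :
    LoopInv pos D (i + 1) (if j < k then k else k + 1) (Function.update L (j + 1) i)
      (Function.update prec i (L j)) where
  one_le := by split_ifs <;> omega
  le := by have := h.le; split_ifs <;> omega
  lt j' h1 h2 := by
    rcases eq_or_ne j' (j + 1) with rfl | hne
    · simp
    · rw [Function.update_of_ne hne]
      have := h.lt j' h1 (by split_ifs at h2 <;> omega)
      omega
  gap j' h1 h2 := by
    rcases eq_or_ne j' (j + 1) with rfl | hne
    · have hjk' : j < k := by split_ifs at h2 <;> omega
      rw [if_pos hjk'] at h2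
      have := h.gap (j + 1) h1 h2
      have := hx hjk'
      rw [Function.update_self, Function.update_of_ne (by omega)]
      omega
    · rw [Function.update_of_ne hne]
      rcases eq_or_ne j' j with rfl | hne'
      · rwa [Function.update_self]
      · rw [Function.update_of_ne (by omega)]
        exact h.gap j' h1 (by split_ifs at h2 <;> omega)
  chain j' h1 h2 := by
    rcases eq_or_ne j' (j + 1) with rfl | hne
    · obtain ⟨j, rfl⟩ : ∃ j₀, j = j₀ + 1 := ⟨j - 1, by omega⟩
      rw [Function.update_self, PrecChain, Function.update_self]
      have := h.lt _ hj hjk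
      exact ⟨this, hlt, (h.chain _ hj hjk).update this⟩
    · rw [Function.update_of_ne hne]
      have : j' ≤ k := by split_ifs at h2 <;> omega
      exact (h.chain j' h1 this).update (h.lt j' h1 this)
  opt j' e he hd := by
    rcases Nat.lt_succ_iff_lt_or_eq.1 he with he | rfl
    · obtain ⟨h1, h2⟩ := h.opt j' e he hd
      refine ⟨by split_ifs <;> omega, ?_⟩
      rcases eq_or_ne j' (j + 1) with rfl | hne
      · have := hx (by omega)
        rw [Function.update_self]
        omega
      · rwa [Function.update_of_ne hne]
    · have key : j' ≤ j + 1 := by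
        match j', hd with
        | 1, _ => omega
        | j' + 2, ⟨a, ha, hae, hd⟩ =>
          obtain ⟨h1, h2⟩ := h.opt (j' + 1) a ha hd
          by_contra hcon
          have h3 := hx (by omega)
          rcases Nat.lt_or_ge (j + 1) (j' + 1) with h4 | h4
          · have := h.gap' (by omega) h4 h1
            omega
          · obtain rfl : j = j' := by omega
            omega
      refine ⟨by split_ifs <;> omega, ?_⟩
      rcases Nat.eq_zero_or_pos j' with rfl | h0
      · exact hd.elim
      rcases key.lt_or_eq with h3 | rfl
      · rw [Function.update_of_ne (by omega)]
        rcases Nat.lt_or_ge j' j with h4 | h4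
        · have := h.gap' h0 h4 hjk
          omega
        · obtain rfl : j = j' := by omega
          omega
      · rw [Function.update_self]

/-- Bisection with `j < h ≤ j + 2 ^ f`, where `f` is the fuel left; `h = k + 1` plays the role of an
end at infinity. Monotonicity of the positions along `L` is not needed here, as only the two sides
of the final gap matter. -/
theorem runs_findJ {s : State} {pos : ℕ → ℕ} {k i : ℕ} {L : ℕ → ℕ}
    (hk : s.reg rK = k) (hi : s.reg rI = i) (hL : s.arr aL = L) (hin : i < n) (hk1 : 1 ≤ k)
    (hkn : k ≤ n) (hLn : ∀ j, 1 ≤ j → j ≤ k → L j < n) (hpos : ∀ j, j < n → s.arr aPos j = pos j)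
    (h1 : pos (L 1) < pos i) (hW : n + 1 < W) :
    Runs n obs coin W findJ s fun s' t =>
      t ≤ 40 * (Nat.log 2 n + 1) + 40 ∧ ∃ j, s'.reg rJ = j ∧ 1 ≤ j ∧ j ≤ k ∧ pos (L j) < pos i ∧
        (j < k → pos i ≤ pos (L (j + 1))) := by
  simp only [findJ, runs_block_cons, runs_assign]
  refine ⟨by simp [RExp.eval]; omega, by simp [RExp.eval, hk, Op.apply]; omega, ?_⟩
  refine (runs_while_fuel (Nat.log 2 n + 1) (fun f s' => s'.reg rI = i ∧ s'.arr aL = L ∧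
    s'.arr aPos = s.arr aPos ∧
    ∃ j h, s'.reg rJ = j ∧ s'.reg rH = h ∧ 1 ≤ j ∧ j < h ∧ h ≤ k + 1 ∧ h ≤ j + 2 ^ f ∧
      pos (L j) < pos i ∧ (h ≤ k → pos i ≤ pos (L h))) 33 ?_ ?_ ?_).then ?_
  · refine ⟨by simpa, by simpa, by simp, 1, k + 1, by simp [RExp.eval],
      by simp [RExp.eval, hk, Op.apply],
      le_rfl, by omega, le_rfl, ?_, h1, by omega⟩
    have := Nat.lt_pow_succ_log_self (b := 2) (by norm_num) n
    omega
  · rintro s' ⟨-, -, -, j, h, hj, hh, -, -, -, h', -, -⟩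
    simp [RExp.eval, hj, hh, Op.apply] at h' ⊢
    omega
  · rintro f s' hc ⟨hi', hL', hp', j, h, hj, hh, hj1, hjh, hhk, hf, hlt, hle⟩ -
    simp only [RExp.eval, hj, hh, Op.apply] at hc
    simp only [runs_block_cons, runs_block_nil, runs_assign, runs_ifLt, RExp.eval, hj, hh, hi',
      hL', hp', Op.apply, RExp.cost, State.setReg_reg, State.setReg_arr]
    have hm : (j + h) / 2 ≤ k := by omega
    have hm' := hLn ((j + h) / 2) (by omega) hm
    simp only [if_true, hpos _ hm', hpos _ hin, rI, rM, rJ, rH, 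
      Nat.reduceEqDiff, if_false, hi']
    rw [pow_succ] at hf
    refine ⟨by omega, fun hlt' => ⟨by omega, by omega, trivial, trivial, trivial, (j + h) / 2, h, rfl,
      rfl, by omega, by omega, hhk, by omega, hlt', hle⟩, fun hlt' => ⟨by omega, by omega, trivial,
      trivial, trivial, j, (j + h) / 2, rfl, rfl, by omega, by omega, by omega, by omega, hlt, by omega⟩⟩
  · rintro s' t ⟨ht, ⟨f, hi', hL', hp', j, h, hj, hh, hj1, hjh, hhk, hf, hlt, hle⟩, hc⟩ -
    rw [runs_block_nil]
    simp only [RExp.eval, hj, hh, Op.apply] at hc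
    obtain rfl : h = j + 1 := by omega
    refine ⟨?_, j, hj, hj1, by omega, hlt, fun h => hle (by omega)⟩
    simp [RExp.cost] at ht ⊢
    omega

theorem runs_mainLoop {s : State} {pos : ℕ → ℕ} {d : ℕ} (hn : 2 ≤ n)
    (hpos : ∀ j, j < n → s.arr aPos j = pos j)
    (hinj : ∀ i j, i < n → j < n → pos i = pos j → i = j) (hd : s.reg rD = d) (hd0 : 0 < d)
    (hW : n + 1 < W) :
    Runs n obs coin W mainLoop s fun s' t =>
      t ≤ 200 * (n * (Nat.log 2 n + 1)) ∧ LoopInv pos (2 * d) n (s'.reg rK) (s'.arr aL)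
        (s'.arr aPrec) := by
  simp only [mainLoop, runs_block_cons, runs_assign, runs_store]
  refine ⟨by simp [RExp.eval]; omega, by simp [RExp.eval]; omega, by simp [RExp.eval]; omega,
    by simp [RExp.eval]; omega, ?_⟩
  refine (runs_while_const (n - 1) (fun i s' => s'.reg rI = i + 1 ∧
    LoopInv pos (2 * d) (i + 1) (s'.reg rK) (s'.arr aL) (s'.arr aPrec))
    (40 * (Nat.log 2 n + 1) + 84) ?_ ?_ ?_).then ?_
  · refine ⟨by simp [RExp.eval], ?_⟩
    simp only [RExp.eval, State.setReg_reg, rK, rI, Nat.reduceEqDiff, if_false, if_true,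
      zero_ne_one, OfNat.zero_ne_ofNat]
    exact loopInv_one _ _ _ _ (by simp)
  · rintro i s' hi ⟨h1, -⟩ -
    simp only [RExp.eval, h1]
    omega
  · rintro i s' hi ⟨hI, hinv⟩ hA
    have hin : i + 1 < n := by omega
    have hpos' : ∀ j, j < n → s'.arr aPos j = pos j := by
      intro j hj
      rw [hA.arr aPos (by decide)]
      simpa using hpos j hj
    have hd' : s'.reg rD = d := by
      rw [hA.reg rD (by decide)]
      simpa using hd
    have hL1 := hinv.lt 1 le_rfl hinv.one_le
    have hkn := hinv.le
    rw [runs_block_cons, runs_ifLt]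
    simp only [RExp.eval, hI, hpos' _ hin, hpos' _ (hL1.trans hin)]
    constructor
    · intro hlt
      simp only [runs_block_cons, runs_block_nil, runs_assign, runs_store, RExp.eval, hI,
        RExp.cost, State.setReg_reg, State.setReg_arr, State.setCell_reg, State.setCell_arr,
        Op.apply]
      refine ⟨by omega, by omega, by omega, by omega, by simp, ?_⟩
      simpa using hinv.replace_first hlt
    · intro hlt
      -- Positions are injective and `L[1]` is an earlier element, so equality of positions is
      -- excluded.
      have hlt' : pos (s'.arr aL 1) < pos (i + 1) := by
        rcases Nat.lt_or_ge (pos (s'.arr aL 1)) (pos (i + 1)) with h | h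
        · exact h
        · have := hinj _ _ (hL1.trans hin) hin (by omega)
          omega
      rw [runs_block_cons]
      refine (runs_findJ (k := s'.reg rK) (i := i + 1) rfl hI rfl hin hinv.one_le
        (by omega) (fun j h1 h2 => (hinv.lt j h1 h2).trans hin) hpos' hlt' hW).then ?_
      rintro s₁ t₁ ⟨ht₁, j, hj, hj1, hjk, hjlt, hjle⟩ hA₁
      have hI₁ : s₁.reg rI = i + 1 := by rw [hA₁.reg rI (by decide), hI]
      have hK₁ : s₁.reg rK = s'.reg rK := by rw [hA₁.reg rK (by decide)]
      have hd₁ : s₁.reg rD = d := by rw [hA₁.reg rD (by decide), hd']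
      have ha₁ : ∀ a, s₁.arr a = s'.arr a := fun a => hA₁.arr a (by simp [findJ, Program.block,
        Program.arrs])
      have hLj := hinv.lt j hj1 hjk
      simp only [runs_block_cons, runs_block_nil, runs_assign, runs_store, runs_ifLt, runs_skip,
        RExp.eval, hI₁, hj, hK₁, hd₁, ha₁, hpos' _ hin, hpos' _ (hLj.trans hin),
        RExp.cost, State.setReg_reg, State.setReg_arr, State.setCell_reg, State.setCell_arr,
        Op.apply, rI, rJ, rK, aL, aPrec, Nat.reduceEqDiff, if_true, if_false]
      simp only [rI, rJ] at hI₁ hj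
      simp only [hI₁, hj, OfNat.ofNat_ne_zero, if_false, OfNat.zero_ne_ofNat, Function.update_self,
        Function.update_of_ne (show j ≠ j + 1 by omega)]
      simp only [rK] at hinv hK₁ hjk hjle hkn
      have hLjW : s'.arr 2 j < W := hLj.trans (by omega)
      refine ⟨fun h => ⟨by omega, by omega, trivial, hinv.skip hj1 hjk hjlt h⟩, fun h => ?_⟩
      have key := hinv.extend (by omega) hj1 hjk (Nat.le_of_not_lt h) hjle
      refine ⟨fun h' => ?_, fun h' => ?_⟩
      · rw [if_pos h'] at key
        exact ⟨by omega, by omega, by omega, by omega, by omega, by omega, trivial, key⟩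
      · rw [if_neg h'] at key
        exact ⟨by omega, by omega, by omega, by omega, by omega, by omega, by omega, trivial, key⟩
  · rintro s' t ⟨ht, ⟨h1, h2⟩, -⟩ -
    rw [runs_block_nil]
    have h3 : n - 1 + 1 = n := by omega
    rw [h3] at h2
    refine ⟨?_, h2⟩
    simp [RExp.cost] at ht ⊢
    have h4 : (n - 1) * (40 * (Nat.log 2 n + 1) + 84 + 3) ≤ n * (40 * (Nat.log 2 n + 1) + 87) :=
      Nat.mul_le_mul (by omega) le_rfl
    have h5 : 1 ≤ n * Nat.log 2 n :=
      Nat.mul_pos (by omega) (Nat.log_pos (by norm_num) hn)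
    nlinarith

/-- The output is filled from the back: after `i` rounds, cell `k - 1 - i` holds the start of a
pointer chain of length `k - i`, which is what is still to be written, this cell included. -/
theorem runs_recover {s : State} {pos : ℕ → ℕ} {D k : ℕ} {L prec : ℕ → ℕ}
    (hk : s.reg rK = k) (hL : s.arr aL = L) (hp : s.arr aPrec = prec)
    (hinv : LoopInv pos D n k L prec) (hW : n + 1 < W) :
    Runs n obs coin W recover s fun s' t =>
      t ≤ 40 * n + 40 ∧ ∃ f : ℕ → ℕ, s'.reg rK = k ∧ (∀ r, r < k → s'.arr aLis r = f r ∧ f r < n) ∧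
        ∀ r, r + 1 < k → f r < f (r + 1) ∧ pos (f r) + D ≤ pos (f (r + 1)) := by
  have hk1 := hinv.one_le
  have hkn := hinv.le
  have hLk := hinv.lt k hk1 le_rfl
  simp only [recover, runs_block_cons, runs_assign, runs_store]
  refine ⟨by simp [RExp.eval, Op.apply, hk]; omega, by simp [RExp.eval, Op.apply, hk]; omega,
    by simp [RExp.eval, hk, hL]; omega, ?_⟩
  refine (runs_while_const (k - 1) (fun i s' => s'.reg rI = k - 1 - i ∧
    (∀ r, k - 1 - i ≤ r → r < k → s'.arr aLis r < n) ∧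
    (∀ r, k - 1 - i ≤ r → r + 1 < k → s'.arr aLis r < s'.arr aLis (r + 1) ∧
      pos (s'.arr aLis r) + D ≤ pos (s'.arr aLis (r + 1))) ∧
    PrecChain pos D prec (k - i) (s'.arr aLis (k - 1 - i))) 30 ?_ ?_ ?_).then ?_
  · simp only [RExp.eval, Op.apply, State.setReg_reg, State.setCell_reg, State.setCell_arr,
      State.setReg_arr, if_true, hk, hL, rI, rK, OfNat.zero_ne_ofNat, if_false] at hk ⊢
    simp only [hk, Nat.sub_zero, Function.update_self]
    refine ⟨trivial, ?_, ?_, hinv.chain k hk1 le_rfl⟩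
    · intro r h1 h2
      obtain rfl : r = k - 1 := by omega
      rwa [Function.update_self]
    · intro r h1 h2
      omega
  · rintro i s' hi ⟨h1, -⟩ -
    simp only [RExp.eval, h1]
    omega
  · rintro i s' hi ⟨h1, h2, h3, h4⟩ hA
    have hp' : s'.arr aPrec = prec := by
      rw [hA.arr aPrec (by decide)]
      simpa using hp
    obtain ⟨j, hj⟩ : ∃ j, k - i = j + 2 := ⟨k - i - 2, by omega⟩
    rw [hj] at h4
    obtain ⟨h5, h6, h7⟩ := h4
    have h8 := h2 (k - 1 - i) le_rfl (by omega)
    simp only [runs_block_cons, runs_block_nil, runs_assign, runs_store, RExp.eval, h1, hp',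
        RExp.cost, State.setReg_reg, State.setReg_arr, State.setCell_reg, State.setCell_arr,
        Op.apply, if_true]
    have e1 : k - 1 - (i + 1) = k - 1 - i - 1 := by omega
    have e2 : k - (i + 1) = j + 1 := by omega
    rw [e1, e2, Function.update_self]
    refine ⟨by omega, by omega, by omega, by omega, rfl, ?_, ?_, h7⟩
    · intro r hr hr'
      rcases eq_or_ne r (k - 1 - i - 1) with rfl | hne
      · rw [Function.update_self]; omega
      · rw [Function.update_of_ne hne]
        exact h2 r (by omega) hr'
    · intro r hr hr'
      rcases eq_or_ne r (k - 1 - i - 1) with rfl | hne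
      · rw [Function.update_self, Function.update_of_ne (by omega)]
        have : k - 1 - i - 1 + 1 = k - 1 - i := by omega
        rw [this]
        exact ⟨h5, h6⟩
      · rw [Function.update_of_ne hne, Function.update_of_ne (by omega)]
        exact h3 r (by omega) hr'
  · rintro s' t ⟨ht, ⟨h1, h2, h3, h4⟩, -⟩ hA
    rw [runs_block_nil]
    refine ⟨?_, s'.arr aLis, ?_, fun r hr => ⟨rfl, h2 r (by omega) hr⟩, fun r hr => h3 r (by omega) hr⟩
    · simp [RExp.cost] at ht ⊢
      omega
    · rw [hA.reg rK (by decide)]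
      simpa using hk

theorem distEnd_of_list {pos : ℕ → ℕ} {D : ℕ} (l : List ℕ) (e : ℕ) :
    (l ++ [e]).Pairwise (· < ·) → (l ++ [e]).IsChain (fun i j => pos i + D ≤ pos j) →
    DistEnd pos D (l.length + 1) e := by
  induction l using List.reverseRecOn generalizing e with
  | nil => intros; trivial
  | append_singleton l a ih =>
    intro h1 h2
    rw [List.length_append, List.length_singleton]
    refine ⟨a, ?_, ?_, ih a ?_ ?_⟩
    · rw [List.pairwise_append] at h1
      exact h1.2.2 a (by simp) e (by simp)
    · rw [List.append_assoc, List.isChain_append] at h2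
      simpa using h2.2.1
    · rw [List.pairwise_append] at h1; exact h1.1
    · rw [List.isChain_append] at h2; exact h2.1

/-- The position of element number `i` in the order `σ`. -/
def posFun (σ : Equiv.Perm (Fin n)) (i : ℕ) : ℕ :=
  if h : i < n then (σ.symm ⟨i, h⟩ : ℕ) else 0

theorem posFun_coe (σ : Equiv.Perm (Fin n)) (i : Fin n) : posFun σ i = (σ.symm i : ℕ) := by
  simp [posFun]

theorem returns_iff {s : State} {l : List (Fin n)} :
    Returns s l ↔ (List.range (s.reg rK)).map (s.arr aLis) = l.map Fin.val := by
  have : (do let a ← l; pure (a : ℕ)) = l.map Fin.val := by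
    induction l <;> simp_all
  rw [Returns, this, List.map_id']

/-- The quality of `σ` plays no role: the output is optimal for any order that the subroutine
leaves. Dislocation enters only when distant subsequences are compared with increasing ones. -/
theorem runs_approximationAlgorithm {sort : Program} {c b : ℕ} {σ : Equiv.Perm (Fin n)}
    (hsort : Runs n obs coin W sort State.init fun s t => t ≤ b ∧ HoldsApx s σ)
    (hn : 2 ≤ n) (hc : 0 < c) (hW : n + 1 < W) (hcW : c * Nat.log 2 n < W) :
    Runs n obs coin W (approximationAlgorithm sort c) State.init fun s t =>
      t ≤ b + 400 * (n * (Nat.log 2 n + 1)) ∧ HoldsApx s σ ∧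
      ∃ l, Returns s l ∧ IsLongestDistantSubseq σ (2 * (c * Nat.log 2 n)) l := by
  have hlog := Nat.log_pos (b := 2) (by norm_num) hn
  simp only [approximationAlgorithm, runs_block_cons]
  refine hsort.then ?_
  rintro s₁ t₁ ⟨ht₁, hσ₁⟩ -
  refine (runs_computePos σ hσ₁ (by omega)).then ?_
  rintro s₂ t₂ ⟨ht₂, hp₂⟩ hA₂
  refine (runs_computeD c hn (by omega) hcW).then ?_
  rintro s₃ t₃ ⟨ht₃, hd₃⟩ hA₃
  refine (runs_mainLoop (pos := posFun σ) hn ?_ ?_ hd₃ (by positivity) hW).then ?_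
  · intro j hj
    rw [hA₃.arr aPos (by simp [computeD, Program.block, Program.arrs])]
    simpa [posFun, hj] using hp₂ ⟨j, hj⟩
  · intro i j hi hj h
    simpa [posFun, hi, hj, Fin.val_inj] using h
  rintro s₄ t₄ ⟨ht₄, hinv⟩ hA₄
  refine (runs_recover rfl rfl rfl hinv hW).then ?_
  rintro s₅ t₅ ⟨ht₅, f, hk, hf, hf'⟩ hA₅
  rw [runs_block_nil]
  refine ⟨?_, ?_, ?_⟩
  · have : Nat.log 2 n ≤ n := Nat.log_le_self 2 n
    have : n * 1 ≤ n * Nat.log 2 n := Nat.mul_le_mul_left _ hlog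
    nlinarith
  · intro q
    rw [hA₅.arr aApx (by decide), hA₄.arr aApx (by decide),
      hA₃.arr aApx (by simp [computeD, Program.block, Program.arrs]), hA₂.arr aApx (by decide)]
    exact hσ₁ q
  · set k := s₄.reg rK with hkdef
    refine ⟨List.ofFn fun r : Fin k => ⟨f r, (hf r r.2).2⟩, ?_, ?_, ?_, ?_⟩
    · rw [returns_iff, hk]
      apply List.ext_getElem
      · simp
      · intro r h1 h2
        simp at h1 h2
        simp [(hf r h1).1]
    · have : (List.ofFn fun r : Fin k => (⟨f r, (hf r r.2).2⟩ : Fin n)).IsChain (· < ·) := by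
        rw [List.isChain_iff_getElem]
        intro i hi
        simp at hi
        simpa using (hf' i hi).1
      exact List.isChain_iff_pairwise.1 this
    · rw [IsDistant, List.isChain_iff_getElem]
      intro i hi
      simp at hi
      have := (hf' i hi).2
      simpa [← posFun_coe] using this
    · intro l' h1 h2
      rw [List.length_ofFn]
      rcases l'.eq_nil_or_concat with rfl | ⟨l, e, rfl⟩
      · simp
      · have := distEnd_of_list (pos := posFun σ) (D := 2 * (c * Nat.log 2 n))
          (l.map Fin.val) e.val ?_ ?_
        · have := (hinv.opt _ _ e.2 this).1
          simpa using this
        · have := List.Pairwise.map (S := (· < ·)) Fin.val (fun _ _ h => h) h1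
          simpa using this
        · have : (List.map Fin.val (l ++ [e])).IsChain
              fun i j => posFun σ i + 2 * (c * Nat.log 2 n) ≤ posFun σ j := by
            rw [List.isChain_map]
            simpa [posFun_coe, IsDistant] using h2
          simpa using this

end Search

/-! ## Distant subsequences of an order with small dislocation -/

section Dislocation
variable {n : ℕ} {α : Type*} [LinearOrder α] {S : Fin n → α}

theorem rank_lt_rank {i j : Fin n} (h : S i < S j) : rank S i < rank S j := by
  apply Finset.card_lt_card
  rw [Finset.ssubset_iff_of_subset]
  · exact ⟨i, by simpa using h, by simp⟩
  · intro k hk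
    simp only [Finset.mem_filter, Finset.mem_univ, true_and] at hk ⊢
    exact hk.trans h

/-- Passing from positions to ranks moves each of the two elements by at most `d`, so a gap of `2 *
d` cannot be reversed; `0 < d` excludes `i = j`. -/
theorem lt_of_pos_add_le {σ : Equiv.Perm (Fin n)} {d : ℕ} (hS : Function.Injective S)
    (hd : 0 < d) (hσ : maxDislocation S σ ≤ d) {i j : Fin n}
    (h : (σ.symm i : ℕ) + 2 * d ≤ (σ.symm j : ℕ)) : S i < S j := by
  have h1 : ∀ i, ((σ.symm i : ℤ) - (rank S i : ℤ)).natAbs ≤ d := fun i =>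
    (Finset.le_sup (f := fun i => ((σ.symm i : ℤ) - (rank S i : ℤ)).natAbs)
      (Finset.mem_univ i)).trans hσ
  have hi := h1 i
  have hj := h1 j
  have hij : i ≠ j := by rintro rfl; omega
  by_contra hcon
  have : S j < S i := lt_of_le_of_ne (not_lt.1 hcon) fun h => hij (hS h.symm)
  have := rank_lt_rank this
  omega

theorem IsDistant.pairwise_lt {σ : Equiv.Perm (Fin n)} {d : ℕ} (hS : Function.Injective S)
    (hd : 0 < d) (hσ : maxDislocation S σ ≤ d) {l : List (Fin n)} (h : IsDistant σ (2 * d) l) :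
    l.Pairwise (fun i j => S i < S j) := by
  have : l.IsChain (fun i j => S i < S j) := List.IsChain.imp
    (fun i j h => lt_of_pos_add_le hS hd hσ h) h
  have htr : IsTrans (Fin n) (fun i j => S i < S j) := ⟨fun _ _ _ => lt_trans⟩
  exact List.isChain_iff_pairwise.1 this

theorem length_eq_sum_filter {β : Type*} (f : β → ℕ) (N : ℕ) (l : List β) (h : ∀ a ∈ l, f a < N) :
    l.length = ∑ r ∈ Finset.range N, (l.filter fun a => f a = r).length := by
  induction l with
  | nil => simp
  | cons a l ih =>
    have h1 : ∀ r, ((a :: l).filter fun a => f a = r).length =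
        (l.filter fun a => f a = r).length + if f a = r then 1 else 0 := by
      intro r
      rw [List.filter_cons]
      by_cases h : f a = r <;> simp [h]
    have h2 := h a (by simp)
    simp only [h1, Finset.sum_add_distrib, ← ih fun a ha => h a (by simp [ha])]
    simp [h2]

/-- The elements of `l'` are split by position modulo `2 * d`. Two elements of one class differ in
position by at least `2 * d`, and the gap has the direction of the values by `lt_of_pos_add_le`. So
each class is a distant subsequence and no longer than `l`. -/
theorem length_le_of_isLongest {σ : Equiv.Perm (Fin n)} {d : ℕ} (hS : Function.Injective S)
    (hd : 0 < d) (hσ : maxDislocation S σ ≤ d) {l l' : List (Fin n)}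
    (hl : IsLongestDistantSubseq σ (2 * d) l) (hl' : IsIncreasingSubseq S l') :
    l'.length ≤ 2 * d * l.length := by
  rw [length_eq_sum_filter (fun i => (σ.symm i : ℕ) % (2 * d)) (2 * d) l'
    (fun a _ => Nat.mod_lt _ (by omega))]
  refine (Finset.sum_le_card_nsmul _ _ l.length fun r _ => hl.2.2 _ ?_ ?_).trans (by simp)
  · exact List.Pairwise.filter _ hl'.1
  · have h1 : (l'.filter fun i => (σ.symm i : ℕ) % (2 * d) = r).Pairwise (fun i j => S i < S j) :=
      List.Pairwise.filter _ hl'.2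
    refine List.Pairwise.isChain ?_
    refine List.Pairwise.imp_of_mem (fun {a b} ha hb hab => ?_) h1
    simp only [List.mem_filter, decide_eq_true_eq] at ha hb
    have hne : (σ.symm a : ℕ) ≠ σ.symm b := by
      intro h
      have := σ.symm.injective (Fin.ext h)
      subst this
      exact lt_irrefl _ hab
    have hmod : (σ.symm a : ℕ) ≡ σ.symm b [MOD 2 * d] := ha.2.trans hb.2.symm
    rcases Nat.lt_or_ge (σ.symm a : ℕ) (σ.symm b) with h | h
    · have := (Nat.modEq_iff_dvd' h.le).1 hmod
      have := Nat.le_of_dvd (by omega) this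
      omega
    · have := (Nat.modEq_iff_dvd' h).1 hmod.symm
      have := Nat.le_of_dvd (by omega) this
      exact absurd hab (lt_of_pos_add_le hS hd hσ (by omega)).asymm

theorem lisLength_le_of_isLongest {σ : Equiv.Perm (Fin n)} {d : ℕ} (hS : Function.Injective S)
    (hd : 0 < d) (hσ : maxDislocation S σ ≤ d) {l : List (Fin n)}
    (hl : IsLongestDistantSubseq σ (2 * d) l) : lisLength S ≤ 2 * d * l.length := by
  apply csSup_le
  · exact ⟨0, [], ⟨List.Pairwise.nil, List.Pairwise.nil⟩, rfl⟩
  · rintro m ⟨l', hl', rfl⟩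
    exact length_le_of_isLongest hS hd hσ hl hl'

end Dislocation

/-! ## The approximate sorting algorithm as a function

`o a b` is the outcome of the comparison of the elements number `a` and `b`. -/

section CountingSort

/-- The position of item `i` when `m` items are sorted stably by the keys `k`. -/
def sortPos (m : ℕ) (k : ℕ → ℕ) (i : ℕ) : ℕ :=
  ((Finset.range m).filter fun i' => k i' < k i).card +
    ((Finset.range i).filter fun i' => k i' = k i).card

/-- The result of sorting the `m` items `x` stably by the keys `k`. -/
def sorted (m : ℕ) (x k : ℕ → ℕ) (p : ℕ) : ℕ :=
  if h : ∃ i, i < m ∧ sortPos m k i = p then x (Nat.find h) else 0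

/-- Stable sorting is sorting by the lexicographic order of key and index, which is a strict total
order on the items; injectivity of `sortPos` follows. -/
theorem sortPos_eq_card {m : ℕ} {k : ℕ → ℕ} {i : ℕ} (hi : i < m) :
    sortPos m k i =
      ((Finset.range m).filter fun i' => k i' < k i ∨ k i' = k i ∧ i' < i).card := by
  rw [sortPos, ← Finset.card_union_of_disjoint]
  · congr 1
    ext j
    simp only [Finset.mem_union, Finset.mem_filter, Finset.mem_range]
    omega
  · rw [Finset.disjoint_left]
    intro j hj hj'
    simp only [Finset.mem_filter, Finset.mem_range] at hj hj'
    omega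

theorem sortPos_lt_sortPos {m : ℕ} {k : ℕ → ℕ} {i i' : ℕ} (hi : i < m) (hi' : i' < m)
    (h : k i < k i' ∨ k i = k i' ∧ i < i') : sortPos m k i < sortPos m k i' := by
  rw [sortPos_eq_card hi, sortPos_eq_card hi']
  apply Finset.card_lt_card
  rw [Finset.ssubset_iff_of_subset]
  · exact ⟨i, by simp [hi, h], by simp⟩
  · intro j hj
    simp only [Finset.mem_filter, Finset.mem_range] at hj ⊢
    omega

theorem sortPos_inj {m : ℕ} {k : ℕ → ℕ} {i i' : ℕ} (hi : i < m) (hi' : i' < m)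
    (h : sortPos m k i = sortPos m k i') : i = i' := by
  by_contra hne
  rcases (by omega : (k i < k i' ∨ k i = k i' ∧ i < i') ∨ (k i' < k i ∨ k i' = k i ∧ i' < i))
    with h1 | h1
  · have := sortPos_lt_sortPos hi hi' h1; omega
  · have := sortPos_lt_sortPos hi' hi h1; omega

theorem sortPos_lt {m : ℕ} {k : ℕ → ℕ} {i : ℕ} (hi : i < m) : sortPos m k i < m := by
  rw [sortPos_eq_card hi]
  calc _ < (Finset.range m).card := by
        apply Finset.card_lt_card
        rw [Finset.ssubset_iff_of_subset (Finset.filter_subset _ _)]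
        exact ⟨i, by simp [hi], by simp⟩
    _ = m := Finset.card_range m

theorem exists_sortPos {m : ℕ} (k : ℕ → ℕ) {p : ℕ} (hp : p < m) : ∃ i, i < m ∧ sortPos m k i = p := by
  let f : Fin m → Fin m := fun i => ⟨sortPos m k i, sortPos_lt i.2⟩
  have hf : Function.Injective f := fun i i' h => Fin.ext (sortPos_inj i.2 i'.2 (by simpa [f] using h))
  obtain ⟨i, hi⟩ := (Finite.injective_iff_surjective.1 hf) ⟨p, hp⟩
  exact ⟨i, i.2, by simpa [f] using hi⟩

theorem sorted_sortPos {m : ℕ} (x : ℕ → ℕ) (k : ℕ → ℕ) {i : ℕ} (hi : i < m) :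
    sorted m x k (sortPos m k i) = x i := by
  have h : ∃ i', i' < m ∧ sortPos m k i' = sortPos m k i := ⟨i, hi, rfl⟩
  rw [sorted, dif_pos h]
  rw [sortPos_inj (Nat.find_spec h).1 hi (Nat.find_spec h).2]

theorem exists_sorted_eq {m : ℕ} (x k : ℕ → ℕ) {p : ℕ} (hp : p < m) :
    ∃ i, i < m ∧ sorted m x k p = x i ∧ sortPos m k i = p := by
  obtain ⟨i, hi, rfl⟩ := exists_sortPos k hp
  exact ⟨i, hi, sorted_sortPos x k hi, rfl⟩

theorem exists_eq_sorted {m : ℕ} (x k : ℕ → ℕ) {i : ℕ} (hi : i < m) :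
    ∃ p, p < m ∧ sorted m x k p = x i :=
  ⟨_, sortPos_lt hi, sorted_sortPos x k hi⟩

theorem sorted_inj {m : ℕ} {x k : ℕ → ℕ} (hx : ∀ i j, i < m → j < m → x i = x j → i = j)
    {p q : ℕ} (hp : p < m) (hq : q < m) (h : sorted m x k p = sorted m x k q) : p = q := by
  obtain ⟨i, hi, h1, rfl⟩ := exists_sorted_eq x k hp
  obtain ⟨j, hj, h2, rfl⟩ := exists_sorted_eq x k hq
  rw [hx i j hi hj (by rw [← h1, ← h2, h])]

theorem sortPos_congr {m : ℕ} {k k' : ℕ → ℕ} (h : ∀ i, i < m → k i = k' i) {i : ℕ} (hi : i < m) :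
    sortPos m k i = sortPos m k' i := by
  rw [sortPos_eq_card hi, sortPos_eq_card hi]
  congr 1
  apply Finset.filter_congr
  intro j hj
  rw [h j (Finset.mem_range.1 hj), h i hi]

theorem sorted_congr {m : ℕ} {x x' k k' : ℕ → ℕ} (hx : ∀ i, i < m → x i = x' i)
    (hk : ∀ i, i < m → k i = k' i) {p : ℕ} (hp : p < m) : sorted m x k p = sorted m x' k' p := by
  obtain ⟨i, hi, rfl⟩ := exists_sortPos k hp
  rw [sorted_sortPos x k hi, sortPos_congr hk hi, sorted_sortPos x' k' hi, hx i hi]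

end CountingSort

/-! ### Nested random samples -/

section Levels

/-- The number of coins tossed before the selection of level `j + 1`. -/
def coinOff (n j : ℕ) : ℕ := ∑ k ∈ Finset.range j, n / 2 ^ (k + 1)

/-- Element number `i` of level `j` of the random samples: one element of each pair of
neighbours of a level is selected for the next level. -/
def lev (coin : ℕ → Bool) (n : ℕ) : ℕ → ℕ → ℕ
  | 0, i => i
  | j + 1, i => lev coin n j (2 * i + (coin (coinOff n j + i)).toNat)

/-- Element `i` of level `j` is drawn from the `2 ^ j` consecutive indices starting at `i * 2 ^ j`.
Hence the elements of a level are distinct, and only full blocks of indices are represented. -/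
theorem lev_div (coin : ℕ → Bool) (n j i : ℕ) : lev coin n j i / 2 ^ j = i := by
  induction j generalizing i with
  | zero => simp [lev]
  | succ j ih =>
    rw [lev, pow_succ, ← Nat.div_div_eq_div_mul, ih]
    have := Bool.toNat_le (coin (coinOff n j + i))
    omega

theorem lev_inj {coin : ℕ → Bool} {n j i i' : ℕ} (h : lev coin n j i = lev coin n j i') :
    i = i' := by
  rw [← lev_div coin n j i, h, lev_div]

theorem lev_lt {coin : ℕ → Bool} {n j i : ℕ} (h : i < n / 2 ^ j) : lev coin n j i < n := by
  have h1 := lev_div coin n j i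
  have h2 : 0 < 2 ^ j := by positivity
  have h3 : lev coin n j i < (i + 1) * 2 ^ j := by
    rw [← Nat.div_lt_iff_lt_mul h2]; omega
  have h4 : (i + 1) * 2 ^ j ≤ n := (Nat.le_div_iff_mul_le h2).1 h
  omega

end Levels

/-! ### Noisy search and the orders of the levels -/

section NoisySearch

/-- The state of a noisy search: the current centre `q` and scale `h` (counted in blocks), the
number of votes for each cell of 64 blocks, and a cell with the most votes. -/
structure Walk where
  q : ℕ
  h : ℕ
  cnt : ℕ → ℕ
  best : ℕ

/-- The answer to the `κ`-th comparison from the state `w`: is the sought element larger than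
those in block `q + (2 * κ - 3) * h`? Blocks are numbered `0, …, N - 1`. -/
def Walk.answer (ans : ℕ → ℕ → Bool) (N : ℕ) (w : Walk) (κ : ℕ) : Bool :=
  decide (w.q + 2 * w.h * κ < 3 * w.h) ||
    (decide (w.q + 2 * w.h * κ - 3 * w.h < N) && ans κ (w.q + 2 * w.h * κ - 3 * w.h))

/-- The number of positive answers among the four comparisons from the state `w`. -/
def Walk.score (ans : ℕ → ℕ → Bool) (N : ℕ) (w : Walk) : ℕ :=
  (w.answer ans N 0).toNat + (w.answer ans N 1).toNat + (w.answer ans N 2).toNat +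
    (w.answer ans N 3).toNat

/-- The new centre after `v` positive answers. -/
def Walk.centre (w : Walk) (v : ℕ) : ℕ :=
  if 0 < v ∧ v < 4 then w.q + 2 * w.h * v - 4 * w.h else w.q

/-- The new scale after `v` positive answers. -/
def Walk.scale (w : Walk) (v : ℕ) : ℕ :=
  if 0 < v ∧ v < 4 then if 8 < w.h then w.h / 2 else w.h else 2 * w.h

/-- Vote for the cell of the centre `q`. -/
def Walk.vote (w : Walk) (q h : ℕ) : Walk where
  q := q
  h := h
  cnt := Function.update w.cnt (q / 64) (w.cnt (q / 64) + 1)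
  best := if Function.update w.cnt (q / 64) (w.cnt (q / 64) + 1) w.best < w.cnt (q / 64) + 1
    then q / 64 else w.best

/-- One round of the noisy search. -/
def Walk.next (ans : ℕ → ℕ → Bool) (N : ℕ) (w : Walk) : Walk :=
  w.vote (w.centre (w.score ans N)) (w.scale (w.score ans N))

/-- The state of the noisy search after `t` rounds, when it starts with scale `h`. -/
def walk (ans : ℕ → ℕ → ℕ → Bool) (N h : ℕ) : ℕ → Walk
  | 0 => ⟨0, h, 0, 0⟩
  | t + 1 => (walk ans N h t).next (ans t) N

/-- The logarithmic factor of the parameters of the algorithm. -/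
def ell (n : ℕ) : ℕ := Nat.log 2 n + 1

/-- The answers of the comparisons of `x` with the `m` elements `π`, which are divided into blocks
of `64 * ell n` elements. -/
def searchAns (o : ℕ → ℕ → Bool) (n : ℕ) (π : ℕ → ℕ) (x t κ b : ℕ) : Bool :=
  o (π (b * (64 * ell n) + (4 * t + κ))) x

/-- The estimated rank of `x` among the `m` elements `π`. -/
def noisyRank (o : ℕ → ℕ → Bool) (n : ℕ) (π : ℕ → ℕ) (m x : ℕ) : ℕ :=
  min ((walk (searchAns o n π x) (m / (64 * ell n)) (8 * 2 ^ ell n) (16 * ell n)).best * 64 *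
    (64 * ell n)) m

/-- The rank of `x` among the `m` elements `π`: its position, if it is one of them, and otherwise
an estimate. -/
def rankIn (o : ℕ → ℕ → Bool) (n : ℕ) (π : ℕ → ℕ) (m x : ℕ) : ℕ :=
  if h : ∃ q, q < m ∧ π q = x then Nat.find h else noisyRank o n π m x

/-- Half the length of the windows in which elements are counted. -/
def window (n : ℕ) : ℕ := 2 ^ 19 * ell n

/-- The rank of the element in position `q` of the `m` elements `ρ`, when the elements in its
window are counted and those before it are assumed to be smaller. -/
def scoreAt (o : ℕ → ℕ → Bool) (w m : ℕ) (ρ : ℕ → ℕ) (q : ℕ) : ℕ :=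
  (q - w) + ((Finset.Ico (q - w) (min (q + w + 1) m)).filter fun r => o (ρ r) (ρ q)).card

/-- The order of the `m` elements `x`, from the order `π` of `m'` elements. -/
def refine (o : ℕ → ℕ → Bool) (n : ℕ) (π : ℕ → ℕ) (m' : ℕ) (x : ℕ → ℕ) (m : ℕ) : ℕ → ℕ :=
  sorted m (sorted m x fun i => rankIn o n π m' (x i))
    (scoreAt o (window n) m (sorted m x fun i => rankIn o n π m' (x i)))

/-- The order of the elements of the `k`-th level from the top. -/
def order (o : ℕ → ℕ → Bool) (coin : ℕ → Bool) (n : ℕ) : ℕ → ℕ → ℕ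
  | 0 => lev coin n (Nat.log 2 n)
  | k + 1 => refine o n (order o coin n k) (n / 2 ^ (Nat.log 2 n - k))
      (lev coin n (Nat.log 2 n - (k + 1))) (n / 2 ^ (Nat.log 2 n - (k + 1)))

theorem rankIn_of_mem {o : ℕ → ℕ → Bool} {n : ℕ} {π : ℕ → ℕ} {m q : ℕ} (hq : q < m)
    (hπ : ∀ q q', q < m → q' < m → π q = π q' → q = q') : rankIn o n π m (π q) = q := by
  have h : ∃ q', q' < m ∧ π q' = π q := ⟨q, hq, rfl⟩
  rw [rankIn, dif_pos h]
  exact hπ _ _ (Nat.find_spec h).1 hq (Nat.find_spec h).2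

theorem rankIn_of_notMem {o : ℕ → ℕ → Bool} {n : ℕ} {π : ℕ → ℕ} {m x : ℕ}
    (h : ∀ q, q < m → π q ≠ x) : rankIn o n π m x = noisyRank o n π m x := by
  rw [rankIn, dif_neg]
  rintro ⟨q, hq, h'⟩
  exact h q hq h'

theorem rankIn_le (o : ℕ → ℕ → Bool) (n : ℕ) (π : ℕ → ℕ) (m x : ℕ) : rankIn o n π m x ≤ m := by
  rw [rankIn]
  split_ifs with h
  · exact (Nat.find_spec h).1.le
  · exact min_le_right _ _

theorem scoreAt_le (o : ℕ → ℕ → Bool) (w m : ℕ) (ρ : ℕ → ℕ) {q : ℕ} (hq : q < m) :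
    scoreAt o w m ρ q ≤ m := by
  have : ((Finset.Ico (q - w) (min (q + w + 1) m)).filter fun r => o (ρ r) (ρ q)).card ≤
      min (q + w + 1) m - (q - w) := by
    simpa using Finset.card_filter_le (Finset.Ico (q - w) (min (q + w + 1) m)) _
  rw [scoreAt]
  omega

/-- Together with `exists_order_eq` and `exists_eq_order`: for any comparison outcomes, the computed
order of a level is a permutation of that level. -/
theorem order_inj {o : ℕ → ℕ → Bool} {coin : ℕ → Bool} {n k p q : ℕ}
    (hp : p < n / 2 ^ (Nat.log 2 n - k)) (hq : q < n / 2 ^ (Nat.log 2 n - k))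
    (h : order o coin n k p = order o coin n k q) : p = q := by
  cases k with
  | zero => exact lev_inj h
  | succ k =>
    exact sorted_inj (fun i j hi hj h => sorted_inj (fun i j _ _ h => lev_inj h) hi hj h) hp hq h

theorem exists_order_eq (o : ℕ → ℕ → Bool) (coin : ℕ → Bool) {n k p : ℕ}
    (hp : p < n / 2 ^ (Nat.log 2 n - k)) :
    ∃ i, i < n / 2 ^ (Nat.log 2 n - k) ∧
      order o coin n k p = lev coin n (Nat.log 2 n - k) i := by
  cases k with
  | zero => exact ⟨p, hp, rfl⟩
  | succ k =>
    obtain ⟨i, hi, h1, -⟩ := exists_sorted_eq (sorted (n / 2 ^ (Nat.log 2 n - (k + 1))) (lev coin n (Nat.log 2 n - (k + 1)))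
      fun i => rankIn o n (order o coin n k) (n / 2 ^ (Nat.log 2 n - k)) (lev coin n (Nat.log 2 n - (k + 1)) i)) _ hp
    obtain ⟨i', hi', h2, -⟩ := exists_sorted_eq (lev coin n (Nat.log 2 n - (k + 1))) _ hi
    exact ⟨i', hi', h1.trans h2⟩

theorem exists_eq_order (o : ℕ → ℕ → Bool) (coin : ℕ → Bool) {n k i : ℕ}
    (hi : i < n / 2 ^ (Nat.log 2 n - k)) :
    ∃ p, p < n / 2 ^ (Nat.log 2 n - k) ∧
      order o coin n k p = lev coin n (Nat.log 2 n - k) i := by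
  cases k with
  | zero => exact ⟨i, hi, rfl⟩
  | succ k =>
    obtain ⟨p, hp, h1⟩ := exists_eq_sorted (lev coin n (Nat.log 2 n - (k + 1)))
      (fun i => rankIn o n (order o coin n k) (n / 2 ^ (Nat.log 2 n - k))
        (lev coin n (Nat.log 2 n - (k + 1)) i)) hi
    obtain ⟨p', hp', h2⟩ := exists_eq_sorted (sorted _ _ _) _ hp
    exact ⟨p', hp', h2.trans h1⟩

theorem order_lt {o : ℕ → ℕ → Bool} {coin : ℕ → Bool} {n k p : ℕ}
    (hp : p < n / 2 ^ (Nat.log 2 n - k)) : order o coin n k p < n := by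
  obtain ⟨i, hi, h⟩ := exists_order_eq o coin hp
  rw [h]
  exact lev_lt hi

end NoisySearch

/-! ## The approximate sorting algorithm as a program -/

/-- The comparison outcomes as a function on natural numbers. -/
def obsNat {n : ℕ} (obs : Fin n → Fin n → Bool) (a b : ℕ) : Bool :=
  if h : a < n ∧ b < n then obs ⟨a, h.1⟩ ⟨b, h.2⟩ else false

section SearchProgram

/-- The array of the levels: element `i` of level `j` is in cell `j * n + i`. -/
abbrev aLev : ℕ := 10
/-- The array of the sorting keys of the elements. -/
abbrev aKey : ℕ := 11
/-- The array of the elements to be sorted by counting. -/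
abbrev aOrd : ℕ := 12
/-- The array of the counters for sorting. -/
abbrev aCnt : ℕ := 13
/-- The array of the votes in a noisy search. -/
abbrev aVote : ℕ := 14
/-- The array of the sizes of the levels. -/
abbrev aSize : ℕ := 15
/-- The element that is searched. -/
abbrev rX : ℕ := 20
/-- The number of elements among which it is searched. -/
abbrev rSub : ℕ := 21
/-- The number of blocks. -/
abbrev rBlocks : ℕ := 22
/-- The size of the blocks. -/
abbrev rStride : ℕ := 23
/-- The number of rounds of a noisy search. -/
abbrev rRounds : ℕ := 24
/-- The centre of a noisy search. -/
abbrev rQ : ℕ := 25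
/-- The scale of a noisy search. -/
abbrev rScale : ℕ := 26
/-- The round of a noisy search. -/
abbrev rStep : ℕ := 27
/-- The number of positive answers. -/
abbrev rScore : ℕ := 28
/-- The cell of the centre. -/
abbrev rCell : ℕ := 29
/-- The cell with the most votes. -/
abbrev rBest : ℕ := 30
/-- The value that stands for zero votes. -/
abbrev rBase : ℕ := 31
/-- The outcome of a comparison or of a coin toss. -/
abbrev rCmp : ℕ := 32
/-- The initial scale of a noisy search. -/
abbrev rScale0 : ℕ := 33
/-- The number `ell n`. -/
abbrev rEll : ℕ := 34
/-- The size of the current level. -/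
abbrev rSize : ℕ := 35
/-- A loop counter. -/
abbrev rIdx : ℕ := 36
/-- The current level. -/
abbrev rLev : ℕ := 37
/-- Half the length of the windows. -/
abbrev rWin : ℕ := 38
/-- A position in a window. -/
abbrev rPt : ℕ := 39
/-- The end of a window. -/
abbrev rEnd : ℕ := 40
/-- The number of levels above the current one. -/
abbrev rUp : ℕ := 41

open RExp in
/-- The unshifted number of the `κ`-th block to compare with. -/
abbrev blockExp (κ : ℕ) : RExp :=
  plus (reg rQ) (op .mul (op .mul (lit 2) (reg rScale)) (lit κ))

open RExp Program in
/-- Count the `κ`-th answer. -/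
def askKey (κ : ℕ) : Program :=
  ifLt (blockExp κ) (op .mul (lit 3) (reg rScale))
    (assign rScore (plus (reg rScore) (lit 1)))
    (ifLt (minus (blockExp κ) (op .mul (lit 3) (reg rScale))) (reg rBlocks)
      (block [
        compare rCmp (cell aApx (plus
          (op .mul (minus (blockExp κ) (op .mul (lit 3) (reg rScale))) (reg rStride))
          (plus (op .mul (lit 4) (reg rStep)) (lit κ)))) (reg rX),
        assign rScore (plus (reg rScore) (reg rCmp))])
      skip)

open RExp Program in
/-- The part of a round in which the centre moves. -/
def searchMove : Program :=
  ifLt (lit 0) (reg rScore)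
    (ifLt (reg rScore) (lit 4)
      (block [
        assign rQ (minus (plus (reg rQ) (op .mul (op .mul (lit 2) (reg rScale)) (reg rScore)))
          (op .mul (lit 4) (reg rScale))),
        ifLt (lit 8) (reg rScale) (assign rScale (op .div (reg rScale) (lit 2))) skip])
      (assign rScale (op .mul (lit 2) (reg rScale))))
    (assign rScale (op .mul (lit 2) (reg rScale)))

open RExp Program in
/-- One round of a noisy search. -/
def searchRound : Program := block [
  assign rScore (lit 0),
  askKey 0, askKey 1, askKey 2, askKey 3,
  searchMove,
  assign rCell (op .div (reg rQ) (lit 64)),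
  ifLt (cell aVote (reg rCell)) (reg rBase) (store aVote (reg rCell) (reg rBase)) skip,
  store aVote (reg rCell) (plus (cell aVote (reg rCell)) (lit 1)),
  ifLt (cell aVote (reg rBest)) (cell aVote (reg rCell)) (assign rBest (reg rCell)) skip,
  assign rStep (plus (reg rStep) (lit 1))]

open RExp Program in
/-- Initialize a noisy search. -/
def searchInit : Program := block [
  assign rBase (plus (reg rBase) (reg rRounds)),
  assign rQ (lit 0),
  assign rScale (reg rScale0),
  assign rBest (lit 0),
  assign rStep (lit 0)]

open RExp Program in
/-- Store the estimated rank of the element `rX` in the array of keys. -/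
def searchKey : Program := block [
  searchInit,
  whileLt (reg rStep) (reg rRounds) searchRound,
  ifLt (op .mul (op .mul (reg rBest) (lit 64)) (reg rStride)) (reg rSub)
    (store aKey (reg rX) (op .mul (op .mul (reg rBest) (lit 64)) (reg rStride)))
    (store aKey (reg rX) (reg rSub))]

variable {n : ℕ} {obs : Fin n → Fin n → Bool} {coin : ℕ → Bool} {W : ℕ}

theorem runs_askKey {s : State} {w : Walk} {N B x t v κ m : ℕ} {π : ℕ → ℕ}
    (hq : s.reg rQ = w.q) (hh : s.reg rScale = w.h) (hN : s.reg rBlocks = N)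
    (hB : s.reg rStride = B) (hx : s.reg rX = x) (ht : s.reg rStep = t) (hv : s.reg rScore = v)
    (hπ : s.arr aApx = π) (hxn : x < n) (hm : ∀ p, p < m → π p < n) (hNB : N * B ≤ m)
    (hκ : 4 * t + κ < B) (hW : v + 1 < W) :
    Runs n obs coin W (askKey κ) s fun s' t' => t' ≤ 60 ∧
      s'.reg rScore = v + (w.answer (fun κ b => obsNat obs (π (b * B + (4 * t + κ))) x) N κ).toNat := by
  rw [askKey, runs_ifLt]
  simp only [RExp.eval, Op.apply, hq, hh, RExp.cost]
  constructor
  · intro h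
    rw [runs_assign]
    simp only [RExp.eval, Op.apply, hv, RExp.cost, State.setReg_reg]
    refine ⟨by omega, by omega, ?_⟩
    simp [Walk.answer, h]
  · intro h
    rw [runs_ifLt]
    simp only [RExp.eval, Op.apply, hq, hh, hN, RExp.cost]
    constructor
    · intro hb
      -- The probed block is one of `N` full blocks, so the offset `4 * t + κ < B` stays inside it
      -- and the position is below `N * B ≤ m`.
      have hlt : π ((w.q + 2 * w.h * κ - 3 * w.h) * B + (4 * t + κ)) < n := by
        apply hm
        have : (w.q + 2 * w.h * κ - 3 * w.h + 1) * B ≤ N * B := Nat.mul_le_mul_right _ hb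
        rw [add_mul] at this
        omega
      simp only [runs_block_cons, runs_block_nil, runs_compare, runs_assign, RExp.eval, Op.apply,
        RExp.cost, hq, hh, hB, ht, hx, hπ, State.setReg_reg, if_true, rScore, rCmp,
        Nat.reduceEqDiff, if_false]
      simp only [rScore] at hv
      refine ⟨hlt, hxn, ?_⟩
      have e : w.answer (fun κ b => obsNat obs (π (b * B + (4 * t + κ))) x) N κ =
          obs ⟨π ((w.q + 2 * w.h * κ - 3 * w.h) * B + (4 * t + κ)), hlt⟩ ⟨x, hxn⟩ := by
        simp [Walk.answer, h, hb, obsNat, hlt, hxn]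
      have := Bool.toNat_le (obs ⟨π ((w.q + 2 * w.h * κ - 3 * w.h) * B + (4 * t + κ)), hlt⟩ ⟨x, hxn⟩)
      rw [hv, e]
      refine ⟨by omega, by omega, rfl⟩
    · intro hb
      rw [runs_skip]
      refine ⟨by omega, ?_⟩
      rw [hv]
      simp [Walk.answer, h, hb]

theorem Walk.scale_le (w : Walk) (v : ℕ) : w.scale v ≤ 2 * w.h := by
  rw [Walk.scale]
  split_ifs <;> omega

theorem Walk.centre_le (w : Walk) (v : ℕ) : w.centre v ≤ w.q + 2 * w.h := by
  rw [Walk.centre]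
  split_ifs with h
  · have : 2 * w.h * v ≤ 2 * w.h * 3 := Nat.mul_le_mul_left _ (by omega)
    omega
  · omega

/-- The scale at most doubles in a round and the centre rises by at most twice the scale. These
crude bounds only serve to show that all numbers fit into words. -/
theorem walk_bounds (ans : ℕ → ℕ → ℕ → Bool) (N h t : ℕ) :
    (walk ans N h t).h ≤ h * 2 ^ t ∧ (walk ans N h t).q + 2 * h ≤ 2 * h * 2 ^ t ∧
      ∀ e, (walk ans N h t).cnt e ≤ t := by
  induction t with
  | zero => simp [walk]
  | succ t ih =>
    obtain ⟨h1, h2, h3⟩ := ih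
    have h4 := Walk.scale_le (walk ans N h t) ((walk ans N h t).score (ans t) N)
    have h5 := Walk.centre_le (walk ans N h t) ((walk ans N h t).score (ans t) N)
    simp only [walk, Walk.next, Walk.vote, pow_succ]
    refine ⟨by nlinarith, by nlinarith, fun e => ?_⟩
    rw [Function.update_apply]
    have := h3 e
    have := h3 ((walk ans N h t).centre ((walk ans N h t).score (ans t) N) / 64)
    split_ifs <;> omega

/-- The state `s` holds the state `w` of a noisy search, where `base` stands for zero votes. -/
structure HoldsWalk (s : State) (w : Walk) (base : ℕ) : Prop where
  q : s.reg rQ = w.q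
  h : s.reg rScale = w.h
  best : s.reg rBest = w.best
  zero : s.reg rBase = base
  cnt : ∀ e, max (s.arr aVote e) base = base + w.cnt e

theorem HoldsWalk.of_agree {s s' : State} {w : Walk} {base : ℕ} {P : Program}
    (h : HoldsWalk s w base) (hA : Agree P s s')
    (hr : ∀ r ∈ [rQ, rScale, rBest, rBase], r ∉ P.regs) (ha : aVote ∉ P.arrs) :
    HoldsWalk s' w base where
  q := by rw [hA.reg _ (hr _ (by simp)), h.q]
  h := by rw [hA.reg _ (hr _ (by simp)), h.h]
  best := by rw [hA.reg _ (hr _ (by simp)), h.best]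
  zero := by rw [hA.reg _ (hr _ (by simp)), h.zero]
  cnt := by rw [hA.arr _ ha]; exact h.cnt

theorem runs_searchMove {s : State} {w : Walk} {v : ℕ}
    (hq : s.reg rQ = w.q) (hh : s.reg rScale = w.h) (hv : s.reg rScore = v)
    (hW : w.q + 2 * w.h < W) :
    Runs n obs coin W searchMove s fun s' t => t ≤ 40 ∧
      s'.reg rQ = w.centre v ∧ s'.reg rScale = w.scale v := by
  have hc := w.centre_le v
  have hs := w.scale_le v
  simp only [searchMove, runs_ifLt, runs_block_cons, runs_block_nil, runs_assign, runs_skip,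
    RExp.eval, Op.apply, RExp.cost, hq, hh, hv, State.setReg_reg, rQ, rScale, Nat.reduceEqDiff,
    if_true, if_false]
  refine ⟨fun h0 => ⟨fun h4 => ⟨?_, fun h8 => ?_, fun h8 => ?_⟩, fun h4 => ?_⟩, fun h0 => ?_⟩
  · rw [Walk.centre, if_pos ⟨h0, h4⟩] at hc
    omega
  · refine ⟨by omega, by omega, ?_, ?_⟩
    · rw [Walk.centre, if_pos ⟨h0, h4⟩]
    · rw [Walk.scale, if_pos ⟨h0, h4⟩, if_pos h8]
  · refine ⟨by omega, ?_, ?_⟩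
    · rw [Walk.centre, if_pos ⟨h0, h4⟩]
    · rw [Walk.scale, if_pos ⟨h0, h4⟩, if_neg h8]
  · refine ⟨by omega, by omega, ?_, ?_⟩
    · rw [Walk.centre, if_neg (by omega)]
    · rw [Walk.scale, if_neg (by omega)]
  · refine ⟨by omega, by omega, ?_, ?_⟩
    · rw [Walk.centre, if_neg (by omega)]
    · rw [Walk.scale, if_neg (by omega)]

theorem runs_searchRound {s : State} {w : Walk} {N B x t base m : ℕ} {π : ℕ → ℕ}
    (hw : HoldsWalk s w base) (hN : s.reg rBlocks = N)
    (hB : s.reg rStride = B) (hx : s.reg rX = x) (ht : s.reg rStep = t)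
    (hπ : s.arr aApx = π) (hxn : x < n) (hm : ∀ p, p < m → π p < n) (hNB : N * B ≤ m)
    (hκ : 4 * t + 3 < B) (hW : w.q + 2 * w.h < W) (hcW : ∀ e, base + w.cnt e + 5 < W)
    (htW : t + 1 < W) :
    Runs n obs coin W searchRound s fun s' t' => t' ≤ 340 ∧ s'.reg rStep = t + 1 ∧
      HoldsWalk s' (w.next (fun κ b => obsNat obs (π (b * B + (4 * t + κ))) x) N) base := by
  have hW5 : 5 < W := by have := hcW 0; omega
  set ans := fun κ b => obsNat obs (π (b * B + (4 * t + κ))) x with hans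
  simp only [searchRound, runs_block_cons, runs_assign]
  refine ⟨by simp [RExp.eval]; omega, ?_⟩
  set s₀ := s.setReg rScore (RExp.eval n s (.lit 0)) with hs₀
  have hw₀ : HoldsWalk s₀ w base :=
    ⟨by simp [s₀, hw.q], by simp [s₀, hw.h], by simp [s₀, hw.best], by simp [s₀, hw.zero],
      by simpa [s₀] using hw.cnt⟩
  -- The four questions differ only in `κ`; each changes nothing of the walk but adds its answer to
  -- the score.
  have key : ∀ κ v (s' : State), κ < 4 → v < 5 → HoldsWalk s' w base → s'.reg rBlocks = N →
      s'.reg rStride = B → s'.reg rX = x → s'.reg rStep = t → s'.arr aApx = π →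
      s'.reg rScore = v →
      Runs n obs coin W (askKey κ) s' fun s'' t' => t' ≤ 60 ∧ HoldsWalk s'' w base ∧
        s''.reg rBlocks = N ∧ s''.reg rStride = B ∧ s''.reg rX = x ∧ s''.reg rStep = t ∧
        s''.arr aApx = π ∧ s''.reg rScore = v + (w.answer ans N κ).toNat := by
    intro κ v s' hκ4 hv5 h1 h2 h3 h4 h5 h6 h7
    refine (runs_askKey h1.q h1.h h2 h3 h4 h5 h7 h6 hxn hm hNB (by omega) (by omega)).then ?_
    rintro s'' t' ⟨ht', hs⟩ hA
    refine ⟨ht', h1.of_agree hA (by simp [askKey, Program.regs, Program.block])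
      (by simp [askKey, Program.arrs, Program.block]), ?_, ?_, ?_, ?_, ?_, hs⟩
    · rw [hA.reg _ (by simp [askKey, Program.regs, Program.block]), h2]
    · rw [hA.reg _ (by simp [askKey, Program.regs, Program.block]), h3]
    · rw [hA.reg _ (by simp [askKey, Program.regs, Program.block]), h4]
    · rw [hA.reg _ (by simp [askKey, Program.regs, Program.block]), h5]
    · rw [hA.arr _ (by simp [askKey, Program.arrs, Program.block]), h6]
  have hb0 := Bool.toNat_le (w.answer ans N 0)
  have hb1 := Bool.toNat_le (w.answer ans N 1)
  have hb2 := Bool.toNat_le (w.answer ans N 2)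
  refine (key 0 0 s₀ (by norm_num) (by norm_num) hw₀ (by simp [s₀, hN]) (by simp [s₀, hB])
    (by simp [s₀, hx]) (by simp [s₀, ht]) (by simp [s₀, hπ]) (by simp [s₀, RExp.eval])).mono ?_
  rintro s₁ t₁ ⟨ht₁, a1, a2, a3, a4, a5, a6, a7⟩
  refine (key 1 _ s₁ (by norm_num) (by omega) a1 a2 a3 a4 a5 a6 a7).mono ?_
  rintro s₂ t₂ ⟨ht₂, b1, b2, b3, b4, b5, b6, b7⟩
  refine (key 2 _ s₂ (by norm_num) (by omega) b1 b2 b3 b4 b5 b6 b7).mono ?_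
  rintro s₃ t₃ ⟨ht₃, c1, c2, c3, c4, c5, c6, c7⟩
  refine (key 3 _ s₃ (by norm_num) (by omega) c1 c2 c3 c4 c5 c6 c7).mono ?_
  rintro s₄ t₄ ⟨ht₄, d1, d2, d3, d4, d5, d6, d7⟩
  have d7' : s₄.reg rScore = w.score ans N := by rw [d7, Walk.score, Nat.zero_add]
  refine (runs_searchMove d1.q d1.h d7' hW).then ?_
  rintro s₅ t₅ ⟨ht₅, e1, e2⟩ hA
  have e3 : s₅.reg rBest = w.best := by rw [hA.reg _ (by decide), d1.best]
  have e4 : s₅.reg rBase = base := by rw [hA.reg _ (by decide), d1.zero]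
  have e5 : s₅.arr aVote = s₄.arr aVote := hA.arr _ (by decide)
  have e6 : s₅.reg rStep = t := by rw [hA.reg _ (by decide), d5]
  have hcnt := d1.cnt
  rw [← e5] at hcnt
  clear hA key hb0 hb1 hb2
  have hcen := w.centre_le (w.score ans N)
  rw [Walk.next]
  generalize w.score ans N = v at *
  generalize w.scale v = h' at *
  generalize w.centre v = q' at *
  simp only [runs_ifLt, runs_block_cons, runs_block_nil, runs_assign, runs_skip, runs_store,
    RExp.eval, Op.apply, RExp.cost, e1, e3, e4, e6, State.setReg_reg, State.setReg_arr,
    State.setCell_reg, State.setCell_arr, rQ, rScale, rCell, rBase, rBest, rStep,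
    Nat.reduceEqDiff, if_true, if_false]
  simp only [rQ, rScale, rCell, rBase, rBest, rStep] at e1 e2 e3 e4 e6
  simp only [e1, e3, e4, e6, Function.update_self]
  have hc1 := hcnt (q' / 64)
  have hc2 := hcnt w.best
  have hc3 := hcW (q' / 64)
  -- Enough to know of the final state: the voted cell holds `base` plus its new count, and all
  -- other cells are untouched.
  have hvote : ∀ (s' : State) (c : ℕ), s'.reg rQ = q' → s'.reg rScale = h' →
      s'.reg rBase = base → s'.reg rBest = (w.vote q' h').best → c = base + w.cnt (q' / 64) + 1 →
      (∀ e, e ≠ q' / 64 → s'.arr aVote e = s₅.arr aVote e) → s'.arr aVote (q' / 64) = c →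
      HoldsWalk s' (w.vote q' h') base := by
    intro s' c h1 h2 h3 h4 h5 h6 h7
    refine ⟨h1, h2, h4, h3, fun e => ?_⟩
    rcases eq_or_ne e (q' / 64) with rfl | hne
    · rw [h7, h5]; simp [Walk.vote]; omega
    · rw [h6 e hne, hcnt]; simp [Walk.vote, hne]
  have hself : s₅.arr aVote w.best = s₅.arr aVote (q' / 64) ∨ w.best ≠ q' / 64 := by
    by_cases h : w.best = q' / 64
    · left; rw [h]
    · right; exact h
  have hdiv : q' / 64 ≤ q' := Nat.div_le_self _ _
  have hbest : (w.vote q' h').best = if w.best ≠ q' / 64 ∧ w.cnt w.best < w.cnt (q' / 64) + 1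
      then q' / 64 else w.best := by
    rw [Walk.vote]
    by_cases h : w.best = q' / 64
    · simp [h]
    · simp [h]
  -- Four cases: the voted cell holds a stale entry below `base` or a current one, and it overtakes
  -- the best cell or not.
  refine ⟨by omega, fun hlt => ⟨by omega, by omega, by omega, by omega, ?_, ?_⟩,
    fun hlt => ⟨by omega, by omega, ?_, ?_⟩⟩
  · intro hlt'
    refine ⟨by omega, by omega, by omega, trivial, ?_⟩
    refine hvote _ (base + 1) (by simp [e1]) (by simp [e2]) (by simp [e4]) ?_ (by omega) ?_ ?_
    · simp only [State.setReg_reg, rBest, rStep, Nat.reduceEqDiff, if_false, if_true, hbest]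
      have hne : w.best ≠ q' / 64 := by
        intro h; rw [h, Function.update_self] at hlt'; omega
      rw [Function.update_of_ne hne, Function.update_of_ne hne] at hlt'
      rw [if_pos ⟨hne, by omega⟩]
    · intro e he; simp [he]
    · simp
  · intro hlt'
    refine ⟨by omega, by omega, trivial, ?_⟩
    refine hvote _ (base + 1) (by simp [e1]) (by simp [e2]) (by simp [e4]) ?_ (by omega) ?_ ?_
    · simp only [State.setReg_reg, State.setCell_reg, rBest, rStep, rCell, Nat.reduceEqDiff,
        if_false, if_true, hbest, e3]
      rw [if_neg]
      rintro ⟨h1, h2⟩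
      rw [Function.update_of_ne h1, Function.update_of_ne h1] at hlt'
      omega
    · intro e he; simp [he]
    · simp
  · intro hlt'
    refine ⟨by omega, by omega, by omega, trivial, ?_⟩
    refine hvote _ (s₅.arr aVote (q' / 64) + 1) (by simp [e1]) (by simp [e2]) (by simp [e4]) ?_
      (by omega) ?_ ?_
    · simp only [State.setReg_reg, rBest, rStep, Nat.reduceEqDiff, if_false, if_true, hbest]
      by_cases h : w.best = q' / 64
      · simp [h]
      · rw [Function.update_of_ne h] at hlt'
        rw [if_pos ⟨h, by omega⟩]
    · intro e he; simp [he]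
    · simp
  · intro hlt'
    refine ⟨by omega, by omega, trivial, ?_⟩
    refine hvote _ (s₅.arr aVote (q' / 64) + 1) (by simp [e1]) (by simp [e2]) (by simp [e4]) ?_
      (by omega) ?_ ?_
    · simp only [State.setReg_reg, State.setCell_reg, rBest, rStep, rCell, Nat.reduceEqDiff,
        if_false, if_true, hbest, e3]
      rw [if_neg]
      rintro ⟨h1, h2⟩
      rw [Function.update_of_ne h1] at hlt'
      omega
    · intro e he; simp [he]
    · simp

end SearchProgram

/-! ### Correctness of one noisy search -/

section SortProgram

variable {n : ℕ} {obs : Fin n → Fin n → Bool} {coin : ℕ → Bool} {W : ℕ}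

theorem ell_pos (n : ℕ) : 0 < ell n := Nat.succ_pos _

theorem lt_two_pow_ell (n : ℕ) : n < 2 ^ ell n := Nat.lt_pow_succ_log_self (by norm_num) n

theorem Walk.answer_congr {ans ans' : ℕ → ℕ → Bool} {N : ℕ} (w : Walk) {κ : ℕ}
    (h : ∀ b, b < N → ans κ b = ans' κ b) : w.answer ans N κ = w.answer ans' N κ := by
  rw [Walk.answer, Walk.answer]
  by_cases hb : w.q + 2 * w.h * κ - 3 * w.h < N
  · rw [h _ hb]
  · simp [hb]

theorem walk_congr {ans ans' : ℕ → ℕ → ℕ → Bool} {N h T : ℕ}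
    (hans : ∀ t κ b, t < T → κ < 4 → b < N → ans t κ b = ans' t κ b) :
    walk ans N h T = walk ans' N h T := by
  induction T with
  | zero => rfl
  | succ T ih =>
    have h1 : ∀ κ, κ < 4 → ∀ b, b < N → ans T κ b = ans' T κ b :=
      fun κ hκ b hb => hans T κ b (by omega) hκ hb
    rw [walk, walk, ih fun t κ b ht hκ hb => hans t κ b (by omega) hκ hb, Walk.next, Walk.next,
      Walk.score, Walk.score, Walk.answer_congr _ (h1 0 (by norm_num)),
      Walk.answer_congr _ (h1 1 (by norm_num)), Walk.answer_congr _ (h1 2 (by norm_num)),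
      Walk.answer_congr _ (h1 3 (by norm_num))]

theorem block_index_lt {m B b i : ℕ} (hb : b < m / B) (hi : i < B) : b * B + i < m := by
  have h1 : (b + 1) * B ≤ m / B * B := Nat.mul_le_mul_right _ hb
  have h2 := Nat.div_mul_le_self m B
  rw [add_mul] at h1
  omega

theorem noisyRank_congr {o o' : ℕ → ℕ → Bool} {π π' : ℕ → ℕ} {m x : ℕ}
    (h : ∀ p, p < m → o (π p) x = o' (π' p) x) :
    noisyRank o n π m x = noisyRank o' n π' m x := by
  rw [noisyRank, noisyRank, walk_congr (ans' := searchAns o' n π' x)]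
  intro t κ b ht hκ hb
  exact h _ (block_index_lt hb (by omega))

/-- Votes of earlier searches are never erased. By `hvote`, raising `base` by the number of rounds
puts every old entry at or below the value that stands for zero votes, so starting a search takes
constant time. -/
theorem runs_searchKey {s : State} {x base m : ℕ} {π key : ℕ → ℕ}
    (hN : s.reg rBlocks = m / (64 * ell n)) (hB : s.reg rStride = 64 * ell n)
    (hT : s.reg rRounds = 16 * ell n) (hh : s.reg rScale0 = 8 * 2 ^ ell n)
    (hm : s.reg rSub = m) (hx : s.reg rX = x) (hbase : s.reg rBase = base)
    (hπ : s.arr aApx = π) (hkey : s.arr aKey = key) (hxn : x < n) (hπn : ∀ p, p < m → π p < n)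
    (hvote : ∀ e, s.arr aVote e ≤ base + 16 * ell n) (hnW : n < W) (hmW : m < W)
    (hW : 2 ^ (40 * ell n) ≤ W) (hbW : base + 32 * ell n + 5 < W) :
    Runs n obs coin W searchKey s fun s' t => t ≤ 6000 * ell n ∧
      s'.arr aKey = Function.update key x (noisyRank (obsNat obs) n π m x) ∧
      s'.reg rBase = base + 16 * ell n ∧ ∀ e, s'.arr aVote e ≤ base + 16 * ell n + 16 * ell n := by
  have hl := ell_pos n
  -- The scale may double in each of the `16 * ell n` rounds; the exponent `5 + ell n + 16 * ell n`
  -- is still below `40 * ell n`.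
  have hpow : ∀ t, t ≤ 16 * ell n → 4 * (8 * 2 ^ ell n) * 2 ^ t < W := by
    intro t ht
    refine lt_of_lt_of_le ?_ hW
    rw [show 4 * (8 * 2 ^ ell n) * 2 ^ t = 2 ^ (5 + ell n + t) by rw [pow_add, pow_add]; ring]
    exact Nat.pow_lt_pow_right (by norm_num) (by omega)
  have h0 := hpow 0 (by omega)
  have hrun : Runs n obs coin W searchInit s fun s' t => t ≤ 20 ∧ s'.reg rStep = 0 ∧
      HoldsWalk s' ⟨0, 8 * 2 ^ ell n, 0, 0⟩ (base + 16 * ell n) := by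
    simp only [searchInit, runs_block_cons, runs_block_nil, runs_assign, RExp.eval, Op.apply, RExp.cost,
      hbase, hT, State.setReg_reg]
    refine ⟨by omega, by omega, by simp [hh]; omega, by omega, by omega, by omega, by simp, ?_⟩
    exact ⟨by simp, by simp [hh], by simp, by simp, fun e => by simpa using hvote e⟩
  rw [searchKey, runs_block_cons]
  refine hrun.then ?_
  rintro s₁ t₁ ⟨ht₁, hs₁, hw₁⟩ hA
  rw [runs_block_cons]
  refine (runs_while_const (16 * ell n) (fun t s' => s'.reg rStep = t ∧ HoldsWalk s'
    (walk (searchAns (obsNat obs) n π x) (m / (64 * ell n)) (8 * 2 ^ ell n) t)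
    (base + 16 * ell n)) 340 ⟨hs₁, hw₁⟩ ?_ ?_).then ?_
  · rintro i s' hi ⟨h1, -⟩ hA'
    simp only [RExp.eval, h1]
    rw [hA'.reg rRounds (by decide), hA.reg rRounds (by decide), hT]
  · rintro t s' ht ⟨h1, h2⟩ hA'
    obtain ⟨b1, b2, b3⟩ := walk_bounds (searchAns (obsNat obs) n π x) (m / (64 * ell n))
      (8 * 2 ^ ell n) t
    refine (runs_searchRound h2 (by rw [hA'.reg rBlocks (by decide), hA.reg rBlocks (by decide),
      hN]) (by rw [hA'.reg rStride (by decide), hA.reg rStride (by decide), hB])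
      (by rw [hA'.reg rX (by decide), hA.reg rX (by decide), hx]) h1
      (by rw [hA'.arr aApx (by decide), hA.arr aApx (by decide), hπ]) hxn hπn
      (Nat.div_mul_le_self _ _) (by omega) ?_ ?_ ?_).mono ?_
    · have := hpow t (by omega)
      nlinarith
    · intro e
      have := b3 e
      omega
    · have := hpow 0 (by omega); omega
    · rintro s'' t'' ⟨h3, h4, h5⟩
      exact ⟨h3, h4, h5⟩
  · rintro s₂ t₂ ⟨ht₂, ⟨h1, h2⟩, -⟩ hA'
    have e1 : s₂.reg rStride = 64 * ell n := by
      rw [hA'.reg rStride (by decide), hA.reg rStride (by decide), hB]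
    have e2 : s₂.reg rSub = m := by rw [hA'.reg rSub (by decide), hA.reg rSub (by decide), hm]
    have e3 : s₂.reg rX = x := by rw [hA'.reg rX (by decide), hA.reg rX (by decide), hx]
    have e4 : s₂.arr aKey = key := by
      rw [hA'.arr aKey (by decide), hA.arr aKey (by decide), hkey]
    have b3 := (walk_bounds (searchAns (obsNat obs) n π x) (m / (64 * ell n))
      (8 * 2 ^ ell n) (16 * ell n)).2.2
    have hv : ∀ e, s₂.arr aVote e ≤ base + 16 * ell n + 16 * ell n := by
      intro e
      have := h2.cnt e
      have := b3 e
      omega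
    simp only [RExp.cost] at ht₂
    rw [runs_block_cons]
    simp only [runs_block_nil, runs_ifLt, runs_store, RExp.eval, Op.apply, RExp.cost, e1, e2, e3,
      e4, h2.best, State.setCell_reg, State.setCell_arr, h2.zero, if_true]
    refine ⟨fun hlt => ⟨by omega, by omega, by omega, ?_, trivial, by simpa using hv⟩,
      fun hlt => ⟨by omega, by omega, by omega, ?_, trivial, by simpa using hv⟩⟩
    · rw [noisyRank, min_eq_left (by omega)]
    · rw [noisyRank, min_eq_right (by omega)]

end SortProgram

/-! ### Counting sort -/

section SortProgram

open RExp Program in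
/-- Sort the elements in `aOrd` by their keys and write them to `aApx`. -/
def countingSort : Program := block [
  assign rIdx (lit 0),
  whileLt (reg rIdx) (plus (reg rSize) (lit 2)) (block [
    store aCnt (reg rIdx) (lit 0),
    assign rIdx (plus (reg rIdx) (lit 1))]),
  assign rIdx (lit 0),
  whileLt (reg rIdx) (reg rSize) (block [
    store aCnt (plus (cell aKey (cell aOrd (reg rIdx))) (lit 1))
      (plus (cell aCnt (plus (cell aKey (cell aOrd (reg rIdx))) (lit 1))) (lit 1)),
    assign rIdx (plus (reg rIdx) (lit 1))]),
  assign rIdx (lit 0),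
  whileLt (reg rIdx) (reg rSize) (block [
    store aCnt (plus (reg rIdx) (lit 1))
      (plus (cell aCnt (plus (reg rIdx) (lit 1))) (cell aCnt (reg rIdx))),
    assign rIdx (plus (reg rIdx) (lit 1))]),
  assign rIdx (lit 0),
  whileLt (reg rIdx) (reg rSize) (block [
    store aApx (cell aCnt (cell aKey (cell aOrd (reg rIdx)))) (cell aOrd (reg rIdx)),
    store aCnt (cell aKey (cell aOrd (reg rIdx)))
      (plus (cell aCnt (cell aKey (cell aOrd (reg rIdx)))) (lit 1)),
    assign rIdx (plus (reg rIdx) (lit 1))])]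

variable {n : ℕ} {obs : Fin n → Fin n → Bool} {coin : ℕ → Bool} {W : ℕ}

theorem card_filter_range_succ (p : ℕ → Prop) [DecidablePred p] (i : ℕ) :
    ((Finset.range (i + 1)).filter p).card =
      ((Finset.range i).filter p).card + if p i then 1 else 0 := by
  rw [Finset.range_add_one, Finset.filter_insert]
  split_ifs
  · rw [Finset.card_insert_of_notMem (by simp)]
  · simp

/-- A key `k` is first counted in cell `k + 1`. Prefix sums then turn cell `v` into the number of
keys below `v`, the first place for items with key `v`, and each item placed advances its cell.
Because of the shift and because keys may equal `m`, there are `m + 2` cells. -/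
theorem runs_countingSort {s : State} {m : ℕ} {x key k : ℕ → ℕ} (hm : s.reg rSize = m)
    (hx : ∀ i, i < m → s.arr aOrd i = x i) (hkey : s.arr aKey = key)
    (hk : ∀ i, i < m → key (x i) = k i) (hkm : ∀ i, i < m → k i ≤ m)
    (hxn : ∀ i, i < m → x i < n) (hmn : m ≤ n) (hW : 2 * n + 5 < W) :
    Runs n obs coin W countingSort s fun s' t => t ≤ 200 * (m + 1) ∧
      ∀ p, p < m → s'.arr aApx p = sorted m x k p := by
  have hcard : ∀ (l : ℕ) (p : ℕ → Prop) [DecidablePred p], ((Finset.range l).filter p).card ≤ l :=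
    fun l p _ => by simpa using Finset.card_filter_le (Finset.range l) p
  simp only [countingSort, runs_block_cons, runs_assign]
  refine ⟨by simp [RExp.eval]; omega, ?_⟩
  refine (runs_while_const (m + 2) (fun i s' => s'.reg rIdx = i ∧ ∀ v, v < i → s'.arr aCnt v = 0)
    20 (by simp [RExp.eval]) ?_ ?_).then ?_
  · rintro i s' hi ⟨h1, -⟩ hA
    have : s'.reg rSize = m := by rw [hA.reg rSize (by decide)]; simpa using hm
    simp only [RExp.eval, h1, this, Op.apply]
  · rintro i s' hi ⟨h1, h2⟩ hA
    simp only [runs_block_cons, runs_block_nil, runs_assign, runs_store, RExp.eval, h1, Op.apply,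
      RExp.cost, State.setCell_reg, State.setReg_reg, State.setCell_arr, State.setReg_arr, if_true]
    refine ⟨by omega, by omega, by omega, by omega, trivial, ?_⟩
    intro v hv
    rcases eq_or_ne v i with rfl | hne
    · simp
    · rw [Function.update_of_ne hne]
      exact h2 v (by omega)
  rintro s₁ t₁ ⟨ht₁, ⟨-, hz⟩, -⟩ hA₁
  have hm₁ : s₁.reg rSize = m := by rw [hA₁.reg rSize (by decide)]; simpa using hm
  have ho₁ : s₁.arr aOrd = s.arr aOrd := by rw [hA₁.arr aOrd (by decide)]; simp
  have hk₁ : s₁.arr aKey = key := by rw [hA₁.arr aKey (by decide)]; simpa using hkey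
  clear hA₁
  refine ⟨by simp [RExp.eval]; omega, ?_⟩
  refine (runs_while_const m (fun i s' => s'.reg rIdx = i ∧ ∀ v, v ≤ m + 1 → s'.arr aCnt v =
    ((Finset.range i).filter fun i' => k i' + 1 = v).card) 30 ?_ ?_ ?_).then ?_
  · exact ⟨by simp [RExp.eval], fun v hv => by simpa using hz v (by omega)⟩
  · rintro i s' hi ⟨h1, -⟩ hA
    have : s'.reg rSize = m := by rw [hA.reg rSize (by decide)]; simpa using hm₁
    simp only [RExp.eval, h1, this, Op.apply]
  · rintro i s' hi ⟨h1, h2⟩ hA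
    have e1 : s'.arr aOrd i = x i := by
      rw [hA.arr aOrd (by decide)]; simpa [ho₁] using hx i hi
    have e2 : s'.arr aKey = key := by rw [hA.arr aKey (by decide)]; simpa using hk₁
    have e3 := hkm i hi
    have e4 := h2 (k i + 1) (by omega)
    have e5 := hcard i (fun i' => k i' + 1 = k i + 1)
    simp only [runs_block_cons, runs_block_nil, runs_assign, runs_store, RExp.eval, h1, Op.apply,
      RExp.cost, State.setCell_reg, State.setReg_reg, State.setCell_arr, State.setReg_arr, if_true,
      e1, e2, hk i hi, e4]
    refine ⟨by omega, by omega, by omega, by omega, trivial, ?_⟩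
    intro v hv
    rw [card_filter_range_succ]
    rcases eq_or_ne v (k i + 1) with rfl | hne
    · simp
    · rw [Function.update_of_ne hne, if_neg hne.symm]
      exact h2 v hv
  rintro s₂ t₂ ⟨ht₂, ⟨-, hz₂⟩, -⟩ hA₂
  have hm₂ : s₂.reg rSize = m := by rw [hA₂.reg rSize (by decide)]; simpa using hm₁
  have ho₂ : s₂.arr aOrd = s.arr aOrd := by rw [hA₂.arr aOrd (by decide)]; simpa using ho₁
  have hk₂ : s₂.arr aKey = key := by rw [hA₂.arr aKey (by decide)]; simpa using hk₁
  clear hA₂ hz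
  refine ⟨by simp [RExp.eval]; omega, ?_⟩
  refine (runs_while_const m (fun i s' => s'.reg rIdx = i ∧ ∀ v, v ≤ m → s'.arr aCnt v =
    if v ≤ i then ((Finset.range m).filter fun i' => k i' < v).card else
    ((Finset.range m).filter fun i' => k i' + 1 = v).card) 30 ?_ ?_ ?_).then ?_
  · refine ⟨by simp [RExp.eval], fun v hv => ?_⟩
    rw [State.setReg_arr, hz₂ v (by omega)]
    split_ifs with h
    · obtain rfl : v = 0 := by omega
      simp
    · rfl
  · rintro i s' hi ⟨h1, -⟩ hA
    have : s'.reg rSize = m := by rw [hA.reg rSize (by decide)]; simpa using hm₂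
    simp only [RExp.eval, h1, this, Op.apply]
  · rintro i s' hi ⟨h1, h2⟩ hA
    have e4 := h2 (i + 1) (by omega)
    have e5 := h2 i (by omega)
    rw [if_neg (by omega)] at e4
    rw [if_pos le_rfl] at e5
    have e6 := hcard m (fun i' => k i' + 1 = i + 1)
    have e7 := hcard m (fun i' => k i' < i)
    have e8 : ((Finset.range m).filter fun i' => k i' < i + 1).card =
        ((Finset.range m).filter fun i' => k i' + 1 = i + 1).card +
        ((Finset.range m).filter fun i' => k i' < i).card := by
      rw [← Finset.card_union_of_disjoint]
      · congr 1
        ext j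
        simp only [Finset.mem_union, Finset.mem_filter, Finset.mem_range]
        omega
      · rw [Finset.disjoint_left]
        intro j hj hj'
        simp only [Finset.mem_filter, Finset.mem_range] at hj hj'
        omega
    simp only [runs_block_cons, runs_block_nil, runs_assign, runs_store, RExp.eval, h1, Op.apply,
      RExp.cost, State.setCell_reg, State.setReg_reg, State.setCell_arr, State.setReg_arr, if_true,
      e4, e5]
    refine ⟨by omega, by omega, by omega, by omega, trivial, ?_⟩
    intro v hv
    rcases eq_or_ne v (i + 1) with rfl | hne
    · rw [Function.update_self, if_pos le_rfl, e8]
    · rw [Function.update_of_ne hne, h2 v hv]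
      split_ifs <;> first | rfl | omega
  rintro s₃ t₃ ⟨ht₃, ⟨-, hz₃⟩, -⟩ hA₃
  have hm₃ : s₃.reg rSize = m := by rw [hA₃.reg rSize (by decide)]; simpa using hm₂
  have ho₃ : s₃.arr aOrd = s.arr aOrd := by rw [hA₃.arr aOrd (by decide)]; simpa using ho₂
  have hk₃ : s₃.arr aKey = key := by rw [hA₃.arr aKey (by decide)]; simpa using hk₂
  clear hA₃ hz₂
  refine ⟨by simp [RExp.eval]; omega, ?_⟩
  -- Cell `v` holds the next free place for key `v`; for the key of item `i` this is by definition
  -- `sortPos m k i`.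
  refine (runs_while_const m (fun i s' => s'.reg rIdx = i ∧ (∀ v, v ≤ m → s'.arr aCnt v =
    ((Finset.range m).filter fun i' => k i' < v).card +
      ((Finset.range i).filter fun i' => k i' = v).card) ∧
    ∀ i', i' < i → s'.arr aApx (sortPos m k i') = x i') 40 ?_ ?_ ?_).then ?_
  · refine ⟨by simp [RExp.eval], fun v hv => ?_, by simp⟩
    rw [State.setReg_arr, hz₃ v (by omega), if_pos hv]
    simp
  · rintro i s' hi ⟨h1, -⟩ hA
    have : s'.reg rSize = m := by rw [hA.reg rSize (by decide)]; simpa using hm₃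
    simp only [RExp.eval, h1, this, Op.apply]
  · rintro i s' hi ⟨h1, h2, h3⟩ hA
    have e1 : s'.arr aOrd i = x i := by
      rw [hA.arr aOrd (by decide)]; simpa [ho₃] using hx i hi
    have e2 : s'.arr aKey = key := by rw [hA.arr aKey (by decide)]; simpa using hk₃
    have e3 := hkm i hi
    have e4 : s'.arr aCnt (k i) = sortPos m k i := h2 (k i) (by omega)
    have e5 := sortPos_lt (k := k) hi
    have e6 := hxn i hi
    simp only [runs_block_cons, runs_block_nil, runs_assign, runs_store, RExp.eval, h1, Op.apply,
      RExp.cost, State.setCell_reg, State.setReg_reg, State.setCell_arr, State.setReg_arr, if_true,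
      e1, e2, hk i hi, aKey, aOrd, aApx, aCnt, Nat.reduceEqDiff, if_false, OfNat.ofNat_ne_zero]
    simp only [aKey, aOrd, aApx, aCnt] at e1 e2 e4 h2 h3
    simp only [e1, e2, e4, hk i hi]
    refine ⟨by omega, by omega, by omega, by omega, by omega, by omega, trivial, ?_, ?_⟩
    · intro v hv
      rw [card_filter_range_succ]
      rcases eq_or_ne v (k i) with rfl | hne
      · rw [Function.update_self, if_pos rfl, ← e4, h2 _ hv, add_assoc]
      · rw [Function.update_of_ne hne, if_neg hne.symm]
        exact h2 v hv
    · intro i' hi'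
      rcases eq_or_ne i' i with rfl | hne
      · simp
      · rw [Function.update_of_ne]
        · exact h3 i' (by omega)
        · intro h
          exact hne (sortPos_inj (by omega) hi h)
  rintro s₄ t₄ ⟨ht₄, ⟨-, -, hz₄⟩, -⟩ hA₄
  rw [runs_block_nil]
  refine ⟨?_, ?_⟩
  · simp only [RExp.cost] at ht₁ ht₂ ht₃ ht₄ ⊢
    omega
  · intro p hp
    obtain ⟨i, hi, rfl⟩ := exists_sortPos k hp
    rw [hz₄ i hi, sorted_sortPos x k hi]

end SortProgram

/-! ### Rank estimates and window scores of a level -/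

section SortProgram

open RExp Program in
/-- Estimate the ranks of the elements of the current level by noisy searches. -/
def searchLevel : Program := block [
  assign rIdx (lit 0),
  whileLt (reg rIdx) (reg rSize) (block [
    assign rX (cell aLev (plus (op .mul (reg rLev) len) (reg rIdx))),
    store aOrd (reg rIdx) (reg rX),
    searchKey,
    assign rIdx (plus (reg rIdx) (lit 1))]),
  assign rIdx (lit 0),
  whileLt (reg rIdx) (reg rSub) (block [
    store aKey (cell aApx (reg rIdx)) (reg rIdx),
    assign rIdx (plus (reg rIdx) (lit 1))])]

open RExp Program in
/-- Compute the scores of the elements of the current level in their windows. -/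
def scoreLevel : Program := block [
  assign rIdx (lit 0),
  whileLt (reg rIdx) (reg rSize) (block [
    assign rX (cell aApx (reg rIdx)),
    store aOrd (reg rIdx) (reg rX),
    assign rScore (minus (reg rIdx) (reg rWin)),
    assign rPt (minus (reg rIdx) (reg rWin)),
    assign rEnd (plus (plus (reg rIdx) (reg rWin)) (lit 1)),
    ifLt (reg rSize) (reg rEnd) (assign rEnd (reg rSize)) skip,
    whileLt (reg rPt) (reg rEnd) (block [
      compare rCmp (cell aApx (reg rPt)) (reg rX),
      assign rScore (plus (reg rScore) (reg rCmp)),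
      assign rPt (plus (reg rPt) (lit 1))]),
    store aKey (reg rX) (reg rScore),
    assign rIdx (plus (reg rIdx) (lit 1))])]

/-- Compute the order of the current level from that of the level above it. -/
def refineLevel : Program := .block [searchLevel, countingSort, scoreLevel, countingSort]

variable {n : ℕ} {obs : Fin n → Fin n → Bool} {coin : ℕ → Bool} {W : ℕ}

/-- All elements of the level are searched, also those of the sparser level; the second loop
replaces the keys of the latter by their positions, which yields `rankIn`. -/
theorem runs_searchLevel {s : State} {base m m' j : ℕ} {π x : ℕ → ℕ}
    (hN : s.reg rBlocks = m' / (64 * ell n)) (hB : s.reg rStride = 64 * ell n)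
    (hT : s.reg rRounds = 16 * ell n) (hh : s.reg rScale0 = 8 * 2 ^ ell n)
    (hm' : s.reg rSub = m') (hm : s.reg rSize = m) (hj : s.reg rLev = j)
    (hbase : s.reg rBase = base)
    (hπ : s.arr aApx = π) (hx : ∀ i, i < m → s.arr aLev (j * n + i) = x i)
    (hxn : ∀ i, i < m → x i < n) (hπn : ∀ p, p < m' → π p < n)
    (hxi : ∀ i i', i < m → i' < m → x i = x i' → i = i')
    (hπi : ∀ i i', i < m' → i' < m' → π i = π i' → i = i')
    (hvote : ∀ e, s.arr aVote e ≤ base + 16 * ell n) (hmn : m ≤ n) (hmn' : m' ≤ n)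
    (hnW : 2 * n + 5 < W)
    (hW : 2 ^ (40 * ell n) ≤ W) (hbW : base + m * (16 * ell n) + 32 * ell n + 5 < W) :
    Runs n obs coin W searchLevel s fun s' t => t ≤ 6100 * (m * ell n) + 20 * m' + 20 ∧
      s'.reg rBase = base + m * (16 * ell n) ∧
      (∀ e, s'.arr aVote e ≤ base + m * (16 * ell n) + 16 * ell n) ∧
      (∀ i, i < m → s'.arr aOrd i = x i) ∧
      ∀ i, i < m → s'.arr aKey (x i) = rankIn (obsNat obs) n π m' (x i) := by
  have hl := ell_pos n
  simp only [searchLevel, runs_block_cons, runs_assign]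
  refine ⟨by simp [RExp.eval]; omega, ?_⟩
  refine (runs_while_const m (fun i s' => s'.reg rIdx = i ∧
    s'.reg rBase = base + i * (16 * ell n) ∧
    (∀ e, s'.arr aVote e ≤ base + i * (16 * ell n) + 16 * ell n) ∧
    (∀ i', i' < i → s'.arr aOrd i' = x i') ∧
    ∀ i', i' < i → s'.arr aKey (x i') = noisyRank (obsNat obs) n π m' (x i'))
    (6000 * ell n + 30) ?_ ?_ ?_).then ?_
  · exact ⟨by simp [RExp.eval], by simpa using hbase, by simpa using hvote, by simp, by simp⟩
  · rintro i s' hi ⟨h1, -⟩ hA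
    have : s'.reg rSize = m := by rw [hA.reg rSize (by decide)]; simpa using hm
    simp only [RExp.eval, h1, this]
  · rintro i s' hi ⟨h1, h2, h3, h4, h5⟩ hA
    have g1 : s'.reg rLev = j := by rw [hA.reg rLev (by decide)]; simpa using hj
    have g2 : s'.arr aLev (j * n + i) = x i := by
      rw [hA.arr aLev (by decide)]; simpa using hx i hi
    have g3 := hxn i hi
    have g4 : i * (16 * ell n) + 16 * ell n ≤ m * (16 * ell n) := by
      rw [← Nat.succ_mul]; exact Nat.mul_le_mul_right _ hi
    have gr : ∀ r v, r ∉ (searchKey.regs ++ [rX, rIdx]) → s.reg r = v → s'.reg r = v := by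
      intro r v hr hv
      simp only [List.mem_append, not_or] at hr
      rw [hA.reg r (by
        simp only [Program.regs, Program.block, List.mem_append, List.mem_cons,
          List.not_mem_nil, or_false, false_or] at hr ⊢
        tauto)]
      have : r ≠ rIdx := by rintro rfl; simp at hr
      simpa [this] using hv
    simp only [runs_block_cons, runs_block_nil, runs_assign, runs_store, RExp.eval, h1, Op.apply,
      RExp.cost, State.setCell_reg, State.setReg_reg, State.setCell_arr, State.setReg_arr, if_true,
      g1, g2, rX, rIdx, Nat.reduceEqDiff, if_false]
    simp only [rIdx] at h1
    refine ⟨by omega, by omega, by omega, ?_⟩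
    refine (runs_searchKey (π := π) (key := s'.arr aKey) (base := base + i * (16 * ell n))
      (x := x i) (m := m') ?_ ?_ ?_ ?_ ?_ ?_ ?_ ?_ ?_ ?_ hπn ?_ ?_ ?_ hW ?_).then ?_
    · simpa using gr _ _ (by decide) hN
    · simpa using gr _ _ (by decide) hB
    · simpa using gr _ _ (by decide) hT
    · simpa using gr _ _ (by decide) hh
    · simpa using gr _ _ (by decide) hm'
    · simp
    · simpa using h2
    · simp only [State.setCell_arr, aApx, aOrd, OfNat.zero_ne_ofNat, if_false, State.setReg_arr]
      rw [hA.arr aApx (by decide)]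
      simpa using hπ
    · simp
    · exact g3
    · simpa using h3
    · omega
    · omega
    · omega
    rintro s₁ t₁ ⟨ht₁, h6, h7, h8⟩ hA₁
    have h9 : s₁.reg 36 = i := by
      rw [hA₁.reg _ (by decide)]
      simpa using h1
    have h10 : s₁.arr aOrd = Function.update (s'.arr aOrd) i (x i) := by
      rw [hA₁.arr _ (by decide)]
      simp [h1]
    refine ⟨by omega, by omega, by omega, ?_, ?_, ?_, ?_⟩
    · rw [if_neg (by decide), h7]; ring
    · intro e
      have := h8 e
      rw [add_mul]
      omega
    · intro i' hi'
      rw [h10]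
      rcases eq_or_ne i' i with rfl | hne
      · simp
      · rw [Function.update_of_ne hne, h4 i' (by omega)]
    · intro i' hi'
      rw [h6]
      rcases eq_or_ne i' i with rfl | hne
      · simp
      · rw [Function.update_of_ne, h5 i' (by omega)]
        exact fun h => hne (hxi _ _ (by omega) hi h)
  rintro s₁ t₁ ⟨ht₁, ⟨-, h2, h3, h4, h5⟩, -⟩ hA₁
  have hm₁ : s₁.reg rSub = m' := by rw [hA₁.reg _ (by decide)]; simpa using hm'
  have hπ₁ : s₁.arr aApx = π := by rw [hA₁.arr _ (by decide)]; simpa using hπ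
  refine ⟨by simp [RExp.eval]; omega, ?_⟩
  refine (runs_while_const m' (fun i s' => s'.reg rIdx = i ∧
    (∀ q, q < i → s'.arr aKey (π q) = q) ∧
    ∀ y, (∀ q, q < i → π q ≠ y) → s'.arr aKey y = s₁.arr aKey y) 15 ?_ ?_ ?_).then ?_
  · exact ⟨by simp [RExp.eval], by simp, by simp⟩
  · rintro i s' hi ⟨h1, -⟩ hA
    have : s'.reg rSub = m' := by rw [hA.reg rSub (by decide)]; simpa using hm₁
    simp only [RExp.eval, h1, this]
  · rintro i s' hi ⟨h1, h6, h7⟩ hA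
    have g2 : s'.arr aApx = π := by
      rw [hA.arr aApx (by decide)]; simpa using hπ₁
    have g3 := hπn i hi
    simp only [runs_block_cons, runs_block_nil, runs_assign, runs_store, RExp.eval, h1, Op.apply,
      RExp.cost, State.setCell_reg, State.setReg_reg, State.setCell_arr, State.setReg_arr, if_true,
      g2]
    refine ⟨by omega, by omega, by omega, by omega, trivial, ?_, ?_⟩
    · intro q hq
      rcases eq_or_ne q i with rfl | hne
      · simp
      · rw [Function.update_of_ne, h6 q (by omega)]
        exact fun h => hne (hπi _ _ (by omega) hi h)
    · intro y hy
      rw [Function.update_of_ne (hy i (by omega)).symm]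
      exact h7 y fun q hq => hy q (by omega)
  rintro s₂ t₂ ⟨ht₂, ⟨-, h6, h7⟩, -⟩ hA₂
  rw [runs_block_nil]
  refine ⟨?_, ?_, ?_, ?_, ?_⟩
  · simp only [RExp.cost] at ht₁ ht₂ ⊢
    have : m * 1 ≤ m * ell n := Nat.mul_le_mul_left _ hl
    nlinarith
  · rw [hA₂.reg _ (by decide)]; simpa using h2
  · rw [hA₂.arr _ (by decide)]; simpa using h3
  · rw [hA₂.arr _ (by decide)]; simpa using h4
  · intro i hi
    by_cases h : ∃ q, q < m' ∧ π q = x i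
    · obtain ⟨q, hq, hqi⟩ := h
      rw [← hqi, h6 q hq, rankIn_of_mem hq fun q q' h1 h2 => hπi q q' h1 h2]
    · rw [h7 _ fun q hq hqi => h ⟨q, hq, hqi⟩, h5 i hi, rankIn_of_notMem]
      exact fun q hq hqi => h ⟨q, hq, hqi⟩

theorem runs_scoreLevel {s : State} {m w : ℕ} {ρ : ℕ → ℕ} (hm : s.reg rSize = m)
    (hw : s.reg rWin = w) (hρ : s.arr aApx = ρ)
    (hρn : ∀ i, i < m → ρ i < n) (hρi : ∀ i i', i < m → i' < m → ρ i = ρ i' → i = i')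
    (hmn : m ≤ n) (hW : 2 * n + w + 5 < W) :
    Runs n obs coin W scoreLevel s fun s' t => t ≤ m * (40 * w + 100) + 20 ∧
      (∀ i, i < m → s'.arr aOrd i = ρ i) ∧
      ∀ i, i < m → s'.arr aKey (ρ i) = scoreAt (obsNat obs) w m ρ i := by
  simp only [scoreLevel, runs_block_cons, runs_assign]
  refine ⟨by simp [RExp.eval]; omega, ?_⟩
  refine (runs_while_const m (fun i s' => s'.reg rIdx = i ∧
    (∀ i', i' < i → s'.arr aOrd i' = ρ i') ∧
    ∀ i', i' < i → s'.arr aKey (ρ i') = scoreAt (obsNat obs) w m ρ i')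
    (40 * w + 90) ?_ ?_ ?_).then ?_
  · exact ⟨by simp [RExp.eval], by simp, by simp⟩
  · rintro i s' hi ⟨h1, -⟩ hA
    have : s'.reg rSize = m := by rw [hA.reg rSize (by decide)]; simpa using hm
    simp only [RExp.eval, h1, this]
  · rintro i s' hi ⟨h1, h2, h3⟩ hA
    have g1 : s'.reg rSize = m := by rw [hA.reg rSize (by decide)]; simpa using hm
    have g2 : s'.reg rWin = w := by rw [hA.reg rWin (by decide)]; simpa using hw
    have g3 : s'.arr aApx = ρ := by rw [hA.arr aApx (by decide)]; simpa using hρ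
    have g4 := hρn i hi
    set e := min (i + w + 1) m with he
    -- The comparisons won within the part of the window before position `l`; the register of the
    -- score holds `i - w + f l` when the inner loop stands at `l`.
    set f := fun l => ((Finset.Ico (i - w) l).filter fun r => obsNat obs (ρ r) (ρ i)).card with hf
    have hfl : ∀ l, f l ≤ l := fun l => by
      have := Finset.card_filter_le (Finset.Ico (i - w) l) fun r => obsNat obs (ρ r) (ρ i)
      simp only [Nat.card_Ico] at this
      simp only [hf]; omega
    have hloop : ∀ s₁ : State, s₁.reg rX = ρ i → s₁.reg rPt = i - w → s₁.reg rScore = i - w →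
        s₁.reg rEnd = e → s₁.arr aApx = ρ → s₁.reg rIdx = i →
        s₁.arr aOrd = Function.update (s'.arr aOrd) i (ρ i) → s₁.arr aKey = s'.arr aKey →
        Runs n obs coin W (.block [.whileLt (.reg rPt) (.reg rEnd) (.block [
          .compare rCmp (.cell aApx (.reg rPt)) (.reg rX),
          .assign rScore (.plus (.reg rScore) (.reg rCmp)),
          .assign rPt (.plus (.reg rPt) (.lit 1))]),
        .store aKey (.reg rX) (.reg rScore),
        .assign rIdx (.plus (.reg rIdx) (.lit 1))]) s₁ fun s₂ t => t ≤ 40 * w + 50 ∧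
          s₂.reg rIdx = i + 1 ∧ s₂.arr aOrd = Function.update (s'.arr aOrd) i (ρ i) ∧
          s₂.arr aKey = Function.update (s'.arr aKey) (ρ i) (i - w + f e) := by
      intro s₁ a1 a2 a3 a4 a5 a6 a7 a8
      rw [runs_block_cons]
      refine (runs_while_const (e - (i - w)) (fun l s₂ => s₂.reg rPt = i - w + l ∧
        s₂.reg rScore = i - w + f (i - w + l)) 16 ?_ ?_ ?_).then ?_
      · exact ⟨by simpa using a2, by simpa [hf] using a3⟩
      · rintro l s₂ hl ⟨b1, b2⟩ hA₂
        have : s₂.reg rEnd = e := by rw [hA₂.reg _ (by decide), a4]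
        simp only [RExp.eval, b1, this]
        omega
      · rintro l s₂ hl ⟨b1, b2⟩ hA₂
        have c1 : s₂.reg rX = ρ i := by rw [hA₂.reg _ (by decide), a1]
        have c2 : s₂.arr aApx = ρ := by rw [hA₂.arr _ (by decide), a5]
        have c3 : ρ (i - w + l) < n := hρn _ (by omega)
        simp only [runs_block_cons, runs_block_nil, runs_compare, runs_assign, RExp.eval, Op.apply,
          RExp.cost, c1, c2, b1, b2, State.setReg_reg, if_true, rScore, rCmp, rPt,
          Nat.reduceEqDiff, if_false]
        simp only [rScore, rPt] at b1 b2
        refine ⟨c3, g4, ?_⟩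
        have d1 : f (i - w + (l + 1)) = f (i - w + l) +
            (obs ⟨ρ (i - w + l), c3⟩ ⟨ρ i, g4⟩).toNat := by
          have d0 : (obs ⟨ρ (i - w + l), c3⟩ ⟨ρ i, g4⟩) = obsNat obs (ρ (i - w + l)) (ρ i) := by
            simp [obsNat, c3, g4]
          rw [d0]
          simp only [hf]
          rw [← add_assoc, ← Finset.insert_Ico_right_eq_Ico_add_one (by omega), Finset.filter_insert]
          by_cases h : obsNat obs (ρ (i - w + l)) (ρ i)
          · rw [if_pos h, Finset.card_insert_of_notMem (by simp), h]; rfl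
          · rw [if_neg h]; simp [h]
        have d2 := hfl (i - w + (l + 1))
        refine ⟨by omega, by omega, by omega, by omega, by omega⟩
      rintro s₂ t₂ ⟨ht₂, ⟨b1, b2⟩, -⟩ hA₂
      have c1 : s₂.reg rX = ρ i := by rw [hA₂.reg _ (by decide), a1]
      have c2 : s₂.reg rIdx = i := by rw [hA₂.reg _ (by decide), a6]
      have c3 : s₂.arr aOrd = Function.update (s'.arr aOrd) i (ρ i) := by
        rw [hA₂.arr _ (by decide), a7]
      have c4 : s₂.arr aKey = s'.arr aKey := by rw [hA₂.arr _ (by decide), a8]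
      rw [show i - w + (e - (i - w)) = e by omega] at b2
      have := hfl e
      simp only [runs_block_cons, runs_block_nil, runs_assign, runs_store, RExp.eval, c1, c2, c3,
        c4, b2, Op.apply, RExp.cost, State.setCell_reg, State.setReg_reg, State.setCell_arr,
        State.setReg_arr, if_true, aKey, aOrd, Nat.reduceEqDiff, if_false]
      simp only [aOrd, aKey, rIdx] at c2 c3 c4
      refine ⟨by omega, by omega, by omega, ?_, trivial, trivial, trivial⟩
      simp only [RExp.cost] at ht₂
      have : (e - (i - w)) * (16 + (1 + 1 + 1)) ≤ (2 * w + 1) * 19 :=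
        Nat.mul_le_mul (by omega) (by norm_num)
      omega
    have hfin : ∀ s₂ : State, s₂.reg rIdx = i + 1 →
        s₂.arr aOrd = Function.update (s'.arr aOrd) i (ρ i) →
        s₂.arr aKey = Function.update (s'.arr aKey) (ρ i) (i - w + f e) →
        s₂.reg rIdx = i + 1 ∧ (∀ i', i' < i + 1 → s₂.arr aOrd i' = ρ i') ∧
        ∀ i', i' < i + 1 → s₂.arr aKey (ρ i') = scoreAt (obsNat obs) w m ρ i' := by
      intro s₂ b1 b2 b3
      refine ⟨b1, fun i' hi' => ?_, fun i' hi' => ?_⟩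
      · rw [b2]
        rcases eq_or_ne i' i with rfl | hne
        · simp
        · rw [Function.update_of_ne hne, h2 i' (by omega)]
      · rw [b3]
        rcases eq_or_ne i' i with rfl | hne
        · simp [scoreAt, hf, he]
        · rw [Function.update_of_ne, h3 i' (by omega)]
          exact fun h => hne (hρi _ _ (by omega) hi h)
    rw [runs_block_cons, runs_assign, runs_block_cons, runs_store, runs_block_cons, runs_assign,
      runs_block_cons, runs_assign, runs_block_cons, runs_assign, runs_block_cons, runs_ifLt]
    simp only [RExp.eval, h1, g1, g2, g3, Op.apply, RExp.cost, State.setCell_reg, State.setReg_reg,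
      State.setCell_arr, State.setReg_arr, if_true, rX, rIdx, rWin, rScore, rPt, rEnd, rSize,
      Nat.reduceEqDiff, if_false, runs_assign, runs_skip]
    simp only [rX, rIdx, rWin, rScore, rPt, rEnd, rSize] at h1 g1 g2
    refine ⟨by omega, by omega, by omega, by omega, by omega, by omega,
      fun hlt => ⟨by omega, ?_⟩, fun hlt => ?_⟩
    · refine (hloop _ ?_ ?_ ?_ ?_ ?_ ?_ ?_ ?_).mono ?_
      · simp
      · simp
      · simp
      · simp; omega
      · simpa using g3
      · simpa using h1
      · simp
      · simp
      · rintro s₂ t₂ ⟨ht₂, b1, b2, b3⟩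
        exact ⟨by omega, hfin s₂ b1 b2 b3⟩
    · refine (hloop _ ?_ ?_ ?_ ?_ ?_ ?_ ?_ ?_).mono ?_
      · simp
      · simp
      · simp
      · simp; omega
      · simpa using g3
      · simpa using h1
      · simp
      · simp
      · rintro s₂ t₂ ⟨ht₂, b1, b2, b3⟩
        exact ⟨by omega, hfin s₂ b1 b2 b3⟩
  rintro s₁ t₁ ⟨ht₁, ⟨-, h2, h3⟩, -⟩ hA₁
  rw [runs_block_nil]
  refine ⟨?_, h2, h3⟩
  simp only [RExp.cost] at ht₁ ⊢
  nlinarith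

end SortProgram

/-! ### The subroutine: parameters, samples, refinement -/

section SortProgram

open RExp Program in
/-- Compute the parameters. -/
def setup : Program := block [
  computeD 1,
  assign rEll (plus (reg rD) (lit 1)),
  assign rStride (op .mul (lit 64) (reg rEll)),
  assign rRounds (op .mul (lit 16) (reg rEll)),
  assign rWin (op .mul (lit 524288) (reg rEll)),
  assign rBase (lit 0),
  assign rScale0 (lit 8),
  assign rIdx (lit 0),
  whileLt (reg rIdx) (reg rEll) (block [
    assign rScale0 (op .mul (reg rScale0) (lit 2)),
    assign rIdx (plus (reg rIdx) (lit 1))])]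

open RExp Program in
/-- Select the elements of the levels. -/
def sampleLevels : Program := block [
  assign rIdx (lit 0),
  whileLt (reg rIdx) len (block [
    store aLev (reg rIdx) (reg rIdx),
    assign rIdx (plus (reg rIdx) (lit 1))]),
  store aSize (lit 0) len,
  assign rLev (lit 0),
  whileLt (reg rLev) (reg rD) (block [
    assign rSub (op .div (cell aSize (reg rLev)) (lit 2)),
    assign rIdx (lit 0),
    whileLt (reg rIdx) (reg rSub) (block [
      toss rCmp,
      store aLev (plus (op .mul (plus (reg rLev) (lit 1)) len) (reg rIdx))
        (cell aLev (plus (op .mul (reg rLev) len)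
          (plus (op .mul (lit 2) (reg rIdx)) (reg rCmp)))),
      assign rIdx (plus (reg rIdx) (lit 1))]),
    store aSize (plus (reg rLev) (lit 1)) (reg rSub),
    assign rLev (plus (reg rLev) (lit 1))])]

open RExp Program in
/-- Compute the orders of the levels from the top down. -/
def refineLevels : Program := block [
  store aApx (lit 0) (cell aLev (op .mul (reg rD) len)),
  assign rUp (lit 0),
  whileLt (reg rUp) (reg rD) (block [
    assign rLev (minus (reg rD) (plus (reg rUp) (lit 1))),
    assign rSize (cell aSize (reg rLev)),
    assign rSub (cell aSize (plus (reg rLev) (lit 1))),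
    assign rBlocks (op .div (reg rSub) (reg rStride)),
    refineLevel,
    assign rUp (plus (reg rUp) (lit 1))])]

/-- The approximate sorting subroutine. -/
def approxSort : Program := .block [setup, sampleLevels, refineLevels]

variable {n : ℕ} {obs : Fin n → Fin n → Bool} {coin : ℕ → Bool} {W : ℕ}

theorem scoreAt_congr {o o' : ℕ → ℕ → Bool} {w m : ℕ} {ρ ρ' : ℕ → ℕ}
    (h : ∀ p, p < m → ρ p = ρ' p)
    (ho : ∀ p q, p < m → q < m → o (ρ p) (ρ q) = o' (ρ p) (ρ q)) {q : ℕ} (hq : q < m) :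
    scoreAt o w m ρ q = scoreAt o' w m ρ' q := by
  rw [scoreAt, scoreAt]
  congr 2
  apply Finset.filter_congr
  intro r hr
  rw [Finset.mem_Ico] at hr
  rw [ho r q (by omega) hq, h q hq, h r (by omega)]

theorem runs_refineLevel {s : State} {base m m' j : ℕ} {π x : ℕ → ℕ}
    (hN : s.reg rBlocks = m' / (64 * ell n)) (hB : s.reg rStride = 64 * ell n)
    (hT : s.reg rRounds = 16 * ell n) (hh : s.reg rScale0 = 8 * 2 ^ ell n)
    (hw : s.reg rWin = window n)
    (hm' : s.reg rSub = m') (hm : s.reg rSize = m) (hj : s.reg rLev = j)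
    (hbase : s.reg rBase = base)
    (hπ : s.arr aApx = π) (hx : ∀ i, i < m → s.arr aLev (j * n + i) = x i)
    (hxn : ∀ i, i < m → x i < n) (hπn : ∀ p, p < m' → π p < n)
    (hxi : ∀ i i', i < m → i' < m → x i = x i' → i = i')
    (hπi : ∀ i i', i < m' → i' < m' → π i = π i' → i = i')
    (hvote : ∀ e, s.arr aVote e ≤ base + 16 * ell n) (hmn : m ≤ n) (hmn' : m' ≤ n) (hmm : m' ≤ m)
    (hnW : 2 * n + window n + 5 < W)
    (hW : 2 ^ (40 * ell n) ≤ W) (hbW : base + m * (16 * ell n) + 32 * ell n + 5 < W) :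
    Runs n obs coin W refineLevel s fun s' t => t ≤ 2 ^ 25 * (m * ell n) + 20 * m' + 500 ∧
      s'.reg rBase = base + m * (16 * ell n) ∧
      (∀ e, s'.arr aVote e ≤ base + m * (16 * ell n) + 16 * ell n) ∧
      ∀ p, p < m → s'.arr aApx p = refine (obsNat obs) n π m' x m p := by
  rw [refineLevel, runs_block_cons]
  refine (runs_searchLevel hN hB hT hh hm' hm hj hbase hπ hx hxn hπn hxi hπi hvote hmn hmn'
    (by omega) hW hbW).then ?_
  rintro s₁ t₁ ⟨ht₁, a1, a2, a3, a4⟩ hA₁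
  set k := fun i => rankIn (obsNat obs) n π m' (x i) with hk
  rw [runs_block_cons]
  refine (runs_countingSort (m := m) (x := x) (k := k) (by rw [hA₁.reg _ (by decide), hm]) a3 rfl a4
    (fun i hi => (rankIn_le _ _ _ _ _).trans hmm) hxn hmn (by omega)).then ?_
  rintro s₂ t₂ ⟨ht₂, b1⟩ hA₂
  have hinj : ∀ i i', i < m → i' < m → s₂.arr aApx i = s₂.arr aApx i' → i = i' := by
    intro i i' hi hi' h
    rw [b1 i hi, b1 i' hi'] at h
    exact sorted_inj hxi hi hi' h
  have hlt : ∀ i, i < m → s₂.arr aApx i < n := by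
    intro i hi
    rw [b1 i hi]
    obtain ⟨i', hi', h, -⟩ := exists_sorted_eq x k hi
    rw [h]
    exact hxn i' hi'
  rw [runs_block_cons]
  refine (runs_scoreLevel (m := m) (w := window n) (ρ := s₂.arr aApx)
    (by rw [hA₂.reg _ (by decide), hA₁.reg _ (by decide), hm])
    (by rw [hA₂.reg _ (by decide), hA₁.reg _ (by decide), hw]) rfl hlt hinj hmn (by omega)).then ?_
  rintro s₃ t₃ ⟨ht₃, c1, c2⟩ hA₃
  rw [runs_block_cons]
  refine (runs_countingSort (m := m) (x := s₂.arr aApx)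
    (k := scoreAt (obsNat obs) (window n) m (s₂.arr aApx))
    (by rw [hA₃.reg _ (by decide), hA₂.reg _ (by decide), hA₁.reg _ (by decide), hm]) c1 rfl c2
    (fun i hi => scoreAt_le _ _ _ _ hi) hlt hmn (by omega)).then ?_
  rintro s₄ t₄ ⟨ht₄, d1⟩ hA₄
  rw [runs_block_nil]
  refine ⟨?_, ?_, ?_, ?_⟩
  -- The windows dominate the running time: `40 * 2 ^ 19 * ell n` steps for each element, below `2 ^
  -- 25 * ell n`.
  · rw [window] at ht₃
    have : m * 1 ≤ m * ell n := Nat.mul_le_mul_left _ (ell_pos n)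
    rw [mul_add, show m * (40 * (2 ^ 19 * ell n)) = 40 * 2 ^ 19 * (m * ell n) by ring] at ht₃
    norm_num at ht₃ ⊢
    omega
  · rw [hA₄.reg _ (by decide), hA₃.reg _ (by decide), hA₂.reg _ (by decide), a1]
  · rw [hA₄.arr _ (by decide), hA₃.arr _ (by decide), hA₂.arr _ (by decide)]
    exact a2
  · intro p hp
    rw [d1 p hp, refine]
    exact sorted_congr b1 (fun i hi => scoreAt_congr b1 (fun _ _ _ _ => rfl) hi) hp

theorem runs_setup {s : State} (hn : 2 ≤ n) (hX : 2 ^ 30 * (2 ^ ell n) ^ 3 ≤ W) :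
    Runs n obs coin W setup s fun s' t => t ≤ 100 * ell n ∧
      s'.reg rD = Nat.log 2 n ∧ s'.reg rStride = 64 * ell n ∧ s'.reg rRounds = 16 * ell n ∧
      s'.reg rWin = window n ∧ s'.reg rBase = 0 ∧ s'.reg rScale0 = 8 * 2 ^ ell n := by
  have hl : 2 ≤ ell n := by have := Nat.log_pos (b := 2) (by norm_num) hn; rw [ell]; omega
  have h1 : ell n ≤ 2 ^ ell n := Nat.lt_two_pow_self.le
  have h2 : 2 ^ ell n ≤ (2 ^ ell n) ^ 3 := Nat.le_self_pow (by norm_num) _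
  have h3 := lt_two_pow_ell n
  rw [setup, runs_block_cons]
  refine (runs_computeD 1 hn (by omega)
    (by have : Nat.log 2 n < ell n := Nat.lt_succ_self _
        omega)).then ?_
  rintro s₁ t₁ ⟨ht₁, hd⟩ -
  have hell : Nat.log 2 n + 1 = ell n := rfl
  rw [one_mul] at hd
  simp only [runs_block_cons, runs_assign, RExp.eval, Op.apply, hd, State.setReg_reg, RExp.cost,
    if_true, hell, rEll, rStride, rRounds, rWin, rBase, rScale0, rIdx, Nat.reduceEqDiff, if_false]
  refine ⟨by omega, by omega, by omega, by omega, by omega, by omega, by omega, ?_⟩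
  refine (runs_while_const (ell n) (fun i s' => s'.reg 36 = i ∧ s'.reg 33 = 8 * 2 ^ i) 10
    ?_ ?_ ?_).then ?_
  · simp
  · rintro i s' hi ⟨h1, -⟩ hA
    have : s'.reg 34 = ell n := by rw [hA.reg _ (by decide)]; simp
    simp only [RExp.eval, h1, this]
  · rintro i s' hi ⟨h1, h2⟩ hA
    have : 2 ^ (i + 1) ≤ 2 ^ ell n := Nat.pow_le_pow_right (by norm_num) hi
    rw [pow_succ] at this
    simp only [runs_block_cons, runs_block_nil, runs_assign, RExp.eval, Op.apply, h1, h2,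
      State.setReg_reg, RExp.cost, if_true, Nat.reduceEqDiff, if_false]
    refine ⟨by omega, by omega, by omega, trivial, ?_⟩
    rw [pow_succ]; ring
  · rintro s₂ t₂ ⟨ht₂, ⟨-, h5⟩, -⟩ hA
    rw [runs_block_nil]
    simp only [RExp.cost] at ht₂
    refine ⟨by omega, ?_, ?_, ?_, ?_, ?_, h5⟩ <;> rw [hA.reg _ (by decide)] <;> simp [hd, window]

theorem coinOff_succ (n j : ℕ) : coinOff n (j + 1) = coinOff n j + n / 2 ^ (j + 1) := by
  rw [coinOff, coinOff, Finset.sum_range_succ]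

theorem runs_sampleLevels {s : State} (hn : 2 ≤ n) (hX : 2 ^ 30 * (2 ^ ell n) ^ 3 ≤ W)
    (hd : s.reg rD = Nat.log 2 n) (htoss : s.tossed = 0) :
    Runs n obs coin W sampleLevels s fun s' t => t ≤ 200 * (n * ell n) ∧
      (∀ j, j ≤ Nat.log 2 n → s'.arr aSize j = n / 2 ^ j) ∧
      ∀ j i, j ≤ Nat.log 2 n → i < n / 2 ^ j → s'.arr aLev (j * n + i) = lev coin n j i := by
  have h1 : ell n ≤ 2 ^ ell n := Nat.lt_two_pow_self.le
  have h2 : 2 ^ ell n ≤ (2 ^ ell n) ^ 3 := Nat.le_self_pow (by norm_num) _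
  have h3 := lt_two_pow_ell n
  have h4 : ell n * n ≤ (2 ^ ell n) ^ 3 := by
    calc ell n * n ≤ 2 ^ ell n * 2 ^ ell n := Nat.mul_le_mul h1 h3.le
      _ = (2 ^ ell n) ^ 2 := by ring
      _ ≤ _ := Nat.pow_le_pow_right (by positivity) (by norm_num)
  simp only [sampleLevels, runs_block_cons, runs_assign]
  refine ⟨by simp [RExp.eval]; omega, ?_⟩
  refine (runs_while_const n (fun i s' => s'.reg rIdx = i ∧ ∀ i', i' < i → s'.arr aLev i' = i')
    15 ?_ ?_ ?_).then ?_
  · simp [RExp.eval]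
  · rintro i s' hi ⟨h1, -⟩ hA
    simp only [RExp.eval, h1]
  · rintro i s' hi ⟨h1, h2⟩ hA
    simp only [runs_block_cons, runs_block_nil, runs_assign, runs_store, RExp.eval, Op.apply, h1,
      State.setReg_reg, State.setCell_reg, State.setReg_arr, State.setCell_arr, RExp.cost, if_true]
    refine ⟨by omega, by omega, by omega, by omega, trivial, ?_⟩
    intro i' hi'
    rcases eq_or_ne i' i with rfl | hne
    · simp
    · rw [Function.update_of_ne hne, h2 i' (by omega)]
  rintro s₁ t₁ ⟨ht₁, ⟨-, hlev⟩, -⟩ hA₁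
  have hd₁ : s₁.reg rD = Nat.log 2 n := by rw [hA₁.reg _ (by decide)]; simpa using hd
  have ht0 : s₁.tossed = 0 := by rw [hA₁.tossed (by decide)]; simpa using htoss
  rw [runs_store]
  refine ⟨by simp [RExp.eval]; omega, by simp [RExp.eval]; omega, by simp [RExp.eval]; omega, ?_⟩
  refine (runs_while_const (Nat.log 2 n) (fun j s' => s'.reg rLev = j ∧ s'.tossed = coinOff n j ∧
    (∀ j', j' ≤ j → s'.arr aSize j' = n / 2 ^ j') ∧
    ∀ j' i, j' ≤ j → i < n / 2 ^ j' → s'.arr aLev (j' * n + i) = lev coin n j' i)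
    (40 * n + 60) ?_ ?_ ?_).then ?_
  · refine ⟨by simp [RExp.eval], by simp [coinOff, ht0], ?_, ?_⟩
    · rintro j' hj'
      obtain rfl : j' = 0 := by omega
      simp [RExp.eval]
    · rintro j' i hj' hi
      obtain rfl : j' = 0 := by omega
      simp at hi
      simpa [lev] using hlev i hi
  · rintro j s' hj ⟨h1, -⟩ hA
    have : s'.reg rD = Nat.log 2 n := by rw [hA.reg _ (by decide)]; simpa using hd₁
    simp only [RExp.eval, h1, this]
  · rintro j s' hj ⟨a1, a2, a3, a4⟩ hA
    have e1 := a3 j le_rfl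
    have e2 : n / 2 ^ j / 2 = n / 2 ^ (j + 1) := by rw [pow_succ, Nat.div_div_eq_div_mul]
    have e3 : n / 2 ^ (j + 1) ≤ n := Nat.div_le_self _ _
    have e4 : (j + 1) * n + n ≤ ell n * n := by
      rw [← Nat.succ_mul]; exact Nat.mul_le_mul_right _ (by rw [ell]; omega)
    simp only [runs_block_cons, runs_assign, RExp.eval, Op.apply, a1, e1, e2]
    refine ⟨by omega, by omega, ?_⟩
    refine (runs_while_const (n / 2 ^ (j + 1)) (fun i s'' => s''.reg rIdx = i ∧
      s''.tossed = coinOff n j + i ∧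
      (∀ i', i' < i → s''.arr aLev ((j + 1) * n + i') = lev coin n (j + 1) i') ∧
      ∀ j' i', j' ≤ j → i' < n / 2 ^ j' → s''.arr aLev (j' * n + i') = lev coin n j' i')
      30 ?_ ?_ ?_).then ?_
    · exact ⟨by simp, by simpa using a2, by simp, by simpa using a4⟩
    · rintro i s'' hi ⟨b1, -⟩ hB
      have : s''.reg rSub = n / 2 ^ (j + 1) := by rw [hB.reg _ (by decide)]; simp
      simp only [RExp.eval, b1, this]
    · rintro i s'' hi ⟨b1, b2, b3, b4⟩ hB
      have c1 : s''.reg rLev = j := by rw [hB.reg _ (by decide)]; simpa using a1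
      set c := coin (coinOff n j + i) with hc
      have c2 := Bool.toNat_le c
      have c3 : 2 * i + c.toNat < n / 2 ^ j := by omega
      have c4 : s''.arr aLev (j * n + (2 * i + c.toNat)) = lev coin n (j + 1) i := by
        rw [b4 j _ le_rfl c3, lev]
      have c5 : lev coin n (j + 1) i < n := lev_lt hi
      simp only [runs_block_cons, runs_block_nil, runs_assign, runs_store, runs_toss, RExp.eval,
        Op.apply, b1, b2, ← hc, c1, State.setReg_reg, State.setCell_reg, State.setReg_arr,
        State.setCell_arr, RExp.cost, if_true, rIdx, rCmp, rLev, Nat.reduceEqDiff, if_false,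
        State.setCell_tossed, State.setReg_tossed]
      simp only [rIdx, rLev] at b1 c1
      simp only [b1, c1, c4]
      refine ⟨by omega, by omega, by omega, by omega, trivial, by omega, ?_, ?_⟩
      · intro i' hi'
        rcases eq_or_ne i' i with rfl | hne
        · simp
        · rw [Function.update_of_ne (by omega), b3 i' (by omega)]
      · intro j' i' hj' hi'
        -- Row `j' ≤ j` of the table of levels ends at `(j' + 1) * n`, not after the start of the
        -- row being written.
        rw [Function.update_of_ne, b4 j' i' hj' hi']
        have : n / 2 ^ j' ≤ n := Nat.div_le_self _ _
        have : (j' + 1) * n ≤ (j + 1) * n := Nat.mul_le_mul_right _ (by omega)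
        rw [add_mul] at this
        omega
    · rintro s₂ t₂ ⟨ht₂, ⟨-, b2, b3, b4⟩, -⟩ hB
      have c1 : s₂.reg rLev = j := by rw [hB.reg _ (by decide)]; simpa using a1
      have c2 : s₂.reg rSub = n / 2 ^ (j + 1) := by rw [hB.reg _ (by decide)]; simp
      have c3 : s₂.arr aSize = s'.arr aSize := by rw [hB.arr _ (by decide)]; simp
      simp only [RExp.cost] at ht₂
      simp only [runs_block_nil, runs_assign, runs_store, RExp.eval,
        Op.apply, c1, c2, c3, State.setReg_reg, State.setCell_reg, State.setReg_arr,
        State.setCell_arr, RExp.cost, if_true, aSize, aLev, Nat.reduceEqDiff, if_false,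
        State.setCell_tossed, State.setReg_tossed]
      simp only [aLev, aSize] at b3 b4 a3 c3
      have hjW : j + 1 < W := by
        have : Nat.log 2 n < ell n := Nat.lt_succ_self _
        omega
      refine ⟨by omega, by omega, by omega, by omega, trivial, by rw [b2, coinOff_succ], ?_, ?_⟩
      · intro j' hj'
        rcases eq_or_ne j' (j + 1) with rfl | hne
        · simp
        · rw [Function.update_of_ne hne]
          exact a3 j' (by omega)
      · intro j' i' hj' hi'
        rcases eq_or_ne j' (j + 1) with rfl | hne
        · exact b3 i' hi'
        · exact b4 j' i' (by omega) hi'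
  rintro s₂ t₂ ⟨ht₂, ⟨-, -, a3, a4⟩, -⟩ -
  rw [runs_block_nil]
  refine ⟨?_, a3, a4⟩
  simp only [RExp.cost] at ht₁ ht₂ ⊢
  have : n * 1 ≤ n * ell n := Nat.mul_le_mul_left _ (ell_pos n)
  have h5 : n * ell n = n * Nat.log 2 n + n := by rw [ell]; ring
  have h6 : Nat.log 2 n ≤ n := Nat.log_le_self 2 n
  nlinarith

/-- The sizes of the levels form a geometric series up to rounding; the additional term carries the
induction. This keeps the total time at `O(n * ell n)` rather than one such term for each level. -/
theorem sum_div_two_pow_le (n J : ℕ) :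
    ∑ j ∈ Finset.range J, n / 2 ^ j + 2 * (n / 2 ^ J) ≤ 2 * n := by
  induction J with
  | zero => simp
  | succ J ih =>
    rw [Finset.sum_range_succ, pow_succ, ← Nat.div_div_eq_div_mul]
    omega

end SortProgram

/-! ### The orders of all levels -/

section SortProgram

variable {n : ℕ} {obs : Fin n → Fin n → Bool} {coin : ℕ → Bool} {W : ℕ}

theorem rankIn_congr {o o' : ℕ → ℕ → Bool} {π π' : ℕ → ℕ} {m x : ℕ}
    (h : ∀ p, p < m → π p = π' p) (hπ : ∀ q q', q < m → q' < m → π q = π q' → q = q')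
    (ho : ∀ p, p < m → o (π p) x = o' (π p) x) :
    rankIn o n π m x = rankIn o' n π' m x := by
  by_cases hx : ∃ q, q < m ∧ π q = x
  · obtain ⟨q, hq, rfl⟩ := hx
    rw [rankIn_of_mem hq hπ, h q hq, rankIn_of_mem hq]
    intro q q' hq hq' h'
    exact hπ q q' hq hq' (by rw [h q hq, h q' hq', h'])
  · have hx' : ∀ q, q < m → π q ≠ x := fun q hq h => hx ⟨q, hq, h⟩
    rw [rankIn_of_notMem hx', rankIn_of_notMem fun q hq => by rw [← h q hq]; exact hx' q hq]
    exact noisyRank_congr fun p hp => by rw [ho p hp, h p hp]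

theorem refine_congr {o o' : ℕ → ℕ → Bool} {π π' x x' : ℕ → ℕ} {m m' : ℕ}
    (h : ∀ p, p < m' → π p = π' p) (hπ : ∀ q q', q < m' → q' < m' → π q = π q' → q = q')
    (hx : ∀ i, i < m → x i = x' i)
    (hoπ : ∀ p i, p < m' → i < m → o (π p) (x i) = o' (π p) (x i))
    (hox : ∀ i i', i < m → i' < m → o (x i) (x i') = o' (x i) (x i')) {p : ℕ} (hp : p < m) :
    refine o n π m' x m p = refine o' n π' m' x' m p := by
  have h1 : ∀ i, i < m → sorted m x (fun i => rankIn o n π m' (x i)) i =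
      sorted m x' (fun i => rankIn o' n π' m' (x' i)) i := fun i hi =>
    sorted_congr hx (fun i hi => by
      rw [← hx i hi]; exact rankIn_congr h hπ fun p hp => hoπ p i hp hi) hi
  rw [refine, refine]
  refine sorted_congr h1 (fun i hi => scoreAt_congr h1 (fun q q' hq hq' => ?_) hi) hp
  obtain ⟨i, hi, e, -⟩ := exists_sorted_eq x (fun i => rankIn o n π m' (x i)) hq
  obtain ⟨i', hi', e', -⟩ := exists_sorted_eq x (fun i => rankIn o n π m' (x i)) hq'
  rw [e, e', hox i i' hi hi']

theorem runs_refineLevels {s : State} (hn : 2 ≤ n) (hX : 2 ^ 30 * (2 ^ ell n) ^ 3 ≤ W)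
    (hW : 2 ^ (40 * ell n) ≤ W) (hd : s.reg rD = Nat.log 2 n) (hB : s.reg rStride = 64 * ell n)
    (hT : s.reg rRounds = 16 * ell n) (hw : s.reg rWin = window n) (hbase : s.reg rBase = 0)
    (hh : s.reg rScale0 = 8 * 2 ^ ell n)
    (hvote : ∀ e, s.arr aVote e = 0)
    (hsize : ∀ j, j ≤ Nat.log 2 n → s.arr aSize j = n / 2 ^ j)
    (hlev : ∀ j i, j ≤ Nat.log 2 n → i < n / 2 ^ j → s.arr aLev (j * n + i) = lev coin n j i) :
    Runs n obs coin W refineLevels s fun s' t => t ≤ 2 ^ 28 * (n * ell n) ∧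
      ∀ p, p < n → s'.arr aApx p = order (obsNat obs) coin n (Nat.log 2 n) p := by
  set J := Nat.log 2 n with hJ
  have hell : ell n = J + 1 := rfl
  have h1 : ell n ≤ 2 ^ ell n := Nat.lt_two_pow_self.le
  have h3 := lt_two_pow_ell n
  have hl := ell_pos n
  have hX1 : 2 ^ ell n ≤ (2 ^ ell n) ^ 3 := Nat.le_self_pow (by norm_num) _
  have h4 : J * (n * (16 * ell n)) ≤ 16 * (2 ^ ell n) ^ 3 := by
    calc J * (n * (16 * ell n)) ≤ 2 ^ ell n * (2 ^ ell n * (16 * 2 ^ ell n)) := by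
          gcongr; omega
      _ = 16 * (2 ^ ell n) ^ 3 := by ring
  have hJn : 2 ^ J ≤ n := Nat.pow_log_le_self 2 (by omega)
  have hpos : ∀ j, j ≤ J → 0 < n / 2 ^ j := fun j hj =>
    Nat.div_pos ((Nat.pow_le_pow_right (by norm_num) hj).trans hJn) (by positivity)
  have hone : n / 2 ^ J = 1 := by
    have : n / 2 ^ J < 2 := by
      rw [Nat.div_lt_iff_lt_mul (by positivity)]
      rwa [hell, pow_succ, mul_comm] at h3
    have := hpos J le_rfl
    omega
  have hle : ∀ j, n / 2 ^ j ≤ n := fun j => Nat.div_le_self _ _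
  simp only [refineLevels, runs_block_cons, runs_store, runs_assign]
  have e0 : s.arr aLev (J * n) = lev coin n J 0 := hlev J 0 le_rfl (hpos J le_rfl)
  have e1 : lev coin n J 0 < n := lev_lt (hpos J le_rfl)
  refine ⟨by simp [RExp.eval]; omega, by simp [RExp.eval, Op.apply, hd, e0]; omega,
    by simp [RExp.eval]; omega, ?_⟩
  -- Each search raises `base` by `16 * ell n`, and a level has at most `n` searches; the bound on
  -- `base` ensures that it remains a word.
  refine (runs_while J (fun k s' => s'.reg rUp = k ∧
    (∀ p, p < n / 2 ^ (J - k) → s'.arr aApx p = order (obsNat obs) coin n k p) ∧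
    ∃ base, s'.reg rBase = base ∧ base ≤ k * (n * (16 * ell n)) ∧
      ∀ e, s'.arr aVote e ≤ base + 16 * ell n)
    (fun k => 2 ^ 26 * (n / 2 ^ (J - 1 - k) * ell n)) ?_ ?_ ?_).then ?_
  · refine ⟨by simp [RExp.eval], ?_, 0, by simpa using hbase, by simp, by simp [hvote]⟩
    intro p hp
    rw [Nat.sub_zero, hone] at hp
    obtain rfl : p = 0 := by omega
    simp [RExp.eval, Op.apply, hd, e0, order, ← hJ]
  · rintro k s' hk ⟨a1, -⟩ hA
    have : s'.reg rD = J := by rw [hA.reg _ (by decide)]; simpa using hd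
    simp only [RExp.eval, a1, this]
  · rintro k s' hk ⟨a1, a2, base, a3, a4, a5⟩ hA
    have b1 : s'.reg rD = J := by rw [hA.reg _ (by decide)]; simpa using hd
    have b2 : s'.reg rStride = 64 * ell n := by rw [hA.reg _ (by decide)]; simpa using hB
    have b3 : s'.reg rRounds = 16 * ell n := by rw [hA.reg _ (by decide)]; simpa using hT
    have b4 : s'.reg rWin = window n := by rw [hA.reg _ (by decide)]; simpa using hw
    have b5 : s'.reg rScale0 = 8 * 2 ^ ell n := by rw [hA.reg _ (by decide)]; simpa using hh
    have b6 : s'.arr aSize = s.arr aSize := by rw [hA.arr _ (by decide)]; simp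
    have b7 : s'.arr aLev = s.arr aLev := by rw [hA.arr _ (by decide)]; simp
    have b8 : J - (k + 1) + 1 = J - k := by omega
    set m := n / 2 ^ (J - (k + 1)) with hm
    set m' := n / 2 ^ (J - k) with hm'
    have c1 : s.arr aSize (J - (k + 1)) = m := hsize _ (by omega)
    have c2 : s.arr aSize (J - k) = m' := hsize _ (by omega)
    have hmm : m' ≤ m := Nat.div_le_div_left (Nat.pow_le_pow_right (by norm_num) (by omega))
      (by positivity)
    have hmn : m ≤ n := hle _
    have hmp : 0 < m := hpos _ (by omega)
    have hbN : m' / (64 * ell n) ≤ m' := Nat.div_le_self _ _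
    have hbase' : base + m * (16 * ell n) ≤ (k + 1) * (n * (16 * ell n)) := by
      rw [add_mul k 1, one_mul]
      exact Nat.add_le_add a4 (Nat.mul_le_mul_right _ hmn)
    have hbase'' : (k + 1) * (n * (16 * ell n)) ≤ J * (n * (16 * ell n)) :=
      Nat.mul_le_mul_right _ hk
    have hJn' : J ≤ n := Nat.log_le_self 2 n
    simp only [runs_block_cons, runs_assign, RExp.eval, Op.apply, a1, b1, b2, b6, c1, c2,
      State.setReg_reg, State.setReg_arr, rLev, rSub, rD, rSize, rStride, rBlocks, Nat.reduceEqDiff,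
      if_true, if_false, b8]
    refine ⟨by omega, by omega, by omega, by omega, ?_⟩
    have hinj : ∀ q q', q < m' → q' < m' → s'.arr aApx q = s'.arr aApx q' → q = q' := by
      intro q q' hq hq' h
      rw [a2 q hq, a2 q' hq'] at h
      exact order_inj hq hq' h
    refine (runs_refineLevel (base := base) (m := m) (m' := m') (j := J - (k + 1))
      (π := s'.arr aApx) (x := lev coin n (J - (k + 1))) ?_
      ?_ ?_ ?_ ?_ ?_ ?_ ?_ ?_ ?_ ?_ (fun i hi => lev_lt hi)
      ?_ (fun i i' _ _ h => lev_inj h) hinj ?_ hmn (hle _) hmm ?_ hW ?_).then ?_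
    · simp
    · simpa using b2
    · simpa using b3
    · simpa using b5
    · simpa using b4
    · simp
    · simp
    · simp
    · simpa using a3
    · rfl
    · intro i hi
      simp only [State.setReg_arr, b7]
      exact hlev _ _ (by omega) hi
    · intro p hp
      rw [a2 p hp]
      exact order_lt hp
    · exact a5
    · rw [window]; omega
    · omega
    rintro s₂ t₂ ⟨ht₂, d1, d2, d3⟩ hA₂
    have d4 : s₂.reg 41 = k := by rw [hA₂.reg _ (by decide)]; simpa using a1
    simp only [runs_block_nil, runs_assign, RExp.eval, Op.apply, rUp, d4,
      State.setReg_reg, State.setReg_arr, RExp.cost, if_true]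
    refine ⟨by omega, ?_, trivial, ?_, _, ?_, hbase', d2⟩
    · have h5 : m * 1 ≤ m * ell n := Nat.mul_le_mul_left _ hl
      have h6 : J - 1 - k = J - (k + 1) := by omega
      rw [h6, ← hm]
      norm_num at ht₂ ⊢
      omega
    · intro p hp
      rw [d3 p hp]
      exact refine_congr a2 hinj (fun i _ => rfl) (fun _ _ _ _ => rfl) (fun _ _ _ _ => rfl) hp
    · simpa using d1
  rintro s₂ t₂ ⟨ht₂, ⟨-, h5, -⟩, -⟩ -
  rw [runs_block_nil]
  rw [Nat.sub_self, pow_zero, Nat.div_one] at h5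
  refine ⟨?_, h5⟩
  simp only [RExp.cost] at ht₂ ⊢
  rw [Finset.sum_add_distrib, ← Finset.mul_sum, ← Finset.sum_mul,
    Finset.sum_range_reflect (fun j => n / 2 ^ j)] at ht₂
  have h6 : (∑ j ∈ Finset.range J, n / 2 ^ j) * ell n ≤ 2 * n * ell n :=
    Nat.mul_le_mul_right _ (by have := sum_div_two_pow_le n J; omega)
  have h7 : n * 1 ≤ n * ell n := Nat.mul_le_mul_left _ hl
  have hJn' : J ≤ n := Nat.log_le_self 2 n
  rw [Finset.sum_const, Finset.card_range, smul_eq_mul] at ht₂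
  rw [mul_assoc] at h6
  norm_num at ht₂ ⊢
  omega

theorem runs_approxSort (hn : 2 ≤ n) (hX : 2 ^ 30 * (2 ^ ell n) ^ 3 ≤ W)
    (hW : 2 ^ (40 * ell n) ≤ W) :
    Runs n obs coin W approxSort State.init fun s t => t ≤ 2 ^ 29 * (n * ell n) ∧
      ∀ p, p < n → s.arr aApx p = order (obsNat obs) coin n (Nat.log 2 n) p := by
  rw [approxSort, runs_block_cons]
  refine (runs_setup hn hX).then ?_
  rintro s₁ t₁ ⟨ht₁, h1, h2, h3, h4, h5, h6⟩ hA₁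
  rw [runs_block_cons]
  refine (runs_sampleLevels hn hX h1 (by rw [hA₁.tossed (by decide)]; rfl)).then ?_
  rintro s₂ t₂ ⟨ht₂, h7, h8⟩ hA₂
  rw [runs_block_cons]
  refine (runs_refineLevels hn hX hW ?_ ?_ ?_ ?_ ?_ ?_ ?_ h7 h8).then ?_
  · rw [hA₂.reg _ (by decide), h1]
  · rw [hA₂.reg _ (by decide), h2]
  · rw [hA₂.reg _ (by decide), h3]
  · rw [hA₂.reg _ (by decide), h4]
  · rw [hA₂.reg _ (by decide), h5]
  · rw [hA₂.reg _ (by decide), h6]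
  · intro e
    rw [hA₂.arr _ (by decide), hA₁.arr _ (by decide)]
    rfl
  rintro s₃ t₃ ⟨ht₃, h9⟩ -
  rw [runs_block_nil]
  refine ⟨?_, h9⟩
  have : 1 * ell n ≤ n * ell n := Nat.mul_le_mul_right _ (by omega)
  have := ell_pos n
  omega

end SortProgram

/-! ## The noisy search succeeds if few comparisons are wrong -/

section SearchAnalysis

/-- One of the answers of the round of the noisy search that starts in state `w` is wrong. -/
def Walk.Errs (ans tru : ℕ → ℕ → Bool) (N : ℕ) (w : Walk) : Prop :=
  ∃ κ, κ < 4 ∧ 3 * w.h ≤ w.q + 2 * w.h * κ ∧ w.q + 2 * w.h * κ - 3 * w.h < N ∧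
    ans κ (w.q + 2 * w.h * κ - 3 * w.h) ≠ tru κ (w.q + 2 * w.h * κ - 3 * w.h)

/-- The state of the search is at most `Φ` rounds without errors away from the block `F`. -/
def Walk.Near (w : Walk) (F Φ : ℕ) : Prop :=
  ∃ s K, w.h = 8 * 2 ^ s ∧ s ≤ K ∧ w.q ≤ F + 20 * 2 ^ K ∧ F ≤ w.q + 20 * 2 ^ K ∧ 2 * K ≤ Φ + s

/-- Only blocks within distance one of `F` may truthfully be answered either way. Blocks left of `0`
or right of `N - 1` are answered by convention, and correctly so since `F ≤ N`. So each answer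
bounds `F` on one side of the probe at `q + (2 * κ - 3) * h`, up to one block. -/
theorem Walk.answer_of_not_errs {ans tru : ℕ → ℕ → Bool} {N F : ℕ} {w : Walk}
    (h1 : ∀ κ b, κ < 4 → b < N → b + 2 ≤ F → tru κ b = true)
    (h2 : ∀ κ b, κ < 4 → b < N → F + 2 ≤ b → tru κ b = false) (hF : F ≤ N)
    (he : ¬ w.Errs ans tru N) {κ : ℕ} (hκ : κ < 4) :
    (w.answer ans N κ = true → w.q + 2 * w.h * κ ≤ F + 1 + 3 * w.h) ∧
      (w.answer ans N κ = false → F ≤ w.q + 2 * w.h * κ + 1 - 3 * w.h ∧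
        3 * w.h ≤ w.q + 2 * w.h * κ) := by
  rw [Walk.answer]
  by_cases c1 : w.q + 2 * w.h * κ < 3 * w.h
  · simp [c1]
    omega
  by_cases c2 : w.q + 2 * w.h * κ - 3 * w.h < N
  · have h3 : ans κ (w.q + 2 * w.h * κ - 3 * w.h) = tru κ (w.q + 2 * w.h * κ - 3 * w.h) := by
      by_contra h
      exact he ⟨κ, hκ, by omega, c2, h⟩
    simp only [c1, c2, decide_false, decide_true, Bool.false_or, Bool.true_and, h3]
    constructor
    · intro h
      by_contra hc
      rw [h2 _ _ hκ c2 (by omega)] at h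
      exact absurd h (by simp)
    · intro h
      refine ⟨?_, by omega⟩
      by_contra hc
      rw [h1 _ _ hκ c2 (by omega)] at h
      exact absurd h (by simp)
  · simp [c1, c2]
    omega

/-- The potential behind `Near` is `2 * K - s`: the scale `8 * 2 ^ s` must grow in `K - s` rounds
until the probes enclose `F`, and then shrink to `8` in `K` rounds. A correct round performs one of
these steps; at `Φ = 0` the truncated subtraction says that the walk stays there. -/
theorem Walk.near_next_of_not_errs {ans tru : ℕ → ℕ → Bool} {N F Φ : ℕ} {w : Walk}
    (h1 : ∀ κ b, κ < 4 → b < N → b + 2 ≤ F → tru κ b = true)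
    (h2 : ∀ κ b, κ < 4 → b < N → F + 2 ≤ b → tru κ b = false) (hF : F ≤ N)
    (he : ¬ w.Errs ans tru N) (hw : w.Near F Φ) : (w.next ans N).Near F (Φ - 1) := by
  obtain ⟨s, K, e1, e2, e3, e4, e5⟩ := hw
  have a0 := Walk.answer_of_not_errs h1 h2 hF he (κ := 0) (by norm_num)
  have a1 := Walk.answer_of_not_errs h1 h2 hF he (κ := 1) (by norm_num)
  have a2 := Walk.answer_of_not_errs h1 h2 hF he (κ := 2) (by norm_num)
  have a3 := Walk.answer_of_not_errs h1 h2 hF he (κ := 3) (by norm_num)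
  rw [Walk.next, Walk.vote]
  have h8 : 8 ≤ w.h := by rw [e1]; have := Nat.one_le_two_pow (n := s); omega
  have hK : 2 ^ s ≤ 2 ^ K := Nat.pow_le_pow_right (by norm_num) e2
  -- The probes stand at `q - 3h`, `q - h`, `q + h`, `q + 3h`. A score from `1` to `3` centres the
  -- interval that contains `F`, up to one block; a score of `0` or `4` means that `F` is at
  -- distance at least `3h - 1`.
  have key : (0 < w.score ans N ∧ w.score ans N < 4 →
      w.centre (w.score ans N) ≤ F + w.h + 1 ∧ F ≤ w.centre (w.score ans N) + w.h + 1) ∧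
      (¬ (0 < w.score ans N ∧ w.score ans N < 4) →
        F + 3 * w.h ≤ w.q + 1 ∨ w.q + 3 * w.h ≤ F + 1) := by
    have b0 : w.answer ans N 0 = true ∨ w.answer ans N 0 = false := by
      cases w.answer ans N 0 <;> simp
    have b1 : w.answer ans N 1 = true ∨ w.answer ans N 1 = false := by
      cases w.answer ans N 1 <;> simp
    have b2 : w.answer ans N 2 = true ∨ w.answer ans N 2 = false := by
      cases w.answer ans N 2 <;> simp
    have b3 : w.answer ans N 3 = true ∨ w.answer ans N 3 = false := by
      cases w.answer ans N 3 <;> simp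
    rw [Walk.centre]
    rcases b0 with b0 | b0 <;> rcases b1 with b1 | b1 <;> rcases b2 with b2 | b2 <;>
      rcases b3 with b3 | b3 <;>
      simp only [Walk.score, b0, b1, b2, b3, Bool.toNat_true, Bool.toNat_false,
        true_imp_iff, reduceCtorEq, false_imp_iff, and_true, true_and] at a0 a1 a2 a3 ⊢ <;>
      norm_num at a0 a1 a2 a3 ⊢ <;> omega
  by_cases hv : 0 < w.score ans N ∧ w.score ans N < 4
  · obtain ⟨k1, k2⟩ := key.1 hv
    rcases s with _ | s
    · refine ⟨0, 0, ?_, le_rfl, ?_, ?_, by omega⟩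
      · simp [Walk.scale, hv, e1]
      · simp only [e1] at k1 k2 ⊢; omega
      · simp only [e1] at k1 k2 ⊢; omega
    · have hp : 2 ^ (s + 1) = 2 * 2 ^ s := by rw [pow_succ, mul_comm]
      have hp1 : 1 ≤ 2 ^ s := Nat.one_le_two_pow
      -- After halving, the distance `h + 1 = 16 * 2 ^ s + 1` to the new centre is at most `20 * 2 ^
      -- s`, so `K` may be reset to the new scale.
      refine ⟨s, s, ?_, le_rfl, ?_, ?_, by omega⟩
      · simp only [Walk.scale, hv, if_true, e1, and_self]
        rw [if_pos (by omega)]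
        omega
      · simp only [e1] at k1 k2 ⊢; omega
      · simp only [e1] at k1 k2 ⊢; omega
  · have k1 := key.2 hv
    have hp : 2 ^ (s + 1) = 2 * 2 ^ s := by rw [pow_succ, mul_comm]
    have hp1 : 1 ≤ 2 ^ s := Nat.one_le_two_pow
    -- If `K = s`, the distance would be at most `20 * 2 ^ s`, less than `3h - 1 = 24 * 2 ^ s - 1`.
    have hs : s + 1 ≤ K := by
      by_contra hc
      obtain rfl : K = s := by omega
      omega
    refine ⟨s + 1, K, ?_, hs, ?_, ?_, by omega⟩
    · simp only [Walk.scale, hv, if_false]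
      omega
    · simp only [Walk.centre, hv, if_false]; exact e3
    · simp only [Walk.centre, hv, if_false]; exact e4

/-- Whatever the answers, the centre moves by at most `2h ≤ 16 * 2 ^ K`, so `K + 1` accommodates the
distance as `20 + 16 ≤ 40`. The exponent `s` drops by at most one, and `2 * K - s` increases by at
most three. -/
theorem Walk.near_next {ans : ℕ → ℕ → Bool} {N F Φ : ℕ} {w : Walk} (hw : w.Near F Φ) :
    (w.next ans N).Near F (Φ + 3) := by
  obtain ⟨s, K, e1, e2, e3, e4, e5⟩ := hw
  rw [Walk.next, Walk.vote]
  have hK : 2 ^ s ≤ 2 ^ K := Nat.pow_le_pow_right (by norm_num) e2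
  have hKp : 2 ^ (K + 1) = 2 * 2 ^ K := by rw [pow_succ, mul_comm]
  have hp1 : 1 ≤ 2 ^ s := Nat.one_le_two_pow
  by_cases hv : 0 < w.score ans N ∧ w.score ans N < 4
  · have hq : w.centre (w.score ans N) ≤ w.q + 2 * w.h ∧
        w.q ≤ w.centre (w.score ans N) + 2 * w.h := by
      rw [Walk.centre, if_pos hv]
      obtain h | h | h : w.score ans N = 1 ∨ w.score ans N = 2 ∨ w.score ans N = 3 := by omega
      all_goals rw [h]; omega
    rcases s with _ | s
    · refine ⟨0, K + 1, ?_, by omega, ?_, ?_, by omega⟩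
      · simp [Walk.scale, hv, e1]
      · simp only at hq ⊢; omega
      · simp only at hq ⊢; omega
    · have hp : 2 ^ (s + 1) = 2 * 2 ^ s := by rw [pow_succ, mul_comm]
      refine ⟨s, K + 1, ?_, by omega, ?_, ?_, by omega⟩
      · simp only [Walk.scale, hv, if_true, e1, and_self]
        rw [if_pos (by omega)]
        omega
      · simp only at hq ⊢; omega
      · simp only at hq ⊢; omega
  · have hp : 2 ^ (s + 1) = 2 * 2 ^ s := by rw [pow_succ, mul_comm]
    refine ⟨s + 1, K + 1, ?_, by omega, ?_, ?_, by omega⟩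
    · simp only [Walk.scale, hv, if_false]
      omega
    · simp only [Walk.centre, hv, if_false]; omega
    · simp only [Walk.centre, hv, if_false]; omega

/-- Here `K = 0`, so the centre is within `20` of `F`; an interval of `41` blocks meets at most two
cells of `64` blocks. -/
theorem Walk.near_zero {F : ℕ} {w : Walk} (hw : w.Near F 0) :
    w.q / 64 = (F - 20) / 64 ∨ w.q / 64 = (F + 20) / 64 := by
  obtain ⟨s, K, e1, e2, e3, e4, e5⟩ := hw
  obtain rfl : K = 0 := by omega
  omega

open Classical in
-- `bad` bounds the number of rounds after which the potential is positive; all other rounds vote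
-- for one of the two cells near `F`. A correct round that leaves the potential positive trades one
-- unit of it for one unit of `bad`, and a faulty round adds at most `3 + 1` to the sum.
theorem walk_invariant {ans tru : ℕ → ℕ → ℕ → Bool} {N F l : ℕ} {T : ℕ}
    (h1 : ∀ t κ b, t < T → κ < 4 → b < N → b + 2 ≤ F → tru t κ b = true)
    (h2 : ∀ t κ b, t < T → κ < 4 → b < N → F + 2 ≤ b → tru t κ b = false) (hF : F ≤ N)
    (hl : F < 2 ^ l) {t : ℕ} (ht : t ≤ T) :
    ∃ Φ bad, (walk ans N (8 * 2 ^ l) t).Near F Φ ∧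
      bad + Φ ≤ l + 4 * ((Finset.range t).filter fun t =>
        (walk ans N (8 * 2 ^ l) t).Errs (ans t) (tru t) N).card ∧
      t ≤ (walk ans N (8 * 2 ^ l) t).cnt ((F - 20) / 64) +
        (walk ans N (8 * 2 ^ l) t).cnt ((F + 20) / 64) + bad ∧
      (∀ e, e ≠ (F - 20) / 64 → e ≠ (F + 20) / 64 → (walk ans N (8 * 2 ^ l) t).cnt e ≤ bad) ∧
      ∀ e, (walk ans N (8 * 2 ^ l) t).cnt e ≤
        (walk ans N (8 * 2 ^ l) t).cnt (walk ans N (8 * 2 ^ l) t).best := by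
  induction t with
  | zero =>
    refine ⟨l, 0, ⟨l, l, rfl, le_rfl, ?_, ?_, by omega⟩, by simp, by simp, by simp [walk],
      by simp [walk]⟩
    · simp [walk]
    · simp only [walk]
      omega
  | succ t ih =>
    obtain ⟨Φ, bad, i1, i2, i3, i4, i5⟩ := ih (by omega)
    rw [walk]
    set w := walk ans N (8 * 2 ^ l) t with hw
    set e := ((Finset.range t).filter fun t =>
        (walk ans N (8 * 2 ^ l) t).Errs (ans t) (tru t) N).card with he
    have hcnt : ∀ c, (w.next (ans t) N).cnt c =
        w.cnt c + if c = (w.next (ans t) N).q / 64 then 1 else 0 := by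
      intro c
      rw [Walk.next, Walk.vote]
      simp only [Function.update_apply]
      split_ifs with h
      · rw [h]
      · rfl
    have hbest : ∀ c, (w.next (ans t) N).cnt c ≤ (w.next (ans t) N).cnt (w.next (ans t) N).best := by
      intro c
      have := i5 c
      rw [Walk.next, Walk.vote]
      have := i5 (w.centre (Walk.score (ans t) N w) / 64)
      dsimp only
      generalize w.centre (Walk.score (ans t) N w) / 64 = a at this ⊢
      by_cases hb : w.best = a
      · subst hb
        rw [Function.update_self, if_neg (lt_irrefl _), Function.update_self]
        rcases eq_or_ne c w.best with rfl | hc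
        · rw [Function.update_self]
        · rw [Function.update_of_ne hc]; omega
      · rw [Function.update_of_ne hb]
        split_ifs with hlt
        · rw [Function.update_self]
          rcases eq_or_ne c a with rfl | hc
          · rw [Function.update_self]
          · rw [Function.update_of_ne hc]; omega
        · rw [Function.update_of_ne hb]
          rcases eq_or_ne c a with rfl | hc
          · rw [Function.update_self]; omega
          · rw [Function.update_of_ne hc]; omega
    have step : ∃ Φ' bad', (w.next (ans t) N).Near F Φ' ∧ bad ≤ bad' ∧
        (0 < Φ' → bad + 1 ≤ bad') ∧
        bad' + Φ' ≤ l + 4 * ((Finset.range (t + 1)).filter fun t =>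
          (walk ans N (8 * 2 ^ l) t).Errs (ans t) (tru t) N).card := by
      rw [Finset.range_add_one, Finset.filter_insert]
      by_cases hE : w.Errs (ans t) (tru t) N
      · rw [if_pos hE, Finset.card_insert_of_notMem (by simp)]
        exact ⟨Φ + 3, bad + 1, Walk.near_next i1, by omega, by omega, by omega⟩
      · rw [if_neg hE]
        have := Walk.near_next_of_not_errs (fun κ b => h1 t κ b (by omega))
          (fun κ b => h2 t κ b (by omega)) hF hE i1
        rcases Nat.eq_zero_or_pos (Φ - 1) with h0 | h0
        · exact ⟨Φ - 1, bad, this, le_rfl, by omega, by omega⟩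
        · exact ⟨Φ - 1, bad + 1, this, by omega, by omega, by omega⟩
    obtain ⟨Φ', bad', s1, s2, s3, s4⟩ := step
    refine ⟨Φ', bad', s1, s4, ?_, ?_, hbest⟩
    · rw [hcnt, hcnt]
      rcases Nat.eq_zero_or_pos Φ' with h0 | h0
      · subst h0
        rcases Walk.near_zero s1 with h | h
        · rw [if_pos h.symm]; omega
        · rw [if_pos (c := (F + 20) / 64 = _) h.symm]; omega
      · have := s3 h0
        omega
    · intro c hc1 hc2
      rw [hcnt]
      have := i4 c hc1 hc2
      rcases Nat.eq_zero_or_pos Φ' with h0 | h0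
      · subst h0
        rw [if_neg]
        · omega
        · intro h
          rcases Walk.near_zero s1 with h' | h'
          · exact hc1 (h.trans h')
          · exact hc2 (h.trans h')
      · have := s3 h0
        split_ifs <;> omega

open Classical in
-- With at most `l` faulty rounds `bad ≤ 5 * l`, so the two good cells share at least `11 * l` of
-- the `16 * l` votes. One of them has more than `5 * l`, and no other cell has more than `bad`. The
-- tolerance `83` is `20` for the cell plus `63` for its length.
theorem walk_best {ans tru : ℕ → ℕ → ℕ → Bool} {N F l : ℕ} (hl0 : 0 < l)
    (h1 : ∀ t κ b, t < 16 * l → κ < 4 → b < N → b + 2 ≤ F → tru t κ b = true)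
    (h2 : ∀ t κ b, t < 16 * l → κ < 4 → b < N → F + 2 ≤ b → tru t κ b = false) (hF : F ≤ N)
    (hl : F < 2 ^ l)
    (herr : ((Finset.range (16 * l)).filter fun t =>
        (walk ans N (8 * 2 ^ l) t).Errs (ans t) (tru t) N).card ≤ l) :
    (walk ans N (8 * 2 ^ l) (16 * l)).best * 64 ≤ F + 83 ∧
      F ≤ (walk ans N (8 * 2 ^ l) (16 * l)).best * 64 + 83 := by
  obtain ⟨Φ, bad, -, i2, i3, i4, i5⟩ := walk_invariant h1 h2 hF hl (ans := ans) le_rfl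
  set w := walk ans N (8 * 2 ^ l) (16 * l)
  have j1 := i5 ((F - 20) / 64)
  have j2 := i5 ((F + 20) / 64)
  by_cases c1 : w.best = (F - 20) / 64
  · omega
  by_cases c2 : w.best = (F + 20) / 64
  · omega
  have := i4 _ c1 c2
  omega

end SearchAnalysis

/-! ## Dislocation of sorted sequences -/

section Dislocation

/-- The number of the items `x 0, …, x (m - 1)` with `ρ`-value below `v`. -/
def below (ρ : ℕ → ℕ) (m : ℕ) (x : ℕ → ℕ) (v : ℕ) : ℕ :=
  ((Finset.range m).filter fun i => ρ (x i) < v).card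

/-- The number of the items `x 0, …, x (m - 1)` with `ρ`-value in the interval `[u, v)`. -/
def between (ρ : ℕ → ℕ) (m : ℕ) (x : ℕ → ℕ) (u v : ℕ) : ℕ :=
  ((Finset.range m).filter fun i => u ≤ ρ (x i) ∧ ρ (x i) < v).card

/-- The order `π` of `m` elements has dislocation at most `D` with respect to the values `ρ`. -/
def Close (ρ : ℕ → ℕ) (m : ℕ) (π : ℕ → ℕ) (D : ℕ) : Prop :=
  ∀ p, p < m → p ≤ below ρ m π (ρ (π p)) + D ∧ below ρ m π (ρ (π p)) ≤ p + D

theorem below_add_between (ρ : ℕ → ℕ) (m : ℕ) (x : ℕ → ℕ) {u v : ℕ} (h : u ≤ v) :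
    below ρ m x u + between ρ m x u v = below ρ m x v := by
  rw [below, below, between, ← Finset.card_union_of_disjoint]
  · congr 1
    ext i
    simp only [Finset.mem_union, Finset.mem_filter, Finset.mem_range]
    omega
  · rw [Finset.disjoint_left]
    intro i hi hi'
    simp only [Finset.mem_filter, Finset.mem_range] at hi hi'
    omega

theorem below_mono (ρ : ℕ → ℕ) (m : ℕ) (x : ℕ → ℕ) {u v : ℕ} (h : u ≤ v) :
    below ρ m x u ≤ below ρ m x v := by
  have := below_add_between ρ m x h
  omega

theorem below_le (ρ : ℕ → ℕ) (m : ℕ) (x : ℕ → ℕ) (v : ℕ) : below ρ m x v ≤ m := by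
  simpa [below] using Finset.card_filter_le (Finset.range m) fun i => ρ (x i) < v

theorem below_lt_below {ρ : ℕ → ℕ} {m : ℕ} {x : ℕ → ℕ} {i v : ℕ} (hi : i < m) (h : ρ (x i) < v) :
    below ρ m x (ρ (x i)) < below ρ m x v := by
  have h1 := below_add_between ρ m x h.le
  have h2 : 0 < between ρ m x (ρ (x i)) v := Finset.card_pos.2 ⟨i, by simp [hi, h]⟩
  omega

/-- Counts do not change when the items are permuted. -/
theorem card_filter_eq_of_perm {m : ℕ} {x y : ℕ → ℕ}
    (hx : ∀ i i', i < m → i' < m → x i = x i' → i = i')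
    (h : ∀ i, i < m → ∃ p, p < m ∧ y p = x i) (P : ℕ → Prop) [DecidablePred P] :
    ((Finset.range m).filter fun p => P (y p)).card =
      ((Finset.range m).filter fun i => P (x i)).card := by
  choose! f hf hfy using h
  have hinj : Set.InjOn f (Finset.range m) := by
    intro i hi i' hi' h
    simp only [Finset.coe_range, Set.mem_Iio] at hi hi'
    exact hx i i' hi hi' (by rw [← hfy i hi, ← hfy i' hi', h])
  have himg : (Finset.range m).image f = Finset.range m := by
    apply Finset.eq_of_subset_of_card_le
    · intro p hp
      obtain ⟨i, hi, rfl⟩ := Finset.mem_image.1 hp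
      exact Finset.mem_range.2 (hf i (Finset.mem_range.1 hi))
    · rw [Finset.card_image_of_injOn hinj]
  rw [← himg, Finset.filter_image, Finset.card_image_of_injOn (hinj.mono (Finset.coe_subset.2 (Finset.filter_subset _ _))), himg]
  congr 1
  apply Finset.filter_congr
  intro i hi
  rw [hfy i (Finset.mem_range.1 hi)]

theorem below_perm {ρ : ℕ → ℕ} {m : ℕ} {x y : ℕ → ℕ}
    (hx : ∀ i i', i < m → i' < m → x i = x i' → i = i')
    (h : ∀ i, i < m → ∃ p, p < m ∧ y p = x i) : below ρ m y = below ρ m x := by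
  funext v
  exact card_filter_eq_of_perm hx h fun a => ρ a < v

/-- An item is displaced only by items inverted with it. All of those on one side lie between it and
the farthest of them, and by `hD` that interval of ranks contains at most `D` items. -/
theorem sortPos_le_below_add {ρ : ℕ → ℕ} {m D : ℕ} {x k : ℕ → ℕ}
    (hinj : ∀ i i', i < m → i' < m → ρ (x i) = ρ (x i') → i = i')
    (hD : ∀ i i', i < m → i' < m → ρ (x i) < ρ (x i') → k i' ≤ k i →
      between ρ m x (ρ (x i)) (ρ (x i')) ≤ D) {i : ℕ} (hi : i < m) :
    sortPos m k i ≤ below ρ m x (ρ (x i)) + D ∧ below ρ m x (ρ (x i)) ≤ sortPos m k i + D := by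
  rw [sortPos_eq_card hi, below]
  constructor
  · set Y := (Finset.range m).filter fun i' => ρ (x i) < ρ (x i') ∧ k i' ≤ k i with hY
    have hYD : Y.card ≤ D := by
      rcases Y.eq_empty_or_nonempty with h0 | h0
      · simp [h0]
      · obtain ⟨z, hz, hzmax⟩ := Y.exists_max_image (fun i' => ρ (x i')) h0
        obtain ⟨hzm, hz1, hz2⟩ : z < m ∧ ρ (x i) < ρ (x z) ∧ k z ≤ k i := by simpa [hY] using hz
        refine le_trans ?_ (hD i z hi hzm hz1 hz2)
        rw [between]
        set S := (Finset.range m).filter fun i' => ρ (x i) ≤ ρ (x i') ∧ ρ (x i') < ρ (x z)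
        have hiS : i ∈ S := by simp [S, hi, hz1]
        -- The interval counted by `between` contains `i` but not the farthest item `z`; exchanging
        -- the two leaves the bound at `D`.
        have : Y.erase z ⊆ S.erase i := by
          intro y hy
          obtain ⟨hne, hy⟩ := Finset.mem_erase.1 hy
          have hmax := hzmax y hy
          obtain ⟨hym, hy1, hy2⟩ : y < m ∧ ρ (x i) < ρ (x y) ∧ k y ≤ k i := by simpa [hY] using hy
          rw [Finset.mem_erase]
          refine ⟨by rintro rfl; omega, ?_⟩
          have : ρ (x y) ≠ ρ (x z) := fun h => hne (hinj y z hym hzm h)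
          simp only [S, Finset.mem_filter, Finset.mem_range]
          omega
        have := Finset.card_le_card this
        rw [Finset.card_erase_of_mem hz, Finset.card_erase_of_mem hiS] at this
        have := Finset.card_pos.2 ⟨i, hiS⟩
        omega
    refine le_trans ?_ (Nat.add_le_add_left hYD _)
    refine le_trans (Finset.card_le_card ?_) (Finset.card_union_le _ _)
    intro j hj
    simp only [Finset.mem_filter, Finset.mem_range, Finset.mem_union, hY] at hj ⊢
    have : ρ (x j) ≠ ρ (x i) := fun h => by
      have := hinj j i hj.1 hi h
      subst this
      omega
    omega
  · set Y := (Finset.range m).filter fun i' => ρ (x i') < ρ (x i) ∧ k i ≤ k i' with hY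
    have hYD : Y.card ≤ D := by
      rcases Y.eq_empty_or_nonempty with h0 | h0
      · simp [h0]
      · obtain ⟨z, hz, hzmin⟩ := Y.exists_min_image (fun i' => ρ (x i')) h0
        obtain ⟨hzm, hz1, hz2⟩ : z < m ∧ ρ (x z) < ρ (x i) ∧ k i ≤ k z := by simpa [hY] using hz
        refine le_trans (Finset.card_le_card ?_) (hD z i hzm hi hz1 hz2)
        intro y hy
        have hmin := hzmin y hy
        simp only [Finset.mem_filter, Finset.mem_range, hY] at hy ⊢
        omega
    refine le_trans ?_ (Nat.add_le_add_left hYD _)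
    refine le_trans (Finset.card_le_card ?_) (Finset.card_union_le _ _)
    intro j hj
    simp only [Finset.mem_filter, Finset.mem_range, Finset.mem_union, hY] at hj ⊢
    omega

theorem close_sorted {ρ : ℕ → ℕ} {m D : ℕ} {x k : ℕ → ℕ}
    (hinj : ∀ i i', i < m → i' < m → ρ (x i) = ρ (x i') → i = i')
    (hD : ∀ i i', i < m → i' < m → ρ (x i) < ρ (x i') → k i' ≤ k i →
      between ρ m x (ρ (x i)) (ρ (x i')) ≤ D) : Close ρ m (sorted m x k) D := by
  have hx : ∀ i i', i < m → i' < m → x i = x i' → i = i' :=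
    fun i i' hi hi' h => hinj i i' hi hi' (by rw [h])
  intro p hp
  rw [below_perm hx fun i hi => exists_eq_sorted x k hi]
  obtain ⟨i, hi, h1, rfl⟩ := exists_sorted_eq x k hp
  rw [h1]
  exact sortPos_le_below_add hinj hD hi

/-- Sorting by keys that differ from the ranks by at most `e`. -/
theorem close_sorted_of_keys {ρ : ℕ → ℕ} {m e : ℕ} {x k : ℕ → ℕ}
    (hinj : ∀ i i', i < m → i' < m → ρ (x i) = ρ (x i') → i = i')
    (hk : ∀ i, i < m → k i ≤ below ρ m x (ρ (x i)) + e ∧ below ρ m x (ρ (x i)) ≤ k i + e) :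
    Close ρ m (sorted m x k) (2 * e) := by
  apply close_sorted hinj
  intro i i' hi hi' h h'
  have h1 := below_add_between ρ m x h.le
  have h2 := hk i hi
  have h3 := hk i' hi'
  omega

/-- The scores of the elements in an order with dislocation at most `D` differ from the ranks by at
most the number of wrong comparisons within the windows. -/
theorem scoreAt_close {ρ : ℕ → ℕ} {m D e : ℕ} {π : ℕ → ℕ} {o : ℕ → ℕ → Bool} (hπ : Close ρ m π D)
    (ho : ∀ a, o a a = false)
    {q : ℕ} (hq : q < m)
    (he : ((Finset.range m).filter fun r =>
      (below ρ m π (ρ (π r)) ≤ below ρ m π (ρ (π q)) + 4 * D ∧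
        below ρ m π (ρ (π q)) ≤ below ρ m π (ρ (π r)) + 4 * D) ∧ π r ≠ π q ∧
        o (π r) (π q) ≠ decide (ρ (π r) < ρ (π q))).card ≤ e) :
    scoreAt o (2 * D) m π q ≤ below ρ m π (ρ (π q)) + e ∧
      below ρ m π (ρ (π q)) ≤ scoreAt o (2 * D) m π q + e := by
  set I := Finset.Ico (q - 2 * D) (min (q + 2 * D + 1) m) with hI
  have hqc := hπ q hq
  -- Position and rank differ by at most `D`, so positions more than `2 * D` before `q` have smaller
  -- rank and those more than `2 * D` after it have larger rank. Only the window needs comparisons.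
  have hR : below ρ m π (ρ (π q)) = (q - 2 * D) + (I.filter fun r => ρ (π r) < ρ (π q)).card := by
    have : (q - 2 * D) = (Finset.range (q - 2 * D)).card := by simp
    conv_rhs => rw [this]
    rw [← Finset.card_union_of_disjoint]
    · rw [below]
      congr 1
      ext r
      simp only [Finset.mem_filter, Finset.mem_range, Finset.mem_union, hI, Finset.mem_Ico]
      constructor
      · rintro ⟨hr, hlt⟩
        by_cases h : r < q - 2 * D
        · exact Or.inl h
        · refine Or.inr ⟨⟨by omega, ?_⟩, hlt⟩
          have h1 := hπ r hr
          have h2 := below_lt_below hr hlt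
          omega
      · rintro (h | ⟨h, hlt⟩)
        · refine ⟨by omega, ?_⟩
          by_contra hc
          have h1 := hπ r (by omega)
          have h2 := below_mono ρ m π (not_lt.1 hc)
          omega
        · exact ⟨by omega, hlt⟩
    · rw [Finset.disjoint_left]
      intro r hr hr'
      simp only [Finset.mem_filter, Finset.mem_range, hI, Finset.mem_Ico] at hr hr'
      omega
  -- Within the window the ranks differ by at most `4 * D`: `2 * D` for the positions and `D` for
  -- the dislocation of each element.
  have hmem : ∀ r ∈ I, π r ≠ π q → o (π r) (π q) ≠ decide (ρ (π r) < ρ (π q)) →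
      r ∈ ((Finset.range m).filter fun r =>
      (below ρ m π (ρ (π r)) ≤ below ρ m π (ρ (π q)) + 4 * D ∧
        below ρ m π (ρ (π q)) ≤ below ρ m π (ρ (π r)) + 4 * D) ∧ π r ≠ π q ∧
        o (π r) (π q) ≠ decide (ρ (π r) < ρ (π q))) := by
    intro r hr hne h
    rw [hI, Finset.mem_Ico] at hr
    have := hπ r (by omega)
    rw [Finset.mem_filter, Finset.mem_range]
    exact ⟨by omega, ⟨by omega, by omega⟩, hne, h⟩
  rw [scoreAt, ← hI, hR]
  constructor
  · rw [add_assoc]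
    refine Nat.add_le_add_left (le_trans ?_ (Nat.add_le_add_left he _)) _
    refine le_trans (Finset.card_le_card ?_) (Finset.card_union_le _ _)
    intro r hr
    obtain ⟨hr, h⟩ := Finset.mem_filter.1 hr
    rw [Finset.mem_union]
    by_cases hlt : ρ (π r) < ρ (π q)
    · exact Or.inl (by simp [hr, hlt])
    · refine Or.inr (hmem r hr ?_ (by simp [h, hlt]))
      intro h'
      rw [h', ho] at h
      exact absurd h (by simp)
  · rw [add_assoc]
    refine Nat.add_le_add_left (le_trans ?_ (Nat.add_le_add_left he _)) _
    refine le_trans (Finset.card_le_card ?_) (Finset.card_union_le _ _)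
    intro r hr
    obtain ⟨hr, h⟩ := Finset.mem_filter.1 hr
    rw [Finset.mem_union]
    by_cases hlt : o (π r) (π q) = true
    · exact Or.inl (by simp [hr, hlt])
    · refine Or.inr (hmem r hr ?_ (by simp [h, hlt]))
      intro h'
      rw [h'] at h
      omega

end Dislocation

/-! ## The order of a level is close to the true order if few comparisons are wrong -/

section LevelAnalysis

/-- Many elements of each long interval of ranks are selected for the next level. -/
def Spread (ρ : ℕ → ℕ) (coin : ℕ → Bool) (n j : ℕ) : Prop :=
  ∀ u v, 2 ^ 18 * ell n ≤ between ρ (n / 2 ^ j) (lev coin n j) u v →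
    10752 * ell n + 1 ≤ between ρ (n / 2 ^ (j + 1)) (lev coin n (j + 1)) u v

/-- There are few wrong comparisons of an element `a` of the level `x` with those of similar ranks. -/
def FewNear (o : ℕ → ℕ → Bool) (ρ : ℕ → ℕ) (n m : ℕ) (x : ℕ → ℕ) (a : ℕ) : Prop :=
  ((Finset.range m).filter fun i =>
    (below ρ m x (ρ (x i)) ≤ below ρ m x (ρ a) + 4 * (2 ^ 18 * ell n) ∧
      below ρ m x (ρ a) ≤ below ρ m x (ρ (x i)) + 4 * (2 ^ 18 * ell n)) ∧ x i ≠ a ∧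
      o (x i) a ≠ decide (ρ (x i) < ρ a)).card ≤ 32 * ell n

open Classical in
/-- There are few rounds with wrong comparisons in the noisy search for the rank of `a`. -/
def FewSearch (o : ℕ → ℕ → Bool) (ρ : ℕ → ℕ) (n : ℕ) (π : ℕ → ℕ) (m a : ℕ) : Prop :=
  ((Finset.range (16 * ell n)).filter fun t =>
    (walk (searchAns o n π a) (m / (64 * ell n)) (8 * 2 ^ ell n) t).Errs (searchAns o n π a t)
      (searchAns (fun a b => decide (ρ a < ρ b)) n π a t) (m / (64 * ell n))).card ≤ ell n

/-- The block size equals the dislocation of `π`, so elements two blocks or more away from the block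
`F` of the true rank are on the right side of `a`. The error is the `83` blocks of `walk_best` plus
one for rounding the rank to a block: `84 * 64 = 5376`. -/
theorem noisyRank_close {o : ℕ → ℕ → Bool} {ρ : ℕ → ℕ} {n m : ℕ} {π : ℕ → ℕ} {a : ℕ} (hm : m ≤ n)
    (hπ : Close ρ m π (64 * ell n)) (hs : FewSearch o ρ n π m a) :
    noisyRank o n π m a ≤ below ρ m π (ρ a) + 5376 * ell n ∧
      below ρ m π (ρ a) ≤ noisyRank o n π m a + 5376 * ell n := by
  set B := 64 * ell n with hB
  have hl := ell_pos n
  have hBpos : 0 < B := by omega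
  set r := below ρ m π (ρ a) with hr
  have hrm : r ≤ m := below_le _ _ _ _
  set F := r / B with hF
  have hF1 : F * B ≤ r := Nat.div_mul_le_self _ _
  have hF2 : r < F * B + B := Nat.lt_div_mul_add hBpos
  have key := walk_best (ans := searchAns o n π a)
    (tru := searchAns (fun a b => decide (ρ a < ρ b)) n π a) (N := m / B) (F := F) (l := ell n) hl
    ?_ ?_ (Nat.div_le_div_right hrm)
    ((Nat.div_le_self _ _).trans_lt (hrm.trans_lt (hm.trans_lt (lt_two_pow_ell n)))) hs
  · rw [noisyRank, ← hB]
    set b := (walk (searchAns o n π a) (m / B) (8 * 2 ^ ell n) (16 * ell n)).best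
    have h1 : b * 64 * B ≤ (F + 83) * B := Nat.mul_le_mul_right _ key.1
    have h2 : F * B ≤ (b * 64 + 83) * B := Nat.mul_le_mul_right _ key.2
    rw [add_mul] at h1 h2
    omega
  · intro t κ b ht hκ hb h
    have hp : b * B + (4 * t + κ) < m := block_index_lt hb (by omega)
    have h1 : (b + 2) * B ≤ F * B := Nat.mul_le_mul_right _ h
    rw [add_mul] at h1
    rw [searchAns, decide_eq_true_eq, ← hB]
    by_contra hc
    have h2 := below_mono ρ m π (not_lt.1 hc)
    have h3 := hπ _ hp
    omega
  · intro t κ b ht hκ hb h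
    have hp : b * B + (4 * t + κ) < m := block_index_lt hb (by omega)
    have h1 : (F + 2) * B ≤ b * B := Nat.mul_le_mul_right _ h
    rw [add_mul] at h1
    rw [searchAns, decide_eq_false_iff_not, ← hB]
    intro hc
    have h2 := below_lt_below hp hc
    have h3 := hπ _ hp
    omega

/-- Coarse sorting by estimated ranks in the sparser level, then fine sorting by scores. The
resulting dislocation is again `64 * ell n`, independently of that of the coarse order, so errors do
not accumulate over the levels. -/
theorem refine_close {o : ℕ → ℕ → Bool} {ρ : ℕ → ℕ} {n m m' : ℕ} {π x : ℕ → ℕ} (hm : m' ≤ n)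
    (ho : ∀ a, o a a = false)
    (hinj : ∀ i i', i < m → i' < m → ρ (x i) = ρ (x i') → i = i')
    (hπi : ∀ i i', i < m' → i' < m' → π i = π i' → i = i')
    (hπ : Close ρ m' π (64 * ell n))
    (hspread : ∀ u v, 2 ^ 18 * ell n ≤ between ρ m x u v →
      10752 * ell n + 1 ≤ between ρ m' π u v)
    (hnear : ∀ i, i < m → FewNear o ρ n m x (x i))
    (hsearch : ∀ i, i < m → (∀ q, q < m' → π q ≠ x i) → FewSearch o ρ n π m' (x i)) :
    Close ρ m (refine o n π m' x m) (64 * ell n) := by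
  have hx : ∀ i i', i < m → i' < m → x i = x i' → i = i' :=
    fun i i' hi hi' h => hinj i i' hi hi' (by rw [h])
  have hkey : ∀ i, i < m →
      rankIn o n π m' (x i) ≤ below ρ m' π (ρ (x i)) + 5376 * ell n ∧
        below ρ m' π (ρ (x i)) ≤ rankIn o n π m' (x i) + 5376 * ell n := by
    intro i hi
    by_cases h : ∃ q, q < m' ∧ π q = x i
    · obtain ⟨q, hq, h⟩ := h
      have := hπ q hq
      rw [← h, rankIn_of_mem hq hπi]
      omega
    · push Not at h
      rw [rankIn_of_notMem h]
      exact noisyRank_close hm hπ (hsearch i hi h)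
  rw [refine]
  set y := sorted m x fun i => rankIn o n π m' (x i) with hy
  have hyx : ∀ i, i < m → ∃ p, p < m ∧ y p = x i := fun i hi => exists_eq_sorted x _ hi
  have hy1 : Close ρ m y (2 ^ 18 * ell n) := by
    apply close_sorted hinj
    intro i i' hi hi' h h'
    have h1 := hkey i hi
    have h2 := hkey i' hi'
    -- If the estimates are inverted, the ranks in the sample differ by at most `2 * 5376 * ell n`,
    -- too little for an interval with `2 ^ 18 * ell n` elements of the level.
    have h3 := below_add_between ρ m' π h.le
    by_contra hc
    have h4 := hspread _ _ (not_le.1 hc).le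
    omega
  have hyi : ∀ i i', i < m → i' < m → ρ (y i) = ρ (y i') → i = i' := by
    intro p p' hp hp' h
    obtain ⟨i, hi, h1, -⟩ := exists_sorted_eq x (fun i => rankIn o n π m' (x i)) hp
    obtain ⟨i', hi', h2, -⟩ := exists_sorted_eq x (fun i => rankIn o n π m' (x i)) hp'
    apply sorted_inj hx hp hp'
    rw [h1, h2, hinj i i' hi hi' (by rw [← h1, ← h2, ← hy, h])]
  rw [show 64 * ell n = 2 * (32 * ell n) by ring]
  apply close_sorted_of_keys hyi
  intro q hq
  rw [show window n = 2 * (2 ^ 18 * ell n) by rw [window]; ring]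
  apply scoreAt_close hy1 ho hq
  obtain ⟨i, hi, h1, -⟩ := exists_sorted_eq x (fun i => rankIn o n π m' (x i)) hq
  have := hnear i hi
  rw [FewNear] at this
  rw [← hy] at h1
  -- `FewNear` refers to ranks only, so it can be read off from any enumeration of the level, in
  -- particular from the coarse order.
  rw [below_perm hx hyx, h1]
  exact (card_filter_eq_of_perm hx hyx fun a =>
    (below ρ m x (ρ a) ≤ below ρ m x (ρ (x i)) + 4 * (2 ^ 18 * ell n) ∧
      below ρ m x (ρ (x i)) ≤ below ρ m x (ρ a) + 4 * (2 ^ 18 * ell n)) ∧ a ≠ x i ∧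
      o a (x i) ≠ decide (ρ a < ρ (x i))).trans_le this

/-- The order of a level is close to the true order, if there are few errors. -/
theorem order_close {o : ℕ → ℕ → Bool} {ρ : ℕ → ℕ} {coin : ℕ → Bool} {n : ℕ}
    (ho : ∀ a, o a a = false) (hρ : ∀ a b, a < n → b < n → ρ a = ρ b → a = b)
    (hspread : ∀ j, j < Nat.log 2 n → Spread ρ coin n j)
    (hnear : ∀ j i, j < Nat.log 2 n → i < n / 2 ^ j →
      FewNear o ρ n (n / 2 ^ j) (lev coin n j) (lev coin n j i))
    (hsearch : ∀ k i, k < Nat.log 2 n → i < n / 2 ^ (Nat.log 2 n - (k + 1)) →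
      (∀ i', i' < n / 2 ^ (Nat.log 2 n - k) →
        lev coin n (Nat.log 2 n - k) i' ≠ lev coin n (Nat.log 2 n - (k + 1)) i) →
      FewSearch o ρ n (order o coin n k) (n / 2 ^ (Nat.log 2 n - k))
        (lev coin n (Nat.log 2 n - (k + 1)) i)) {k : ℕ} (hk : k ≤ Nat.log 2 n) :
    Close ρ (n / 2 ^ (Nat.log 2 n - k)) (order o coin n k) (64 * ell n) := by
  induction k with
  | zero =>
    intro p hp
    -- The sparsest level has a single element.
    have h1 : n / 2 ^ Nat.log 2 n < 2 := by
      rw [Nat.div_lt_iff_lt_mul (by positivity), mul_comm, ← pow_succ]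
      exact lt_two_pow_ell n
    have h2 := below_le ρ (n / 2 ^ (Nat.log 2 n - 0)) (order o coin n 0) (ρ (order o coin n 0 p))
    have := ell_pos n
    rw [Nat.sub_zero] at *
    omega
  | succ k ih =>
    have hkj : Nat.log 2 n - k = Nat.log 2 n - (k + 1) + 1 := by omega
    refine refine_close (Nat.div_le_self _ _) ho ?_ (fun i i' => order_inj) (ih (by omega)) ?_
      (fun i hi => hnear _ i (by omega) hi) ?_
    · intro i i' hi hi' h
      exact lev_inj (hρ _ _ (lev_lt hi) (lev_lt hi') h)
    · intro u v h
      have := hspread _ (by omega) u v h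
      rw [← hkj] at this
      refine this.trans_eq ?_
      exact (card_filter_eq_of_perm (fun i i' _ _ h => lev_inj h)
        (fun i hi => exists_eq_order o coin hi) fun a => u ≤ ρ a ∧ ρ a < v).symm
    · intro i hi h
      apply hsearch k i (by omega) hi
      intro i' hi' h'
      obtain ⟨p, hp, hp'⟩ := exists_eq_order o coin hi'
      exact h p hp (hp'.trans h')

end LevelAnalysis

/-! ## Product measures on Boolean vectors -/

section Probability

open MeasureTheory ProbabilityTheory

/-- A bound for the sections of a set in a product space. -/
theorem prod_real_le {α β : Type*} [MeasurableSpace α] [MeasurableSpace β] (μ : Measure α)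
    (ν : Measure β) [IsProbabilityMeasure μ] [IsProbabilityMeasure ν] {A : Set (α × β)} {δ : ℝ}
    (hA : MeasurableSet A) (h : ∀ y, μ.real {x | (x, y) ∈ A} ≤ δ) : (μ.prod ν).real A ≤ δ := by
  have hδ : 0 ≤ δ := by
    obtain ⟨y⟩ := nonempty_of_isProbabilityMeasure ν
    exact measureReal_nonneg.trans (h y)
  rw [measureReal_def, Measure.prod_apply_symm hA]
  refine ENNReal.toReal_le_of_le_ofReal hδ ?_
  calc ∫⁻ y, μ ((fun x => (x, y)) ⁻¹' A) ∂ν ≤ ∫⁻ _, ENNReal.ofReal δ ∂ν := by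
        refine lintegral_mono fun y => ?_
        rw [← ENNReal.ofReal_toReal (measure_ne_top μ ((fun x => (x, y)) ⁻¹' A))]
        exact ENNReal.ofReal_le_ofReal (h y)
    _ = ENNReal.ofReal δ := by simp

variable {ι : Type*} [Fintype ι] [DecidableEq ι]

/-- Resampling some of the coordinates does not change a product measure. -/
theorem map_piecewise_pi (ν : Measure Bool) [IsProbabilityMeasure ν] (X : Finset ι) :
    ((Measure.pi fun _ : ι => ν).prod (Measure.pi fun _ : ι => ν)).map
      (fun z => X.piecewise z.1 z.2) = Measure.pi fun _ : ι => ν := by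
  symm
  apply Measure.pi_eq
  intro s hs
  rw [Measure.map_apply (measurable_of_finite _) (MeasurableSet.of_discrete)]
  -- The preimage of a box is a product of two boxes, which restrict complementary sets of
  -- coordinates.
  have : (fun z : (ι → Bool) × (ι → Bool) => X.piecewise z.1 z.2) ⁻¹' (Set.univ.pi s) =
      (Set.univ.pi fun i => if i ∈ X then s i else Set.univ) ×ˢ
        (Set.univ.pi fun i => if i ∈ X then Set.univ else s i) := by
    ext z
    simp only [Set.mem_preimage, Set.mem_pi, Set.mem_univ, true_imp_iff, Set.mem_prod]
    constructor
    · intro h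
      refine ⟨fun i => ?_, fun i => ?_⟩ <;> have := h i <;> by_cases hi : i ∈ X <;>
        simp_all [Finset.piecewise]
    · rintro ⟨h1, h2⟩ i
      have h1 := h1 i
      have h2 := h2 i
      by_cases hi : i ∈ X <;> simp_all [Finset.piecewise]
  rw [this, Measure.prod_prod, Measure.pi_pi, Measure.pi_pi, ← Finset.prod_mul_distrib]
  apply Finset.prod_congr rfl
  intro i _
  split_ifs
  · rw [measure_univ, mul_one]
  · rw [measure_univ, one_mul]

/-- Conditioning on the coordinates outside `X`: these are frozen to `w`, and a bound uniform in `w`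
for the randomness in `X` alone holds unconditionally. -/
theorem pi_real_le_of_piecewise (ν : Measure Bool) [IsProbabilityMeasure ν] (X : Finset ι)
    {A : Set (ι → Bool)} {δ : ℝ}
    (h : ∀ w, (Measure.pi fun _ : ι => ν).real {η | X.piecewise η w ∈ A} ≤ δ) :
    (Measure.pi fun _ : ι => ν).real A ≤ δ := by
  rw [← map_piecewise_pi ν X, measureReal_def,
    Measure.map_apply (measurable_of_finite _) (MeasurableSet.of_discrete)]
  exact prod_real_le _ _ MeasurableSet.of_discrete h

theorem pi_real_forall_eq_true (p : unitInterval) (E : Finset ι) :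
    (Measure.pi fun _ : ι => bernoulliMeasure true false p).real {w | ∀ e ∈ E, w e = true} =
      (p : ℝ) ^ E.card := by
  have : {w : ι → Bool | ∀ e ∈ E, w e = true} =
      Set.univ.pi fun i => if i ∈ E then {true} else Set.univ := by
    ext w
    simp only [Set.mem_ofPred_eq, Set.mem_pi, Set.mem_univ, true_imp_iff]
    refine forall_congr' fun i => ?_
    split_ifs with h <;> simp [h]
  rw [this, measureReal_def, Measure.pi_pi, ENNReal.toReal_prod]
  have h1 : (bernoulliMeasure true false p).real {true} = p := by
    rw [bernoulliMeasure_real_apply_of_mem_of_notMem] <;> simp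
  rw [← Finset.prod_subset (Finset.subset_univ E) (by intro i _ hi; simp [hi]),
    Finset.prod_congr rfl (g := fun _ => (p : ℝ)), Finset.prod_const]
  intro i hi
  rw [if_pos hi, ← measureReal_def, h1]

theorem pi_real_exists_le (p : unitInterval) (𝓔 : Finset (Finset ι)) {k : ℕ}
    (hk : ∀ E ∈ 𝓔, k ≤ E.card) :
    (Measure.pi fun _ : ι => bernoulliMeasure true false p).real
      {w | ∃ E ∈ 𝓔, ∀ e ∈ E, w e = true} ≤ 𝓔.card * (p : ℝ) ^ k := by
  have : {w : ι → Bool | ∃ E ∈ 𝓔, ∀ e ∈ E, w e = true} =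
      ⋃ E ∈ 𝓔, {w | ∀ e ∈ E, w e = true} := by
    ext w; simp
  rw [this]
  refine (measureReal_biUnion_finset_le _ _).trans ?_
  rw [← nsmul_eq_mul]
  apply Finset.sum_le_card_nsmul
  intro E hE
  rw [pi_real_forall_eq_true]
  exact pow_le_pow_of_le_one p.2.1 p.2.2 (hk E hE)

/-- It is unlikely that many of the coordinates in a given set are `true`. -/
theorem pi_real_card_filter_le (p : unitInterval) (M : Finset ι) (e : ℕ) :
    (Measure.pi fun _ : ι => bernoulliMeasure true false p).real
      {w | e < (M.filter fun i => w i = true).card} ≤ 2 ^ M.card * (p : ℝ) ^ (e + 1) := by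
  have h1 := pi_real_exists_le p (M.powerset.filter fun E => e + 1 ≤ E.card) (k := e + 1)
    (fun E hE => (Finset.mem_filter.1 hE).2)
  refine (measureReal_mono ?_).trans (h1.trans ?_)
  · intro w hw
    refine ⟨M.filter fun i => w i = true, ?_, fun i hi => (Finset.mem_filter.1 hi).2⟩
    rw [Finset.mem_filter, Finset.mem_powerset]
    exact ⟨Finset.filter_subset _ _, hw⟩
  · gcongr
    · exact pow_nonneg p.2.1 _
    · have := (Finset.card_filter_le M.powerset fun E => e + 1 ≤ E.card)
      rw [Finset.card_powerset] at this
      exact_mod_cast this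

/-- It is unlikely that few of many independent events with probability at least `1 / 2` occur. -/
theorem pi_real_card_lt_le (f : ι → Bool → Prop) [∀ i, DecidablePred (f i)] (T : Finset ι)
    (hf : ∀ i ∈ T, ∃ b, f i b) (g : ℕ) :
    (Measure.pi fun _ : ι =>
      bernoulliMeasure true false (⟨1 / 2, by norm_num, by norm_num⟩ : unitInterval)).real
      {c | (T.filter fun i => f i (c i)).card < g} ≤ 2 ^ g * (3 / 4) ^ T.card := by
  set ν := bernoulliMeasure true false (⟨1 / 2, by norm_num, by norm_num⟩ : unitInterval)
  -- The weight `1 / 2` for each event that occurs has mean at most `3 / 4`, because one of the two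
  -- coin values realizes the event. The product of the weights is `(1 / 2) ^ count`, and Markov's
  -- inequality applies.
  set φ : ι → Bool → ℝ := fun i b => if i ∈ T then (if f i b then 1 / 2 else 1) else 1 with hφ
  have hφ0 : ∀ i b, 0 ≤ φ i b := fun i b => by simp only [hφ]; split_ifs <;> norm_num
  have h1 : ∫ c, ∏ i, φ i (c i) ∂(Measure.pi fun _ : ι => ν) ≤ (3 / 4) ^ T.card := by
    rw [integral_fintype_prod_eq_prod]
    have h2 : ∀ i, ∫ b, φ i b ∂ν = 1 / 2 * φ i true + 1 / 2 * φ i false := by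
      intro i
      rw [integral_bernoulliMeasure]
      norm_num
    rw [← Finset.prod_subset (Finset.subset_univ T)]
    · rw [← Finset.prod_const]
      apply Finset.prod_le_prod
      · intro i _
        rw [h2]
        have := hφ0 i true
        have := hφ0 i false
        positivity
      · intro i hi
        rw [h2]
        obtain ⟨b, hb⟩ := hf i hi
        cases b <;> simp only [hφ, hi, hb, if_true] <;> split_ifs <;> norm_num
    · intro i _ hi
      rw [h2]
      simp [hφ, hi]
      norm_num
  have h2 := mul_meas_ge_le_integral_of_nonneg (μ := Measure.pi fun _ : ι => ν)
    (f := fun c => ∏ i, φ i (c i)) (Filter.Eventually.of_forall fun c =>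
      Finset.prod_nonneg fun i _ => hφ0 i _) (Integrable.of_finite) ((1 / 2) ^ g)
  have h3 : (Measure.pi fun _ : ι => ν).real {c | (T.filter fun i => f i (c i)).card < g} ≤
      (Measure.pi fun _ : ι => ν).real {c | (1 / 2 : ℝ) ^ g ≤ ∏ i, φ i (c i)} := by
    refine measureReal_mono ?_ (measure_ne_top _ _)
    intro c hc
    have : ∏ i, φ i (c i) = (1 / 2) ^ (T.filter fun i => f i (c i)).card := by
      rw [← Finset.prod_subset (Finset.subset_univ T) (by intro i _ hi; simp [hφ, hi]),
        ← Finset.prod_const, Finset.prod_filter]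
      exact Finset.prod_congr rfl fun i hi => by simp [hφ, hi]
    rw [Set.mem_ofPred_eq, this]
    exact pow_le_pow_of_le_one (by norm_num) (by norm_num) (le_of_lt hc)
  have h4 : (2 : ℝ) ^ g * (1 / 2) ^ g = 1 := by rw [← mul_pow]; norm_num
  calc _ ≤ _ := h3
    _ = 2 ^ g * ((1 / 2) ^ g * (Measure.pi fun _ : ι => ν).real
        {c | (1 / 2 : ℝ) ^ g ≤ ∏ i, φ i (c i)}) := by rw [← mul_assoc, h4, one_mul]
    _ ≤ _ := by
      gcongr
      exact h2.trans h1

end Probability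

/-! ## Dependence of the orders on coins and comparisons -/

section Dependence

variable {n : ℕ}

/-- The levels are nested. -/
theorem exists_lev_succ_eq (coin : ℕ → Bool) {n j i : ℕ} (hi : i < n / 2 ^ (j + 1)) :
    ∃ i', i' < n / 2 ^ j ∧ lev coin n (j + 1) i = lev coin n j i' := by
  refine ⟨_, ?_, rfl⟩
  have := Bool.toNat_le (coin (coinOff n j + i))
  rw [pow_succ, ← Nat.div_div_eq_div_mul] at hi
  omega

/-- The order of a level depends only on that level, the levels above it, and the comparisons of
the elements of that level. -/
theorem order_congr {o o' : ℕ → ℕ → Bool} {coin coin' : ℕ → Bool} {k : ℕ} (hk : k ≤ Nat.log 2 n)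
    (hlev : ∀ j i, j ≤ Nat.log 2 n → i < n / 2 ^ j → lev coin n j i = lev coin' n j i)
    (ho : ∀ i i', i < n / 2 ^ (Nat.log 2 n - k) → i' < n / 2 ^ (Nat.log 2 n - k) →
      o (lev coin n (Nat.log 2 n - k) i) (lev coin n (Nat.log 2 n - k) i') =
        o' (lev coin n (Nat.log 2 n - k) i) (lev coin n (Nat.log 2 n - k) i')) {p : ℕ}
    (hp : p < n / 2 ^ (Nat.log 2 n - k)) : order o coin n k p = order o' coin' n k p := by
  induction k generalizing p with
  | zero => exact hlev _ _ le_rfl hp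
  | succ k ih =>
    have hkj : Nat.log 2 n - k = Nat.log 2 n - (k + 1) + 1 := by omega
    have hsub : ∀ i, i < n / 2 ^ (Nat.log 2 n - k) → ∃ i', i' < n / 2 ^ (Nat.log 2 n - (k + 1)) ∧
        lev coin n (Nat.log 2 n - k) i = lev coin n (Nat.log 2 n - (k + 1)) i' := by
      intro i hi
      rw [hkj] at hi ⊢
      exact exists_lev_succ_eq coin hi
    refine refine_congr (fun p hp => ih (by omega) ?_ hp) (fun _ _ => order_inj)
      (fun i hi => hlev _ _ (by omega) hi) ?_ ho hp
    · intro i i' hi hi'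
      obtain ⟨a, ha, e⟩ := hsub i hi
      obtain ⟨a', ha', e'⟩ := hsub i' hi'
      rw [e, e', ho a a' ha ha']
    · intro p i hp hi
      obtain ⟨i', hi', e⟩ := exists_order_eq o coin hp
      obtain ⟨a, ha, e'⟩ := hsub i' hi'
      rw [e, e', ho a i ha hi]

theorem coinOff_mono (n : ℕ) : Monotone (coinOff n) :=
  monotone_nat_of_le_succ fun j => by rw [coinOff_succ]; exact Nat.le_add_right _ _

theorem lev_congr {coin coin' : ℕ → Bool} {j i : ℕ}
    (h : ∀ c, c < coinOff n j → coin c = coin' c) (hi : i < n / 2 ^ j) :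
    lev coin n j i = lev coin' n j i := by
  induction j generalizing i with
  | zero => rfl
  | succ j ih =>
    have h1 : coin (coinOff n j + i) = coin' (coinOff n j + i) :=
      h _ (by rw [coinOff_succ]; exact Nat.add_lt_add_left hi _)
    rw [lev, lev, h1, ih (fun c hc => h c (hc.trans_le (coinOff_mono n (Nat.le_succ j))))]
    have := Bool.toNat_le (coin' (coinOff n j + i))
    rw [pow_succ, ← Nat.div_div_eq_div_mul] at hi
    omega

end Dependence

/-! ### The wrong answers of a noisy search -/

section SearchPatterns

/-- If the answers at the queried places agree, then so do the next states. -/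
theorem Walk.next_congr {ans ans' : ℕ → ℕ → Bool} {N : ℕ} {w : Walk}
    (h : ∀ κ, κ < 4 → 3 * w.h ≤ w.q + 2 * w.h * κ → w.q + 2 * w.h * κ - 3 * w.h < N →
      ans κ (w.q + 2 * w.h * κ - 3 * w.h) = ans' κ (w.q + 2 * w.h * κ - 3 * w.h)) :
    w.next ans N = w.next ans' N := by
  have h1 : ∀ κ, κ < 4 → w.answer ans N κ = w.answer ans' N κ := by
    intro κ hκ
    rw [Walk.answer, Walk.answer]
    by_cases c1 : w.q + 2 * w.h * κ < 3 * w.h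
    · simp [c1]
    by_cases c2 : w.q + 2 * w.h * κ - 3 * w.h < N
    · rw [h κ hκ (by omega) c2]
    · simp [c2]
  have h2 : w.score ans N = w.score ans' N := by
    rw [Walk.score, Walk.score, h1 0 (by norm_num), h1 1 (by norm_num), h1 2 (by norm_num),
      h1 3 (by norm_num)]
  rw [Walk.next, Walk.next, h2]

/-- The block that is queried in question `κ` of a round from the state `w`. -/
def Walk.probe (w : Walk) (κ : ℕ) : ℕ := w.q + 2 * w.h * κ - 3 * w.h

open Classical in
/-- A noisy search with many wrong rounds makes all comparisons of one of few large sets wrong. -/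
theorem exists_patterns (ρ : ℕ → ℕ) (n : ℕ) (π : ℕ → ℕ) (m a : ℕ) :
    ∃ 𝓔 : Finset (Finset ℕ), 𝓔.card ≤ 2 ^ (64 * ell n) ∧
      (∀ P ∈ 𝓔, ell n + 1 ≤ P.card ∧ ∀ p ∈ P, p < m) ∧
      ∀ (o : ℕ → ℕ → Bool) (π' : ℕ → ℕ), (∀ p, p < m → π' p = π p) → ¬ FewSearch o ρ n π' m a →
        ∃ P ∈ 𝓔, ∀ p ∈ P, o (π p) a ≠ decide (ρ (π p) < ρ a) := by
  set B := 64 * ell n with hB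
  set N := m / B with hN
  set T := 16 * ell n with hT
  set tru := searchAns (fun a b => decide (ρ a < ρ b)) n π a with htru
  -- Query `κ` of round `t` has number `4 * t + κ`. The walk `w Q` replays the search with the true
  -- answers flipped exactly at the queries in `Q`, so it does not depend on the actual comparisons.
  let anss : Finset ℕ → ℕ → ℕ → ℕ → Bool := fun Q t κ b =>
    xor (tru t κ b) (decide (4 * t + κ ∈ Q))
  let w : Finset ℕ → ℕ → Walk := fun Q t => walk (anss Q) N (8 * 2 ^ ell n) t
  let pos : Finset ℕ → ℕ → ℕ := fun Q q => (w Q (q / 4)).probe (q % 4) * B + q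
  -- The offset of a query within its block is its number, so different queries use different
  -- elements even when they probe the same block.
  have hposinj : ∀ Q ∈ (Finset.range B).powerset, Set.InjOn (pos Q) Q := by
    intro Q hQ q hq q' hq' h
    have h1 := Finset.mem_range.1 (Finset.mem_powerset.1 hQ hq)
    have h2 := Finset.mem_range.1 (Finset.mem_powerset.1 hQ hq')
    have h3 : pos Q q % B = pos Q q' % B := by rw [h]
    simp only [pos] at h3
    rwa [Nat.mul_add_mod', Nat.mul_add_mod', Nat.mod_eq_of_lt h1, Nat.mod_eq_of_lt h2] at h3
  refine ⟨((Finset.range B).powerset.image fun Q => Q.image (pos Q)).filter fun P =>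
    ell n + 1 ≤ P.card ∧ ∀ p ∈ P, p < m, ?_, fun P hP => (Finset.mem_filter.1 hP).2, ?_⟩
  · refine (Finset.card_filter_le _ _).trans (Finset.card_image_le.trans ?_)
    rw [Finset.card_powerset, Finset.card_range]
  intro o π' hπ' hfew
  set ans := searchAns o n π' a with hans
  let v : ℕ → Walk := fun t => walk ans N (8 * 2 ^ ell n) t
  let Q := (Finset.range B).filter fun q => 3 * (v (q / 4)).h ≤ (v (q / 4)).q +
    2 * (v (q / 4)).h * (q % 4) ∧ (v (q / 4)).probe (q % 4) < N ∧
    ans (q / 4) (q % 4) ((v (q / 4)).probe (q % 4)) ≠ tru (q / 4) (q % 4) ((v (q / 4)).probe (q % 4))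
  have hQB : Q ∈ (Finset.range B).powerset := Finset.mem_powerset.2 (Finset.filter_subset _ _)
  have hmemQ : ∀ t κ, t < T → κ < 4 → 3 * (v t).h ≤ (v t).q + 2 * (v t).h * κ →
      (v t).probe κ < N →
      (4 * t + κ ∈ Q ↔ ans t κ ((v t).probe κ) ≠ tru t κ ((v t).probe κ)) := by
    intro t κ ht hκ h1 h2
    have e1 : (4 * t + κ) / 4 = t := by omega
    have e2 : (4 * t + κ) % 4 = κ := by omega
    simp only [Q, Finset.mem_filter, Finset.mem_range, e1, e2, h1, h2, true_and, and_iff_right_iff_imp]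
    intro _
    omega
  -- The actual search coincides with the replay for its own set of wrong queries.
  have hvw : ∀ t, t ≤ T → v t = w Q t := by
    intro t ht
    induction t with
    | zero => rfl
    | succ t ih =>
      have ih := ih (by omega)
      change (v t).next (ans t) N = (w Q t).next (anss Q t) N
      rw [← ih]
      apply Walk.next_congr
      intro κ hκ h1 h2
      have h3 := hmemQ t κ (by omega) hκ h1 h2
      simp only [anss]
      rw [Walk.probe] at h3
      by_cases h4 : 4 * t + κ ∈ Q
      · have := h3.1 h4
        simp only [h4, decide_true, Bool.xor_true]
        generalize ans t κ _ = x at this ⊢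
        generalize tru t κ _ = y at this ⊢
        cases x <;> cases y <;> simp_all
      · have := not_not.1 (mt h3.2 h4)
        simp [h4, this]
  have hpos : ∀ q ∈ Q, pos Q q < m ∧ o (π (pos Q q)) a ≠ decide (ρ (π (pos Q q)) < ρ a) := by
    intro q hq
    have hqB := Finset.mem_range.1 (Finset.mem_powerset.1 hQB hq)
    obtain ⟨h1, h2, h3⟩ := (Finset.mem_filter.1 hq).2
    have e1 : v (q / 4) = w Q (q / 4) := hvw _ (by omega)
    rw [e1] at h2 h3
    have h4 : pos Q q < m := block_index_lt h2 hqB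
    refine ⟨h4, ?_⟩
    have e2 : 4 * (q / 4) + q % 4 = q := Nat.div_add_mod q 4
    simp only [hans, htru, searchAns, e2, ← hB] at h3
    rw [hπ' _ h4] at h3
    exact h3
  refine ⟨Q.image (pos Q), ?_, ?_⟩
  · rw [Finset.mem_filter]
    refine ⟨Finset.mem_image_of_mem _ hQB, ?_, ?_⟩
    · rw [Finset.card_image_of_injOn (hposinj Q hQB)]
      rw [FewSearch, not_le] at hfew
      -- Every faulty round contains at least one wrong query, so there are at least as many wrong
      -- queries as faulty rounds.
      refine (Nat.succ_le_of_lt hfew).trans ((Finset.card_le_card ?_).trans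
        (Finset.card_image_le (s := Q) (f := fun q => q / 4)))
      intro t ht
      obtain ⟨ht, κ, hκ, h1, h2, h3⟩ := Finset.mem_filter.1 ht
      have htT := Finset.mem_range.1 ht
      refine Finset.mem_image.2 ⟨4 * t + κ, (hmemQ t κ htT hκ h1 h2).2 ?_, by omega⟩
      have h4 : (v t).probe κ * B + (4 * t + κ) < m := block_index_lt h2 (by omega)
      have h5 : searchAns (fun a b => decide (ρ a < ρ b)) n π' a t κ ((v t).probe κ) =
          tru t κ ((v t).probe κ) := by
        rw [htru, searchAns, searchAns, ← hB, hπ' _ h4]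
      rw [← h5]
      exact h3
    · intro p hp
      obtain ⟨q, hq, rfl⟩ := Finset.mem_image.1 hp
      exact (hpos q hq).1
  · intro p hp
    obtain ⟨q, hq, rfl⟩ := Finset.mem_image.1 hp
    exact (hpos q hq).2

end SearchPatterns

/-! ## The probability of many wrong comparisons -/

section Comparisons

open MeasureTheory ProbabilityTheory

variable {n : ℕ} {α : Type*} [LinearOrder α] {S : Fin n → α}

/-- The rank of the element number `a`, if there is one. -/
def rankNat (S : Fin n → α) (a : ℕ) : ℕ := if h : a < n then rank S ⟨a, h⟩ else 0

/-- The pair of the elements number `b` and `A`. -/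
def pairWith (A : Fin n) (b : ℕ) : Sym2 (Fin n) := if h : b < n then s(⟨b, h⟩, A) else s(A, A)

theorem rank_lt_rank_iff {i j : Fin n} : rank S i < rank S j ↔ S i < S j := by
  refine ⟨fun h => ?_, rank_lt_rank⟩
  by_contra hc
  refine absurd h (not_lt.2 (Finset.card_le_card ?_))
  intro k hk
  simp only [Finset.mem_filter, Finset.mem_univ, true_and] at hk ⊢
  exact hk.trans_le (not_lt.1 hc)

theorem rank_inj (hS : Function.Injective S) {i j : Fin n} (h : rank S i = rank S j) : i = j := by
  apply hS
  apply le_antisymm <;> rw [← not_lt] <;> intro hlt <;> have := rank_lt_rank hlt <;> omega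

theorem rank_lt (i : Fin n) : rank S i < n := by
  have : rank S i < (Finset.univ : Finset (Fin n)).card := by
    apply Finset.card_lt_card
    rw [Finset.ssubset_iff_of_subset (Finset.filter_subset _ _)]
    exact ⟨i, by simp, by simp⟩
  simpa using this

theorem rankNat_inj (hS : Function.Injective S) {a b : ℕ} (ha : a < n) (hb : b < n)
    (h : rankNat S a = rankNat S b) : a = b := by
  rw [rankNat, rankNat, dif_pos ha, dif_pos hb] at h
  simpa using rank_inj hS h

theorem rankNat_lt {a : ℕ} (ha : a < n) : rankNat S a < n := by
  rw [rankNat, dif_pos ha]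
  exact rank_lt _

theorem obsNat_observed_self (w : Sym2 (Fin n) → Bool) (a : ℕ) :
    obsNat (observed S w) a a = false := by
  rw [obsNat]
  split_ifs <;> simp [observed]

theorem obsNat_ne_iff {w : Sym2 (Fin n) → Bool} {a b : ℕ} (ha : a < n) (hb : b < n) (hab : b ≠ a) :
    obsNat (observed S w) b a ≠ decide (rankNat S b < rankNat S a) ↔
      w (pairWith ⟨a, ha⟩ b) = true := by
  rw [obsNat, dif_pos ⟨hb, ha⟩, observed, rankNat, rankNat, dif_pos ha, dif_pos hb, pairWith,
    dif_pos hb]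
  simp only [rank_lt_rank_iff]
  have : (⟨b, hb⟩ : Fin n) ≠ ⟨a, ha⟩ := by simpa using hab
  simp only [this, ne_eq, not_false_eq_true, decide_true, Bool.true_and]
  cases w s(⟨b, hb⟩, ⟨a, ha⟩) <;> simp

theorem pairWith_inj {A : Fin n} {b b' : ℕ} (hb : b < n) (hb' : b' < n)
    (h : pairWith A b = pairWith A b') : b = b' := by
  rw [pairWith, pairWith, dif_pos hb, dif_pos hb', Sym2.congr_left] at h
  simpa using h

/-- Distinct elements of the level have distinct ranks in it, and these lie in an interval of `2 * D
+ 1` integers. -/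
theorem card_near_le {ρ : ℕ → ℕ} {m D R : ℕ} {x : ℕ → ℕ}
    (hinj : ∀ i i', i < m → i' < m → ρ (x i) = ρ (x i') → i = i') :
    ((Finset.range m).filter fun i => below ρ m x (ρ (x i)) ≤ R + D ∧
      R ≤ below ρ m x (ρ (x i)) + D).card ≤ 2 * D + 1 := by
  have : (Finset.Icc (R - D) (R + D)).card ≤ 2 * D + 1 := by rw [Nat.card_Icc]; omega
  refine (Finset.card_le_card_of_injOn (fun i => below ρ m x (ρ (x i))) ?_ ?_).trans this
  · intro i hi
    simp only [Finset.coe_filter, Finset.mem_range, Set.mem_ofPred_eq] at hi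
    simp only [Finset.coe_Icc, Set.mem_Icc]
    omega
  · intro i hi i' hi' h
    simp only [Finset.coe_filter, Finset.mem_range, Set.mem_ofPred_eq] at hi hi' h
    apply hinj i i' hi.1 hi'.1
    by_contra hne
    rcases lt_or_gt_of_ne hne with hlt | hlt
    · have := below_lt_below (x := x) hi.1 hlt; omega
    · have := below_lt_below (x := x) hi'.1 hlt; omega

/-- Nearness is defined by true ranks, so the pairs in question are a fixed set of at most `2 * 4 *
2 ^ 18 * ell n + 1` independent coordinates, no matter which order the algorithm computes. -/
theorem real_not_fewNear_le (hS : Function.Injective S) (p : unitInterval) {m : ℕ} {x : ℕ → ℕ}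
    (hx : ∀ i, i < m → x i < n) (hinj : ∀ i i', i < m → i' < m → x i = x i' → i = i') {a : ℕ}
    (ha : a < n) :
    (Measure.pi fun _ : Sym2 (Fin n) => bernoulliMeasure true false p).real
      {w | ¬ FewNear (obsNat (observed S w)) (rankNat S) n m x a} ≤
        2 ^ (2 ^ 21 * ell n + 1) * (p : ℝ) ^ (32 * ell n + 1) := by
  set I := (Finset.range m).filter fun i =>
    (below (rankNat S) m x (rankNat S (x i)) ≤
      below (rankNat S) m x (rankNat S a) + 4 * (2 ^ 18 * ell n) ∧
    below (rankNat S) m x (rankNat S a) ≤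
      below (rankNat S) m x (rankNat S (x i)) + 4 * (2 ^ 18 * ell n)) ∧ x i ≠ a with hI
  have hIcard : I.card ≤ 2 ^ 21 * ell n + 1 := by
    have := card_near_le (ρ := rankNat S) (m := m) (D := 4 * (2 ^ 18 * ell n))
      (R := below (rankNat S) m x (rankNat S a)) (x := x)
      (fun i i' hi hi' h => hinj i i' hi hi' (rankNat_inj hS (hx i hi) (hx i' hi') h))
    refine (Finset.card_le_card ?_).trans (this.trans (by ring_nf; rfl))
    intro i hi
    simp only [hI, Finset.mem_filter] at hi ⊢
    exact ⟨hi.1, hi.2.1⟩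
  set M := I.image fun i => pairWith ⟨a, ha⟩ (x i) with hM
  have h1 := pi_real_card_filter_le p M (32 * ell n)
  refine (measureReal_mono ?_ (measure_ne_top _ _)).trans (h1.trans ?_)
  · intro w hw
    rw [Set.mem_ofPred_eq, FewNear, not_le] at hw
    refine hw.trans_le ?_
    refine Finset.card_le_card_of_injOn (fun i => pairWith ⟨a, ha⟩ (x i)) ?_ ?_
    · intro i hi
      simp only [Finset.coe_filter, Finset.mem_range, Set.mem_ofPred_eq] at hi ⊢
      obtain ⟨him, hnear, hne, hwrong⟩ := hi
      refine ⟨Finset.mem_image_of_mem _ ?_, (obsNat_ne_iff ha (hx i him) hne).1 hwrong⟩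
      rw [hI, Finset.mem_filter, Finset.mem_range]
      exact ⟨him, hnear, hne⟩
    · intro i hi i' hi' h
      simp only [Finset.coe_filter, Finset.mem_range, Set.mem_ofPred_eq] at hi hi'
      exact hinj i i' hi.1 hi'.1 (pairWith_inj (hx i hi.1) (hx i' hi'.1) h)
  · have h2 : M.card ≤ 2 ^ 21 * ell n + 1 := Finset.card_image_le.trans hIcard
    have h3 : (0 : ℝ) ≤ (p : ℝ) ^ (32 * ell n + 1) := pow_nonneg p.2.1 _
    gcongr
    norm_num

/-- All pairs without `a` are frozen. As `a` is not in the sparser level, this fixes its order `π`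
and hence the family of patterns; the pairs with `a` are still independent, and a union bound over
the patterns applies. -/
theorem real_not_fewSearch_le (p : unitInterval) (coin : ℕ → Bool) {k : ℕ} (hk : k ≤ Nat.log 2 n)
    {a : ℕ} (ha : a < n)
    (hne : ∀ i, i < n / 2 ^ (Nat.log 2 n - k) → lev coin n (Nat.log 2 n - k) i ≠ a) :
    (Measure.pi fun _ : Sym2 (Fin n) => bernoulliMeasure true false p).real
      {w | ¬ FewSearch (obsNat (observed S w)) (rankNat S) n
        (order (obsNat (observed S w)) coin n k) (n / 2 ^ (Nat.log 2 n - k)) a} ≤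
        2 ^ (64 * ell n) * (p : ℝ) ^ (ell n + 1) := by
  classical
  set m := n / 2 ^ (Nat.log 2 n - k) with hm
  refine pi_real_le_of_piecewise _ (Finset.univ.filter fun e => (⟨a, ha⟩ : Fin n) ∈ e) fun w => ?_
  set π := order (obsNat (observed S w)) coin n k with hπ
  have hπn : ∀ q, q < m → π q < n := fun q hq => order_lt hq
  have hπa : ∀ q, q < m → π q ≠ a := by
    intro q hq
    obtain ⟨i, hi, h⟩ := exists_order_eq (obsNat (observed S w)) coin hq
    rw [hπ, h]
    exact hne i hi
  obtain ⟨𝓔, h1, h2, h3⟩ := exists_patterns (rankNat S) n π m a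
  have h4 := pi_real_exists_le p (𝓔.image fun P => P.image fun q => pairWith ⟨a, ha⟩ (π q))
    (k := ell n + 1) (by
      intro E hE
      obtain ⟨P, hP, rfl⟩ := Finset.mem_image.1 hE
      obtain ⟨h5, h6⟩ := h2 P hP
      rw [Finset.card_image_of_injOn]
      · exact h5
      · intro q hq q' hq' h
        exact order_inj (h6 q hq) (h6 q' hq')
          (pairWith_inj (hπn q (h6 q hq)) (hπn q' (h6 q' hq')) h))
  refine (measureReal_mono ?_ (measure_ne_top _ _)).trans (h4.trans ?_)
  · intro η hη
    set w' := (Finset.univ.filter fun e => (⟨a, ha⟩ : Fin n) ∈ e).piecewise η w with hw'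
    rw [Set.mem_ofPred_eq, Set.mem_ofPred_eq, ← hw'] at hη
    -- Resampling the pairs with `a` does not touch a comparison of two elements of the sparser
    -- level.
    have hord : ∀ q, q < m → order (obsNat (observed S w')) coin n k q = π q := by
      intro q hq
      apply order_congr hk (fun _ _ _ _ => rfl) _ hq
      intro i i' hi hi'
      rw [obsNat, obsNat, dif_pos ⟨lev_lt hi, lev_lt hi'⟩, dif_pos ⟨lev_lt hi, lev_lt hi'⟩,
        observed, observed, hw', Finset.piecewise_eq_of_notMem]
      have e1 := hne i hi
      have e2 := hne i' hi'
      simp only [Finset.mem_filter, Finset.mem_univ, true_and, Sym2.mem_iff, Fin.mk.injEq]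
      omega
    obtain ⟨P, hP, h5⟩ := h3 _ _ hord hη
    refine ⟨_, Finset.mem_image_of_mem _ hP, fun e he => ?_⟩
    obtain ⟨q, hq, rfl⟩ := Finset.mem_image.1 he
    have hqm := (h2 P hP).2 q hq
    have h6 := (obsNat_ne_iff ha (hπn q hqm) (hπa q hqm)).1 (h5 q hq)
    rw [hw', Finset.piecewise_eq_of_mem] at h6
    · exact h6
    · rw [Finset.mem_filter, pairWith, dif_pos (hπn q hqm)]
      simp
  · have h5 : (𝓔.image fun P => P.image fun q => pairWith ⟨a, ha⟩ (π q)).card ≤ 2 ^ (64 * ell n) :=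
      Finset.card_image_le.trans h1
    have h6 : (0 : ℝ) ≤ (p : ℝ) ^ (ell n + 1) := pow_nonneg p.2.1 _
    gcongr
    exact_mod_cast h5

end Comparisons

/-! ## The probability that the samples are not spread evenly -/

section Coins

open MeasureTheory ProbabilityTheory

variable {n : ℕ}

/-- A sequence of coins, from its first `D` members. -/
def extendCoins {D : ℕ} (c : Finset.range D → Bool) (i : ℕ) : Bool :=
  if h : i ∈ Finset.range D then c ⟨i, h⟩ else false

/-- The law of a fair coin. -/
noncomputable def fairCoin : Measure Bool :=
  bernoulliMeasure true false (⟨1 / 2, by norm_num, by norm_num⟩ : unitInterval)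

instance : IsProbabilityMeasure fairCoin :=
  inferInstanceAs (IsProbabilityMeasure (bernoulliMeasure true false _))

/-- The number of pairs `{2 i, 2 i + 1}` that meet a set of indices. -/
theorem card_le_of_pairs {m : ℕ} (P : ℕ → Prop) [DecidablePred P] :
    ((Finset.range m).filter P).card ≤
      2 * ((Finset.range (m / 2)).filter fun i => ∃ b : Bool, P (2 * i + b.toNat)).card + 1 := by
  set T := (Finset.range (m / 2)).filter fun i => ∃ b : Bool, P (2 * i + b.toNat)
  have : (Finset.range m).filter P ⊆
      (T.image (fun i => 2 * i) ∪ T.image fun i => 2 * i + 1) ∪ {2 * (m / 2)} := by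
    intro i hi
    obtain ⟨hi, hP⟩ := Finset.mem_filter.1 hi
    rw [Finset.mem_range] at hi
    simp only [Finset.mem_union, Finset.mem_image, Finset.mem_singleton]
    by_cases h : i / 2 < m / 2
    · left
      rcases Nat.mod_two_eq_zero_or_one i with h0 | h0
      · refine Or.inl ⟨i / 2, ?_, by omega⟩
        rw [Finset.mem_filter, Finset.mem_range]
        refine ⟨h, false, ?_⟩
        rwa [Bool.toNat_false, show 2 * (i / 2) + 0 = i by omega]
      · refine Or.inr ⟨i / 2, ?_, by omega⟩
        rw [Finset.mem_filter, Finset.mem_range]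
        refine ⟨h, true, ?_⟩
        rwa [Bool.toNat_true, show 2 * (i / 2) + 1 = i by omega]
    · right; omega
  refine (Finset.card_le_card this).trans ((Finset.card_union_le _ _).trans ?_)
  have h1 := Finset.card_union_le (T.image fun i => 2 * i) (T.image fun i => 2 * i + 1)
  have h2 := Finset.card_image_le (s := T) (f := fun i => 2 * i)
  have h3 := Finset.card_image_le (s := T) (f := fun i => 2 * i + 1)
  rw [Finset.card_singleton]
  omega

/-- The coins before `coinOff n j` are frozen and fix level `j`. If `2 * K` of its elements lie in
the interval, at least `K` neighbouring pairs meet it, and each of them sends an element of the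
interval to the next level with probability at least `1 / 2`, independently. -/
theorem real_between_lt_le (ρ : ℕ → ℕ) {D j : ℕ} (hD : coinOff n (j + 1) ≤ D) (u v K g : ℕ) :
    (Measure.pi fun _ : Finset.range D => fairCoin).real
      {c | 2 * K ≤ between ρ (n / 2 ^ j) (lev (extendCoins c) n j) u v ∧
        between ρ (n / 2 ^ (j + 1)) (lev (extendCoins c) n (j + 1)) u v < g} ≤
      2 ^ g * (3 / 4) ^ K := by
  classical
  set X : Finset (Finset.range D) := Finset.univ.filter fun e => coinOff n j ≤ e.1 with hX
  refine pi_real_le_of_piecewise _ X fun w => ?_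
  set y := lev (extendCoins w) n j with hy
  have hm : n / 2 ^ (j + 1) = n / 2 ^ j / 2 := by rw [pow_succ, Nat.div_div_eq_div_mul]
  have hoff := coinOff_succ n j
  have hlev : ∀ (η : Finset.range D → Bool) i, i < n / 2 ^ j →
      lev (extendCoins (X.piecewise η w)) n j i = y i := by
    intro η i hi
    apply lev_congr _ hi
    intro c hc
    rw [extendCoins, extendCoins]
    split_ifs with h
    · rw [Finset.piecewise_eq_of_notMem]
      simp only [hX, Finset.mem_filter, Finset.mem_univ, true_and]
      omega
    · rfl
  have hbtw : ∀ η : Finset.range D → Bool,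
      between ρ (n / 2 ^ j) (lev (extendCoins (X.piecewise η w)) n j) u v =
        between ρ (n / 2 ^ j) y u v := by
    intro η
    rw [between, between]
    congr 1
    apply Finset.filter_congr
    intro i hi
    rw [hlev η i (Finset.mem_range.1 hi)]
  by_cases hK : 2 * K ≤ between ρ (n / 2 ^ j) y u v
  swap
  · have : {η | X.piecewise η w ∈ {c : Finset.range D → Bool |
        2 * K ≤ between ρ (n / 2 ^ j) (lev (extendCoins c) n j) u v ∧
        between ρ (n / 2 ^ (j + 1)) (lev (extendCoins c) n (j + 1)) u v < g}} = ∅ := by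
      ext η
      simp only [Set.mem_ofPred_eq, hbtw, hK, false_and, Set.mem_empty_iff_false]
    rw [this, measureReal_empty]
    positivity
  let P : ℕ → Prop := fun i => u ≤ ρ (y i) ∧ ρ (y i) < v
  let f : Finset.range D → Bool → Prop := fun e b => P (2 * (e.1 - coinOff n j) + b.toNat)
  set T : Finset (Finset.range D) := Finset.univ.filter fun e =>
    (coinOff n j ≤ e.1 ∧ e.1 < coinOff n (j + 1)) ∧ ∃ b, f e b with hT
  have hTK : K ≤ T.card := by
    have h1 := card_le_of_pairs (m := n / 2 ^ j) P
    have h2 : between ρ (n / 2 ^ j) y u v = ((Finset.range (n / 2 ^ j)).filter P).card := rfl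
    have h3 : ((Finset.range (n / 2 ^ j / 2)).filter fun i =>
        ∃ b : Bool, P (2 * i + b.toNat)).card ≤ (T.image fun e => e.1 - coinOff n j).card := by
      apply Finset.card_le_card
      intro i hi
      obtain ⟨hi, b, hb⟩ := Finset.mem_filter.1 hi
      rw [Finset.mem_range, ← hm] at hi
      have hiD : coinOff n j + i ∈ Finset.range D := by rw [Finset.mem_range]; omega
      refine Finset.mem_image.2 ⟨⟨coinOff n j + i, hiD⟩, ?_, by simp⟩
      rw [hT, Finset.mem_filter]
      refine ⟨Finset.mem_univ _, ⟨by simp, by simp only; omega⟩, b, ?_⟩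
      simp only [f, Nat.add_sub_cancel_left]
      exact hb
    have h4 := Finset.card_image_le (s := T) (f := fun e => e.1 - coinOff n j)
    omega
  have key := pi_real_card_lt_le f T (fun e he => (Finset.mem_filter.1 he).2.2) g
  refine (measureReal_mono ?_ (measure_ne_top _ _)).trans (key.trans ?_)
  · intro η hη
    refine lt_of_le_of_lt ?_ hη.2
    refine Finset.card_le_card_of_injOn (fun e => e.1 - coinOff n j) ?_ ?_
    · intro e he
      obtain ⟨he, hfe⟩ := Finset.mem_filter.1 he
      obtain ⟨-, ⟨h1, h2⟩, -⟩ := Finset.mem_filter.1 he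
      have h3 : e.1 - coinOff n j < n / 2 ^ (j + 1) := by omega
      rw [Finset.mem_coe, Finset.mem_filter, Finset.mem_range]
      refine ⟨h3, ?_⟩
      have h4 : extendCoins (X.piecewise η w) (coinOff n j + (e.1 - coinOff n j)) = η e := by
        rw [Nat.add_sub_cancel' h1, extendCoins, dif_pos e.2, Finset.piecewise_eq_of_mem]
        simpa [hX] using h1
      have h5 := Bool.toNat_le (η e)
      have h6 : 2 * (e.1 - coinOff n j) + (η e).toNat < n / 2 ^ j := by
        rw [hm] at h3
        generalize n / 2 ^ j = M at h3 ⊢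
        omega
      beta_reduce
      rw [lev, h4, hlev η _ h6]
      exact hfe
    · intro e he e' he' h
      obtain ⟨he, -⟩ := Finset.mem_filter.1 he
      obtain ⟨-, ⟨h1, -⟩, -⟩ := Finset.mem_filter.1 he
      obtain ⟨he', -⟩ := Finset.mem_filter.1 he'
      obtain ⟨-, ⟨h2, -⟩, -⟩ := Finset.mem_filter.1 he'
      apply Subtype.ext
      simp only at h
      omega
  · gcongr ?_ * ?_
    exact pow_le_pow_of_le_one (by norm_num) (by norm_num) hTK

/-- Ranks are below `N`, so the ends of an interval may be capped; only finitely many intervals then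
remain in the union bound for `Spread`. -/
theorem between_min {ρ : ℕ → ℕ} {m N : ℕ} {x : ℕ → ℕ} (h : ∀ i, i < m → ρ (x i) < N) (u v : ℕ) :
    between ρ m x (min u N) (min v N) = between ρ m x u v := by
  rw [between, between]
  congr 1
  apply Finset.filter_congr
  intro i hi
  have := h i (Finset.mem_range.1 hi)
  omega

theorem real_not_spread_le {ρ : ℕ → ℕ} (hρ : ∀ a, a < n → ρ a < n) {D j : ℕ}
    (hD : coinOff n (j + 1) ≤ D) :
    (Measure.pi fun _ : Finset.range D => fairCoin).real {c | ¬ Spread ρ (extendCoins c) n j} ≤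
      (n + 1) ^ 2 * (2 ^ (10752 * ell n + 1) * (3 / 4) ^ (2 ^ 17 * ell n)) := by
  have hsub : {c : Finset.range D → Bool | ¬ Spread ρ (extendCoins c) n j} ⊆
      ⋃ z ∈ Finset.range (n + 1) ×ˢ Finset.range (n + 1), {c |
        2 * (2 ^ 17 * ell n) ≤ between ρ (n / 2 ^ j) (lev (extendCoins c) n j) z.1 z.2 ∧
        between ρ (n / 2 ^ (j + 1)) (lev (extendCoins c) n (j + 1)) z.1 z.2 <
          10752 * ell n + 1} := by
    intro c hc
    rw [Set.mem_ofPred_eq, Spread] at hc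
    push Not at hc
    obtain ⟨u, v, h1, h2⟩ := hc
    rw [Set.mem_iUnion₂]
    refine ⟨(min u n, min v n), ?_, ?_⟩
    · simp only [Finset.mem_product, Finset.mem_range]
      omega
    · rw [Set.mem_ofPred_eq, between_min (x := lev (extendCoins c) n j) fun i hi => hρ _ (lev_lt hi),
        between_min (x := lev (extendCoins c) n (j + 1)) fun i hi => hρ _ (lev_lt hi)]
      omega
  refine (measureReal_mono hsub (measure_ne_top _ _)).trans
    ((measureReal_biUnion_finset_le _ _).trans ?_)
  refine (Finset.sum_le_card_nsmul _ _ _ fun z _ => real_between_lt_le ρ hD z.1 z.2 _ _).trans ?_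
  rw [Finset.card_product, Finset.card_range, nsmul_eq_mul]
  push_cast
  rw [sq]

end Coins

/-! ## The probability of success -/

section SuccessProbability

open MeasureTheory ProbabilityTheory

variable {n : ℕ} {α : Type*} [LinearOrder α] {S : Fin n → α}

/-- The comparison errors and coin tosses are such that the order of the approximate sorting
algorithm is close to the true order. -/
structure Favourable (S : Fin n → α) (w : Sym2 (Fin n) → Bool) (coin : ℕ → Bool) : Prop where
  spread : ∀ j, j < Nat.log 2 n → Spread (rankNat S) coin n j
  near : ∀ j i, j < Nat.log 2 n → i < n / 2 ^ j → FewNear (obsNat (observed S w)) (rankNat S) n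
    (n / 2 ^ j) (lev coin n j) (lev coin n j i)
  search : ∀ k i, k < Nat.log 2 n → i < n / 2 ^ (Nat.log 2 n - (k + 1)) →
    (∀ i', i' < n / 2 ^ (Nat.log 2 n - k) →
      lev coin n (Nat.log 2 n - k) i' ≠ lev coin n (Nat.log 2 n - (k + 1)) i) →
    FewSearch (obsNat (observed S w)) (rankNat S) n (order (obsNat (observed S w)) coin n k)
      (n / 2 ^ (Nat.log 2 n - k)) (lev coin n (Nat.log 2 n - (k + 1)) i)

theorem real_iUnion_range_le {Ω : Type*} [MeasurableSpace Ω] (μ : Measure Ω)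
    [IsFiniteMeasure μ] {N : ℕ} {B : ℕ → Set Ω} {δ : ℝ} (h : ∀ j, j < N → μ.real (B j) ≤ δ) :
    μ.real {ω | ∃ j, j < N ∧ ω ∈ B j} ≤ N * δ := by
  have : {ω | ∃ j, j < N ∧ ω ∈ B j} = ⋃ j ∈ Finset.range N, B j := by
    ext ω; simp
  rw [this]
  refine (measureReal_biUnion_finset_le _ _).trans ?_
  refine (Finset.sum_le_card_nsmul _ _ δ fun j hj => h j (Finset.mem_range.1 hj)).trans ?_
  simp

theorem two_pow_mul_half_pow_le {a b c : ℕ} (h : a + c ≤ b) :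
    (2 : ℝ) ^ a * (1 / 2) ^ b ≤ (1 / 2) ^ c := by
  have h1 : (2 : ℝ) ^ a * (1 / 2) ^ a = 1 := by rw [← mul_pow]; norm_num
  calc (2 : ℝ) ^ a * (1 / 2) ^ b ≤ 2 ^ a * (1 / 2) ^ (a + c) := by
        gcongr ?_ * ?_
        exact pow_le_pow_of_le_one (by norm_num) (by norm_num) h
    _ = (1 / 2) ^ c := by rw [pow_add, ← mul_assoc, h1, one_mul]

theorem log_le_two_pow_ell (n : ℕ) : Nat.log 2 n ≤ 2 ^ ell n :=
  (Nat.le_succ _).trans Nat.lt_two_pow_self.le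

theorem real_exists_not_spread_le (S : Fin n → α) :
    (Measure.pi fun _ : Finset.range (coinOff n (Nat.log 2 n)) => fairCoin).real
      {c | ∃ j, j < Nat.log 2 n ∧ ¬ Spread (rankNat S) (extendCoins c) n j} ≤
        (1 / 2) ^ (3 * ell n) := by
  refine (real_iUnion_range_le _ fun j hj => real_not_spread_le (ρ := rankNat S)
    (fun a ha => rankNat_lt ha) (coinOff_mono n hj)).trans ?_
  have h1 : ((Nat.log 2 n : ℕ) : ℝ) ≤ 2 ^ ell n := by exact_mod_cast log_le_two_pow_ell n
  have h2 : (n : ℝ) + 1 ≤ 2 ^ ell n := by exact_mod_cast lt_two_pow_ell n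
  -- From `(3 / 4) ^ 4 ≤ 1 / 2`. The exponent `2 ^ 15 = 32768` exceeds `10752` with ample room for
  -- the union bounds.
  have h3 : (3 / 4 : ℝ) ^ (2 ^ 17 * ell n) ≤ (1 / 2) ^ (2 ^ 15 * ell n) := by
    rw [show 2 ^ 17 * ell n = 4 * (2 ^ 15 * ell n) by ring, pow_mul (3 / 4 : ℝ) 4]
    exact pow_le_pow_left₀ (by norm_num) (by norm_num) _
  calc (Nat.log 2 n : ℝ) * ((n + 1) ^ 2 * (2 ^ (10752 * ell n + 1) * (3 / 4) ^ (2 ^ 17 * ell n)))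
      ≤ 2 ^ ell n * ((2 ^ ell n) ^ 2 * (2 ^ (10752 * ell n + 1) * (1 / 2) ^ (2 ^ 15 * ell n))) := by
        gcongr
    _ = 2 ^ (ell n + ell n * 2 + (10752 * ell n + 1)) * (1 / 2) ^ (2 ^ 15 * ell n) := by
        rw [pow_add, pow_add, ← pow_mul]; ring
    _ ≤ _ := two_pow_mul_half_pow_le (by have := ell_pos n; omega)

variable {p : unitInterval}

theorem pow_error_le {E : ℕ} (hp : (p : ℝ) ≤ (1 / 2) ^ E) (k : ℕ) :
    (p : ℝ) ^ k ≤ (1 / 2) ^ (E * k) := by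
  rw [pow_mul]
  exact pow_le_pow_left₀ p.2.1 hp k

theorem real_exists_not_fewNear_le (hS : Function.Injective S) {E : ℕ} (hE : 2 ^ 17 ≤ E) (hp : (p : ℝ) ≤ (1 / 2) ^ E)
    (coin : ℕ → Bool) :
    (Measure.pi fun _ : Sym2 (Fin n) => bernoulliMeasure true false p).real
      {w | ∃ j, j < Nat.log 2 n ∧ ∃ i, i < n / 2 ^ j ∧ ¬ FewNear (obsNat (observed S w))
        (rankNat S) n (n / 2 ^ j) (lev coin n j) (lev coin n j i)} ≤ (1 / 2) ^ (3 * ell n) := by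
  have h1 : ((Nat.log 2 n : ℕ) : ℝ) ≤ 2 ^ ell n := by exact_mod_cast log_le_two_pow_ell n
  have h2 : (n : ℝ) ≤ 2 ^ ell n := by exact_mod_cast (lt_two_pow_ell n).le
  have h3 := pow_error_le hp (32 * ell n + 1)
  have h4 : (0 : ℝ) ≤ (p : ℝ) ^ (32 * ell n + 1) := pow_nonneg p.2.1 _
  refine (real_iUnion_range_le _ (δ := n * (2 ^ (2 ^ 21 * ell n + 1) * (p : ℝ) ^ (32 * ell n + 1)))
    (B := fun j => {w | ∃ i, i < n / 2 ^ j ∧ ¬ FewNear (obsNat (observed S w))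
        (rankNat S) n (n / 2 ^ j) (lev coin n j) (lev coin n j i)}) fun j hj => ?_).trans ?_
  · refine (real_iUnion_range_le _ fun i hi => real_not_fewNear_le hS p (fun i hi => lev_lt hi)
      (fun i i' _ _ h => lev_inj h) (lev_lt hi)).trans ?_
    gcongr
    exact_mod_cast Nat.div_le_self _ _
  calc (Nat.log 2 n : ℝ) * (n * (2 ^ (2 ^ 21 * ell n + 1) * (p : ℝ) ^ (32 * ell n + 1)))
      ≤ 2 ^ ell n * (2 ^ ell n * (2 ^ (2 ^ 21 * ell n + 1) *
        (1 / 2) ^ (E * (32 * ell n + 1)))) := by gcongr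
    _ = 2 ^ (ell n + ell n + (2 ^ 21 * ell n + 1)) * (1 / 2) ^ (E * (32 * ell n + 1)) := by
        rw [pow_add, pow_add]; ring
    -- Here `E * 32 ≥ 2 ^ 22` outweighs the `2 ^ 21` of the choice of a set of wrong pairs.
    _ ≤ _ := two_pow_mul_half_pow_le (by
        have := Nat.mul_le_mul_right (32 * ell n + 1) hE
        have := ell_pos n
        omega)

theorem real_exists_not_fewSearch_le (S : Fin n → α) {E : ℕ} (hE : 2 ^ 17 ≤ E) (hp : (p : ℝ) ≤ (1 / 2) ^ E)
    (coin : ℕ → Bool) :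
    (Measure.pi fun _ : Sym2 (Fin n) => bernoulliMeasure true false p).real
      {w | ∃ k, k < Nat.log 2 n ∧ ∃ i, i < n / 2 ^ (Nat.log 2 n - (k + 1)) ∧
        (∀ i', i' < n / 2 ^ (Nat.log 2 n - k) →
          lev coin n (Nat.log 2 n - k) i' ≠ lev coin n (Nat.log 2 n - (k + 1)) i) ∧
        ¬ FewSearch (obsNat (observed S w)) (rankNat S) n (order (obsNat (observed S w)) coin n k)
          (n / 2 ^ (Nat.log 2 n - k)) (lev coin n (Nat.log 2 n - (k + 1)) i)} ≤
        (1 / 2) ^ (3 * ell n) := by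
  have h1 : ((Nat.log 2 n : ℕ) : ℝ) ≤ 2 ^ ell n := by exact_mod_cast log_le_two_pow_ell n
  have h2 : (n : ℝ) ≤ 2 ^ ell n := by exact_mod_cast (lt_two_pow_ell n).le
  have h3 := pow_error_le hp (ell n + 1)
  have h4 : (0 : ℝ) ≤ (p : ℝ) ^ (ell n + 1) := pow_nonneg p.2.1 _
  refine (real_iUnion_range_le _ (δ := n * (2 ^ (64 * ell n) * (p : ℝ) ^ (ell n + 1)))
    (B := fun k => {w | ∃ i, i < n / 2 ^ (Nat.log 2 n - (k + 1)) ∧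
        (∀ i', i' < n / 2 ^ (Nat.log 2 n - k) →
          lev coin n (Nat.log 2 n - k) i' ≠ lev coin n (Nat.log 2 n - (k + 1)) i) ∧
        ¬ FewSearch (obsNat (observed S w)) (rankNat S) n (order (obsNat (observed S w)) coin n k)
          (n / 2 ^ (Nat.log 2 n - k)) (lev coin n (Nat.log 2 n - (k + 1)) i)})
    fun k hk => ?_).trans ?_
  · refine (real_iUnion_range_le _ (δ := 2 ^ (64 * ell n) * (p : ℝ) ^ (ell n + 1))
      (B := fun i => {w | (∀ i', i' < n / 2 ^ (Nat.log 2 n - k) →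
          lev coin n (Nat.log 2 n - k) i' ≠ lev coin n (Nat.log 2 n - (k + 1)) i) ∧
        ¬ FewSearch (obsNat (observed S w)) (rankNat S) n (order (obsNat (observed S w)) coin n k)
          (n / 2 ^ (Nat.log 2 n - k)) (lev coin n (Nat.log 2 n - (k + 1)) i)})
      fun i hi => ?_).trans ?_
    -- Membership in the sparser level depends on the coins only; for its members the event is
    -- empty.
    · by_cases hne : ∀ i', i' < n / 2 ^ (Nat.log 2 n - k) →
          lev coin n (Nat.log 2 n - k) i' ≠ lev coin n (Nat.log 2 n - (k + 1)) i
      · exact (measureReal_mono (fun w hw => hw.2) (measure_ne_top _ _)).trans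
          (real_not_fewSearch_le p coin hk.le (lev_lt hi) hne)
      · refine (measureReal_mono (s₂ := ∅) (fun w hw => hne hw.1) (measure_ne_top _ _)).trans ?_
        rw [measureReal_empty]
        positivity
    · gcongr
      exact_mod_cast Nat.div_le_self _ _
  calc (Nat.log 2 n : ℝ) * (n * (2 ^ (64 * ell n) * (p : ℝ) ^ (ell n + 1)))
      ≤ 2 ^ ell n * (2 ^ ell n * (2 ^ (64 * ell n) *
        (1 / 2) ^ (E * (ell n + 1)))) := by gcongr
    _ = 2 ^ (ell n + ell n + 64 * ell n) * (1 / 2) ^ (E * (ell n + 1)) := by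
        rw [pow_add, pow_add]; ring
    _ ≤ _ := two_pow_mul_half_pow_le (by
        have := Nat.mul_le_mul_right (ell n + 1) hE
        have := ell_pos n
        omega)

/-- The coins that are tossed. -/
def usedCoins (n : ℕ) (coin : ℕ → Bool) : ℕ → Bool :=
  extendCoins ((Finset.range (coinOff n (Nat.log 2 n))).restrict coin)

/-- Only finitely many coins matter, so the law is projected to a finite product, where every set is
measurable. Failure is covered by three events; the last two are bounded for each fixed sequence of
coins. -/
theorem sampleLaw_favourable (hn : 0 < n) (hS : Function.Injective S)
    {E : ℕ} (hE : 2 ^ 17 ≤ E) (hp : (p : ℝ) ≤ (1 / 2) ^ E) :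
    1 - 1 / (n : ℝ) ≤ (sampleLaw n p).real
      {ω : Sample n | Favourable S ω.1 (usedCoins n ω.2)} := by
  set D := coinOff n (Nat.log 2 n)
  set μ := Measure.pi fun _ : Sym2 (Fin n) => bernoulliMeasure true false p with hμ
  set ν := Measure.pi fun _ : Finset.range D => fairCoin with hν
  have hmap : (sampleLaw n p).map (Prod.map id (Finset.range D).restrict) = μ.prod ν := by
    rw [sampleLaw, ← Measure.map_prod_map _ _ measurable_id (Finset.measurable_restrict _),
      Measure.map_id, Measure.infinitePi_map_restrict]
    rfl
  have hmeas : Measurable (Prod.map id (Finset.range D).restrict :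
      Sample n → (Sym2 (Fin n) → Bool) × (Finset.range D → Bool)) :=
    measurable_id.prodMap (Finset.measurable_restrict _)
  set G := {z : (Sym2 (Fin n) → Bool) × (Finset.range D → Bool) |
    Favourable S z.1 (extendCoins z.2)} with hG
  have h1 : (sampleLaw n p).real {ω : Sample n | Favourable S ω.1 (usedCoins n ω.2)} =
      (μ.prod ν).real G := by
    rw [← hmap, measureReal_def, measureReal_def, Measure.map_apply hmeas MeasurableSet.of_discrete]
    rfl
  set B₁ := {c : Finset.range D → Bool |
    ∃ j, j < Nat.log 2 n ∧ ¬ Spread (rankNat S) (extendCoins c) n j}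
  set B₂ := {z : (Sym2 (Fin n) → Bool) × (Finset.range D → Bool) |
    ∃ j, j < Nat.log 2 n ∧ ∃ i, i < n / 2 ^ j ∧ ¬ FewNear (obsNat (observed S z.1))
      (rankNat S) n (n / 2 ^ j) (lev (extendCoins z.2) n j) (lev (extendCoins z.2) n j i)}
  set B₃ := {z : (Sym2 (Fin n) → Bool) × (Finset.range D → Bool) |
    ∃ k, k < Nat.log 2 n ∧ ∃ i, i < n / 2 ^ (Nat.log 2 n - (k + 1)) ∧
      (∀ i', i' < n / 2 ^ (Nat.log 2 n - k) → lev (extendCoins z.2) n (Nat.log 2 n - k) i' ≠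
        lev (extendCoins z.2) n (Nat.log 2 n - (k + 1)) i) ∧
      ¬ FewSearch (obsNat (observed S z.1)) (rankNat S) n
        (order (obsNat (observed S z.1)) (extendCoins z.2) n k)
        (n / 2 ^ (Nat.log 2 n - k)) (lev (extendCoins z.2) n (Nat.log 2 n - (k + 1)) i)}
  have hb₁ : (μ.prod ν).real (Set.univ ×ˢ B₁) ≤ (1 / 2) ^ (3 * ell n) := by
    rw [measureReal_prod_prod, probReal_univ, one_mul]
    exact real_exists_not_spread_le S
  have hb₂ : (μ.prod ν).real B₂ ≤ (1 / 2) ^ (3 * ell n) :=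
    prod_real_le _ _ MeasurableSet.of_discrete fun c =>
      real_exists_not_fewNear_le hS hE hp (extendCoins c)
  have hb₃ : (μ.prod ν).real B₃ ≤ (1 / 2) ^ (3 * ell n) :=
    prod_real_le _ _ MeasurableSet.of_discrete fun c =>
      real_exists_not_fewSearch_le S hE hp (extendCoins c)
  have hcover : Gᶜ ⊆ (Set.univ ×ˢ B₁ ∪ B₂) ∪ B₃ := by
    rintro ⟨w, c⟩ hz
    by_contra hcon
    simp only [Set.mem_union, not_or] at hcon
    obtain ⟨⟨hc₁, hc₂⟩, hc₃⟩ := hcon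
    refine hz ⟨?_, ?_, ?_⟩
    · intro j hj
      by_contra h
      exact hc₁ ⟨Set.mem_univ _, j, hj, h⟩
    · intro j i hj hi
      by_contra h
      exact hc₂ ⟨j, hj, i, hi, h⟩
    · intro k i hk hi hne
      by_contra h
      exact hc₃ ⟨k, hk, i, hi, hne, h⟩
  have h2 : (μ.prod ν).real Gᶜ ≤ 3 * (1 / 2) ^ (3 * ell n) := by
    refine (measureReal_mono hcover (measure_ne_top _ _)).trans ?_
    have := measureReal_union_le (μ := μ.prod ν) (Set.univ ×ˢ B₁ ∪ B₂) B₃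
    have := measureReal_union_le (μ := μ.prod ν) (Set.univ ×ˢ B₁) B₂
    linarith
  -- As `n ≤ 2 ^ ell n`, the product with `n` is at most `2 ^ 2 * 2 ^ (-2 * ell n) ≤ 1`.
  have h3 : (3 : ℝ) * (1 / 2) ^ (3 * ell n) ≤ 1 / n := by
    have hn' : (0 : ℝ) < n := by exact_mod_cast hn
    have h4 : (n : ℝ) ≤ 2 ^ ell n := by exact_mod_cast (lt_two_pow_ell n).le
    rw [le_div_iff₀ hn']
    have h5 := ell_pos n
    have h6 := two_pow_mul_half_pow_le (a := ell n + 2) (b := 3 * ell n) (c := 0) (by omega)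
    rw [pow_zero, pow_add] at h6
    calc (3 : ℝ) * (1 / 2) ^ (3 * ell n) * n ≤ 2 ^ 2 * (1 / 2) ^ (3 * ell n) * 2 ^ ell n := by
          gcongr; norm_num
      _ = 2 ^ ell n * 2 ^ 2 * (1 / 2) ^ (3 * ell n) := by ring
      _ ≤ 1 := h6
  rw [h1]
  have h4 := probReal_compl_eq_one_sub (μ := μ.prod ν) (s := G) MeasurableSet.of_discrete
  linarith

end SuccessProbability

/-! ## The theorem -/

section Main

variable {n : ℕ} {α : Type*} [LinearOrder α] {S : Fin n → α}

/-- The order of the elements that the approximate sorting algorithm finds. -/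
noncomputable def apxOrder (obs : Fin n → Fin n → Bool) (coin : ℕ → Bool) : Equiv.Perm (Fin n) :=
  Equiv.ofBijective (fun q => ⟨order (obsNat obs) coin n (Nat.log 2 n) q,
      order_lt (by rw [Nat.sub_self, pow_zero, Nat.div_one]; exact q.2)⟩) <| by
    refine Finite.injective_iff_bijective.1 fun q q' h => Fin.ext ?_
    simp only [Fin.mk.injEq] at h
    exact order_inj (by rw [Nat.sub_self, pow_zero, Nat.div_one]; exact q.2)
      (by rw [Nat.sub_self, pow_zero, Nat.div_one]; exact q'.2) h

theorem apxOrder_apply (obs : Fin n → Fin n → Bool) (coin : ℕ → Bool) (q : Fin n) :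
    (apxOrder obs coin q : ℕ) = order (obsNat obs) coin n (Nat.log 2 n) q := rfl

theorem maxDislocation_apxOrder_le (hS : Function.Injective S) {w : Sym2 (Fin n) → Bool}
    {coin : ℕ → Bool} (h : Favourable S w (usedCoins n coin)) :
    maxDislocation S (apxOrder (observed S w) coin) ≤ 64 * ell n := by
  have hclose := order_close (obsNat_observed_self w) (fun a b ha hb => rankNat_inj hS ha hb)
    h.spread h.near h.search le_rfl
  rw [Nat.sub_self, pow_zero, Nat.div_one] at hclose
  -- The levels read only coins before `coinOff n (Nat.log 2 n)`, so truncating the sequence of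
  -- coins does not change the order.
  have hord : ∀ q, q < n →
      order (obsNat (observed S w)) (usedCoins n coin) n (Nat.log 2 n) q =
        order (obsNat (observed S w)) coin n (Nat.log 2 n) q := by
    intro q hq
    refine order_congr le_rfl (fun j i hj hi => lev_congr (fun c hc => ?_) hi)
      (fun _ _ _ _ => rfl) (by rwa [Nat.sub_self, pow_zero, Nat.div_one])
    have : c ∈ Finset.range (coinOff n (Nat.log 2 n)) :=
      Finset.mem_range.2 (hc.trans_le (coinOff_mono n hj))
    rw [usedCoins, extendCoins, dif_pos this, Finset.restrict]
  set σ := apxOrder (observed S w) coin with hσ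
  have hσo : ∀ q : Fin n, order (obsNat (observed S w)) (usedCoins n coin) n (Nat.log 2 n) q =
      (σ q : ℕ) := fun q => hord q q.2
  have hbelow : ∀ i : Fin n, below (rankNat S) n
      (order (obsNat (observed S w)) (usedCoins n coin) n (Nat.log 2 n)) (rankNat S i) =
        rank S i := by
    intro i
    rw [below_perm (x := id) (fun _ _ _ _ h => h) (fun i hi =>
      ⟨σ.symm ⟨i, hi⟩, (σ.symm ⟨i, hi⟩).2, by rw [hσo]; simp⟩), below, rank]
    refine Finset.card_bij' (fun a _ => if h : a < n then (⟨a, h⟩ : Fin n) else i)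
      (fun b _ => (b : ℕ)) ?_ ?_ ?_ ?_
    · intro a ha
      simp only [Finset.mem_filter, Finset.mem_range, id] at ha
      have h2 := ha.2
      rw [rankNat, rankNat, dif_pos ha.1, dif_pos i.2, rank_lt_rank_iff] at h2
      rw [dif_pos ha.1, Finset.mem_filter]
      exact ⟨Finset.mem_univ _, h2⟩
    · intro b hb
      simp only [Finset.mem_filter, Finset.mem_univ, true_and] at hb
      simp only [Finset.mem_filter, Finset.mem_range, id]
      refine ⟨b.2, ?_⟩
      rw [rankNat, rankNat, dif_pos b.2, dif_pos i.2]
      exact rank_lt_rank hb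
    · intro a ha
      simp only [Finset.mem_filter, Finset.mem_range] at ha
      rw [dif_pos ha.1]
    · intro b _
      rw [dif_pos b.2]
  rw [maxDislocation]
  refine Finset.sup_le fun i _ => ?_
  have h1 := hclose (σ.symm i) (σ.symm i).2
  rw [hσo, Equiv.apply_symm_apply, hbelow] at h1
  omega

/-- Since `2 ^ ell n ≤ 2 * n ≤ n ^ 2` and `2 ≤ n`, the constant factors too are absorbed by a power
of `n`. -/
theorem word_bounds (hn : 2 ≤ n) :
    2 ^ 30 * (2 ^ ell n) ^ 3 ≤ n ^ 80 ∧ 2 ^ (40 * ell n) ≤ n ^ 80 := by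
  have h1 : 2 ^ ell n ≤ n ^ 2 := by
    rw [ell, pow_succ, sq]
    exact Nat.mul_le_mul (Nat.pow_log_le_self 2 (by omega)) hn
  constructor
  · calc 2 ^ 30 * (2 ^ ell n) ^ 3 ≤ n ^ 30 * (n ^ 2) ^ 3 :=
        Nat.mul_le_mul (Nat.pow_le_pow_left hn 30) (Nat.pow_le_pow_left h1 3)
      _ = n ^ 36 := by ring
      _ ≤ n ^ 80 := Nat.pow_le_pow_right (by omega) (by norm_num)
  · rw [mul_comm, pow_mul]
    calc (2 ^ ell n) ^ 40 ≤ (n ^ 2) ^ 40 := Nat.pow_le_pow_left h1 40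
      _ = n ^ 80 := by rw [← pow_mul]

theorem runs_approximationAlgorithm_approxSort (hn : 2 ≤ n) (obs : Fin n → Fin n → Bool)
    (coin : ℕ → Bool) :
    ∃ l s t, Exec n obs coin (n ^ 80) (approximationAlgorithm approxSort 128) State.init s t ∧
      (t : ℝ) ≤ (2 ^ 31 : ℕ) * (n * Real.logb 2 n) ∧ HoldsApx s (apxOrder obs coin) ∧
      Returns s l ∧ IsLongestDistantSubseq (apxOrder obs coin) (2 * (128 * Nat.log 2 n)) l := by
  obtain ⟨hX, hW⟩ := word_bounds hn
  have h1 : 2 ^ ell n ≤ (2 ^ ell n) ^ 3 := Nat.le_self_pow (by norm_num) _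
  have h2 := lt_two_pow_ell n
  have h3 := log_le_two_pow_ell n
  have hlog := Nat.log_pos (b := 2) (by norm_num) hn
  have hsort : Runs n obs coin (n ^ 80) approxSort State.init fun s t =>
      t ≤ 2 ^ 29 * (n * ell n) ∧ HoldsApx s (apxOrder obs coin) :=
    (runs_approxSort hn hX hW).mono fun s t h => ⟨h.1, fun q => by
      rw [apxOrder_apply]; exact h.2 q q.2⟩
  obtain ⟨s, t, hexec, ht, hσ, l, hl, hlong⟩ := runs_approximationAlgorithm (c := 128) hsort hn
    (by norm_num) (by omega) (by omega)
  refine ⟨l, s, t, hexec, ?_, hσ, hl, hlong⟩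
  have h4 : t ≤ 2 ^ 31 * (n * Nat.log 2 n) := by
    have h5 : n * 1 ≤ n * Nat.log 2 n := Nat.mul_le_mul_left _ hlog
    rw [ell, mul_add] at ht
    omega
  have h6 : ((Nat.log 2 n : ℕ) : ℝ) ≤ Real.logb 2 n := Real.natLog_le_logb n 2
  calc (t : ℝ) ≤ ((2 ^ 31 * (n * Nat.log 2 n) : ℕ) : ℝ) := by exact_mod_cast h4
    _ = (2 ^ 31 : ℕ) * (n * (Nat.log 2 n : ℕ)) := by push_cast; ring
    _ ≤ _ := by gcongr

instance (n : ℕ) (p : unitInterval) : MeasureTheory.IsProbabilityMeasure (sampleLaw n p) := by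
  rw [sampleLaw]
  infer_instance

end Main

end NoisyLIS


open NoisyLIS in
theorem theorem1 :
    ∃ p₀ : ℝ, 0 < p₀ ∧ p₀ < 1 / 2 ∧
    ∀ p : unitInterval, (p : ℝ) ≤ p₀ →
    ∃ (sort : Program) (c C w : ℕ), 0 < c ∧
    ∀ n : ℕ, 2 ≤ n →
    ∀ (α : Type*) [LinearOrder α] (S : Fin n → α), Function.Injective S →
    ∃ (apx : Sample n → Equiv.Perm (Fin n)) (out : Sample n → List (Fin n)),
      (∀ ω : Sample n, ∃ (s : State) (t : ℕ),
        Exec n (observed S ω.1) ω.2 (n ^ w) (approximationAlgorithm sort c) State.init s t ∧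
        (t : ℝ) ≤ C * (n * Real.logb 2 n) ∧
        HoldsApx s (apx ω) ∧
        Returns s (out ω) ∧
        IsLongestDistantSubseq (apx ω) (2 * (c * Nat.log 2 n)) (out ω)) ∧
      1 - 1 / (n : ℝ) ≤ (sampleLaw n p).real {ω : Sample n |
        maxDislocation S (apx ω) ≤ c * Nat.log 2 n ∧
        IsIncreasingSubseq S (out ω) ∧
        (lisLength S : ℝ) / (2 * (c * Nat.log 2 n : ℕ)) ≤ (out ω).length ∧
        (lisLength S : ℝ) / (C * Real.logb 2 n) ≤ (out ω).length} := by
  -- The exponent is kept abstract; only its lower bound is used, and `(1 / 2) ^ (2 ^ 17)` is never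
  -- evaluated.
  obtain ⟨E, hE⟩ : ∃ E : ℕ, 2 ^ 17 ≤ E := ⟨_, le_rfl⟩
  refine ⟨(1 / 2) ^ E, by positivity, ?_, fun p hp => ⟨approxSort, 128, 2 ^ 31, 80, by norm_num,
    fun n hn α _ S hS => ?_⟩⟩
  · calc (1 / 2 : ℝ) ^ E ≤ (1 / 2) ^ 2 :=
          pow_le_pow_of_le_one (by norm_num) (by norm_num) (le_trans (by norm_num) hE)
      _ < 1 / 2 := by norm_num
  choose out hout using fun ω : Sample n =>
    runs_approximationAlgorithm_approxSort hn (observed S ω.1) ω.2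
  refine ⟨fun ω => apxOrder (observed S ω.1) ω.2, out, hout, ?_⟩
  refine (sampleLaw_favourable (by omega) hS hE hp).trans
    (MeasureTheory.measureReal_mono ?_ (MeasureTheory.measure_ne_top _ _))
  intro ω hω
  obtain ⟨s, t, -, -, -, -, hlong⟩ := hout ω
  have hlog := Nat.log_pos (b := 2) (by norm_num) hn
  have hd : maxDislocation S (apxOrder (observed S ω.1) ω.2) ≤ 128 * Nat.log 2 n := by
    refine (maxDislocation_apxOrder_le hS hω).trans ?_
    -- The value `c = 128` comes from `64 * (Nat.log 2 n + 1) ≤ 128 * Nat.log 2 n`, as the logarithm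
    -- is at least `1`.
    rw [ell]
    omega
  have hlis := lisLength_le_of_isLongest hS (by omega) hd hlong
  have hlisR : (lisLength S : ℝ) ≤ 2 * (128 * Nat.log 2 n : ℕ) * (out ω).length := by
    exact_mod_cast hlis
  have hlogR : (1 : ℝ) ≤ (Nat.log 2 n : ℕ) := by exact_mod_cast hlog
  have hlogb : ((Nat.log 2 n : ℕ) : ℝ) ≤ Real.logb 2 n := Real.natLog_le_logb n 2
  refine ⟨hd, ⟨hlong.1, hlong.2.1.pairwise_lt hS (by omega) hd⟩, ?_, ?_⟩
  · rw [div_le_iff₀ (by push_cast; linarith), mul_comm]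
    exact hlisR
  -- The constant `2 ^ 31` of the time bound also exceeds `2 * 128`, and the rounded logarithm is at
  -- most the real one.
  · rw [div_le_iff₀ (by push_cast; linarith)]
    refine hlisR.trans ?_
    rw [mul_comm ((out ω).length : ℝ)]
    refine mul_le_mul_of_nonneg_right ?_ (Nat.cast_nonneg _)
    push_cast
    linarith
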